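/- Let $M$ be a smooth $n$-dimensional manifold, $\pi:T^*M\to M$ its cotangent bundle, $\vartheta=p_i\,dx^i$ the tautological one-form and $\omega=-d\vartheta$ the canonical symplectic form on $T^*M$; the Hamiltonian vector field $X_H$ of a function $H$ is given by $i_{X_H}\omega=dH$. **Hybrid systems and invariance.** A hybrid system on a manifold $N$ consists of a guard $S\subset N$, a vector field $X$ on $N$ and a reset $\Delta:S\to N$. Its executions follow $X$ until they meet $S$, are then moved by $\Delta$, and continue from there; $\varphi_t$ denotes the time-$t$ map of this hybrid flow, defined at the points whose execution exists up to time $t$ with finitely many resets (at the instant of a reset the state is the one before the reset; for $t<0$, $\varphi_t$ is a local inverse branch of $\varphi_{-t}$, i.e. the execution that starts at $\varphi_t(y)$ is at $y$ after time $-t$). The system preserves a differential form $\alpha$ if $(\varphi_t^*\alpha)_x=\alpha_x$ for all $t\in\mathbb R$ and all $x\notin S$ with $\varphi_t(x)\notin S$ such that $\varphi_t$ is defined and smooth on an open neighbourhood of $x$ disjoint from $S$. **Time-independent problem.** Let $\mathcal U\subset\mathbb R^m$ be closed, $V\supset\mathcal U$ open, $f:M\times V\to TM$ a smooth controlled vector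 field, $\ell:M\times V\to\mathbb R$ a smooth running cost, $S=\{x\in W: h(x)=0\}$, where $W\subset M$ is open, $h:W\to\mathbb R$ is smooth and $dh\neq0$ on $S$, and let $\Delta:S\to M$ be smooth with $S\cap\Delta(S)=\emptyset$. Assume that for all $(x,p)\in T^*M$ the minimum $$H(x,p)=\min_{u\in\mathcal U}\bigl(\ell(x,u)+\langle p,f(x,u)\rangle\bigr)$$ is attained and that $H$ is smooth. Let $S^*=\{z\in T^*M:\pi(z)\in S,\ (\pi^*dh)(X_H(z))>0\}$, and let $\vartheta_H=p_i\,dx^i-H\,dt$ on $\mathbb R\times T^*M$. Let $\tilde\Delta:S^*\to T^*M$ be an extended reset: a smooth map with $\pi\circ\tilde\Delta=\Delta\circ\pi$ and $(\mathrm{Id}\times\tilde\Delta)^*\vartheta_H=\iota^*\vartheta_H$, where $\iota:\mathbb R\times S^*\hookrightarrow\mathbb R\times T^*M$ is the inclusion. Then the hybrid system $(T^*M,S^*,X_H,\tilde\Delta)$ preserves $\omega$. Moreover $\omega^n$ is a volume form (of top degree and nowhere zero), and the system preserves it. **Time-dependent problem.** Let $\mathcal U\subset V$ be as above, let $f$ and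 $\ell$ depend smoothly also on $t\in\mathbb R$, let $S=\{(t,x)\in W:h(t,x)=0\}$, where $W\subset\mathbb R\times M$ is open, $h:W\to\mathbb R$ is smooth and $dh\ne0$ on $S$, and let $\Delta:S\to M$ be smooth with $(t,\Delta(t,x))\notin S$ for $(t,x)\in S$. Assume that the minimum $H(t,x,p)=\min_{u\in\mathcal U}(\ell(t,x,u)+\langle p,f(t,x,u)\rangle)$ is attained everywhere and that $H$ is smooth on $\mathbb R\times T^*M$. Let $X=\partial_t+X_{H(t,\cdot)}$ on $\mathbb R\times T^*M$ and $S^*=\{q\in\mathbb R\times T^*M:(\mathrm{Id}\times\pi)(q)\in S,\ ((\mathrm{Id}\times\pi)^*dh)(X(q))>0\}$. Let $\tilde\Delta:S^*\to T^*M$ be smooth with $\pi(\tilde\Delta(q))=\Delta((\mathrm{Id}\times\pi)(q))$ and such that $\bar\Delta(t,z)=(t,\tilde\Delta(t,z))$ satisfies $\bar\Delta^*\vartheta_H=\iota^*\vartheta_H$ on $S^*$, where $\vartheta_H=p_i\,dx^i-H\,dt$ and $\iota:S^*\hookrightarrow\mathbb R\times T^*M$ is the inclusion. Then the hybrid system $(\mathbb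 R\times T^*M,S^*,X,\bar\Delta)$ preserves $\omega_H=-d\vartheta_H$. Moreover $dt\wedge\omega_H^n$ is a volume form (of top degree and nowhere zero), and the system preserves it. -/

import Mathlib

open scoped Manifold ContDiff Bundle

noncomputable section

/-! ### Exterior algebra on a real vector space -/

/-- The wedge product of two scalar alternating forms (a signed sum over shuffles). -/
def wedge {V : Type*} [AddCommGroup V] [Module ℝ V] {k l : ℕ}
    (a : V [⋀^Fin k]→ₗ[ℝ] ℝ) (b : V [⋀^Fin l]→ₗ[ℝ] ℝ) : V [⋀^Fin (k + l)]→ₗ[ℝ] ℝ :=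
  ((LinearMap.mul' ℝ ℝ).compAlternatingMap (a.domCoprod b)).domDomCongr finSumFinEquiv

/-- The `k`-fold wedge power of a two-form. -/
def wedgePow {V : Type*} [AddCommGroup V] [Module ℝ V] (a : V [⋀^Fin 2]→ₗ[ℝ] ℝ) :
    (k : ℕ) → V [⋀^Fin (2 * k)]→ₗ[ℝ] ℝ
  | 0 => AlternatingMap.constOfIsEmpty ℝ V (Fin 0) (1 : ℝ)
  | k + 1 => wedge (wedgePow a k) a

/-! ### Differential forms and hybrid dynamics on a manifold `N` -/

section General

variable {F : Type*} [NormedAddCommGroup F] [NormedSpace ℝ F] {K : Type*} [TopologicalSpace K]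
  (J : ModelWithCorners ℝ F K) {N : Type*} [TopologicalSpace N] [ChartedSpace K N]

/-- The expression of a `k`-form `α` in the preferred chart at `z₀`: the pullback of `α` by the
inverse of the chart. -/
def formInChart {k : ℕ} (α : (z : N) → TangentSpace J z [⋀^Fin k]→L[ℝ] ℝ) (z₀ : N) (e : F) :
    F [⋀^Fin k]→L[ℝ] ℝ :=
  (α ((extChartAt J z₀).symm e)).compContinuousLinearMap
    (mfderivWithin 𝓘(ℝ, F) J (extChartAt J z₀).symm (Set.range J) e)

/-- The exterior derivative of a `k`-form on a manifold, computed at each point in the preferred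
chart there. -/
def mextDeriv {k : ℕ} (α : (z : N) → TangentSpace J z [⋀^Fin k]→L[ℝ] ℝ) (z₀ : N) :
    TangentSpace J z₀ [⋀^Fin (k + 1)]→L[ℝ] ℝ :=
  (extDerivWithin (formInChart J α z₀) (Set.range J)
      (extChartAt J z₀ z₀)).compContinuousLinearMap
    (mfderiv J 𝓘(ℝ, F) (extChartAt J z₀) z₀)

/-- The exterior derivative of a one-form given as a field of covectors. -/
def mextDerivOne (α : (z : N) → TangentSpace J z →L[ℝ] ℝ) (z : N) :
    TangentSpace J z [⋀^Fin 2]→L[ℝ] ℝ :=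
  mextDeriv J
    (fun y => ContinuousAlternatingMap.ofSubsingleton ℝ (TangentSpace J y) ℝ (0 : Fin 1) (α y)) z

/-- A nowhere vanishing form of top degree. -/
def IsVolumeForm {k : ℕ} (α : (z : N) → TangentSpace J z [⋀^Fin k]→ₗ[ℝ] ℝ) : Prop :=
  Module.finrank ℝ F = k ∧ ∀ z, α z ≠ 0

variable (N) in
/-- The data `(S, X, Δ)` of a hybrid dynamical system on `N`. Only the values of `reset` on the
guard matter. -/
structure HybridSystem where
  guard : Set N
  field : (z : N) → TangentSpace J z
  reset : N → N

variable {J}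

/-- `Y.Reaches t z w`: the execution of `Y` starting at `z` is at `w` after time `t ≥ 0`, having
undergone finitely many resets. It follows the vector field until it meets the guard, is then moved
by the reset, and goes on from there. At the instant of a reset the state is the one before the
reset. -/
inductive HybridSystem.Reaches (Y : HybridSystem J N) : ℝ → N → N → Prop
  | flow (t : ℝ) (γ : ℝ → N) (ht : 0 ≤ t) (hγ : IsMIntegralCurveOn γ Y.field (Set.Icc 0 t))
      (hS : ∀ s ∈ Set.Ico 0 t, γ s ∉ Y.guard) : Y.Reaches t (γ 0) (γ t)
  | reset (τ t : ℝ) (γ : ℝ → N) (w : N) (hτ : 0 ≤ τ) (ht : 0 < t)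
      (hγ : IsMIntegralCurveOn γ Y.field (Set.Icc 0 τ))
      (hS : ∀ s ∈ Set.Ico 0 τ, γ s ∉ Y.guard) (hτS : γ τ ∈ Y.guard)
      (hw : Y.Reaches t (Y.reset (γ τ)) w) : Y.Reaches (τ + t) (γ 0) w

/-- `Φ` is, on `U`, the time-`t` map of the hybrid flow. For `t < 0` this means that the execution
starting at `Φ y` is at `y` after time `-t`. -/
def HybridSystem.IsFlowMapOn (Y : HybridSystem J N) (t : ℝ) (Φ : N → N) (U : Set N) : Prop :=
  ∀ y ∈ U, (0 ≤ t → Y.Reaches t y (Φ y)) ∧ (t < 0 → Y.Reaches (-t) (Φ y) y)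

/-- The form `α` is preserved along the hybrid flow: `(φ_t)^* α = α` at every point `x` off the
guard with `φ_t x` off the guard, near which the time-`t` map `φ_t` of the hybrid flow is defined
and smooth. -/
def HybridSystem.Preserves (Y : HybridSystem J N) {k : ℕ}
    (α : (z : N) → TangentSpace J z [⋀^Fin k]→ₗ[ℝ] ℝ) : Prop :=
  ∀ (t : ℝ) (U : Set N) (Φ : N → N), IsOpen U → Disjoint U Y.guard → Y.IsFlowMapOn t Φ U →
    ContMDiffOn J J ∞ Φ U → ∀ x ∈ U, Φ x ∉ Y.guard →
      (α (Φ x)).compLinearMap (mfderiv J J Φ x).toLinearMap = α x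

end General

/-! ### The cotangent bundle -/

/-- The cotangent bundle `T^*M` of an `n`-dimensional manifold. -/
abbrev Cotangent (n : ℕ) (M : Type*) [TopologicalSpace M]
    [ChartedSpace (EuclideanSpace ℝ (Fin n)) M] :=
  Bundle.TotalSpace (EuclideanSpace ℝ (Fin n) →L[ℝ] ℝ)
    (fun x : M => TangentSpace (𝓡 n) x →L[ℝ] Bundle.Trivial M ℝ x)

/-- The model of `T^*M`. -/
abbrev cotModel (n : ℕ) :=
  (𝓡 n).prod 𝓘(ℝ, EuclideanSpace ℝ (Fin n) →L[ℝ] ℝ)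

/-- The model of `ℝ × T^*M`. -/
abbrev extModel (n : ℕ) := 𝓘(ℝ, ℝ).prod (cotModel n)

section Cotangent

variable {n : ℕ} {M : Type*} [TopologicalSpace M] [ChartedSpace (EuclideanSpace ℝ (Fin n)) M]
  [IsManifold (𝓡 n) ∞ M]

/-- The projection `π : T^*M → M`. -/
def cotProj (z : Cotangent n M) : M := z.proj

/-- The projection `id × π : ℝ × T^*M → ℝ × M`. -/
def extProj (q : ℝ × Cotangent n M) : ℝ × M := (q.1, q.2.proj)

/-- The covector `p` of a point `z = (x, p)` of `T^*M`. -/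
def covector (z : Cotangent n M) : TangentSpace (𝓡 n) (cotProj z) →L[ℝ] ℝ := z.snd

/-- The tautological one-form `ϑ = p_i dx^i`. -/
def tautologicalForm (z : Cotangent n M) : TangentSpace (cotModel n) z →L[ℝ] ℝ :=
  (covector z).comp (mfderiv (cotModel n) (𝓡 n) cotProj z)

/-- The canonical symplectic form `ω = -dϑ = dx^i ∧ dp_i`. -/
def symplecticForm (z : Cotangent n M) : TangentSpace (cotModel n) z [⋀^Fin 2]→L[ℝ] ℝ :=
  -mextDerivOne (cotModel n) tautologicalForm z

/-- The Hamiltonian vector field of `H`, that is, the vector field `X` with `ω(X, ·) = dH`. -/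
def hamiltonianField (H : Cotangent n M → ℝ) (z : Cotangent n M) : TangentSpace (cotModel n) z :=
  Classical.epsilon fun v => ∀ w, symplecticForm z ![v, w] = mvfderiv (cotModel n) H z w

/-- The one-form `dt` on `ℝ × T^*M`. -/
def dtForm (q : ℝ × Cotangent n M) : TangentSpace (extModel n) q →L[ℝ] ℝ :=
  mvfderiv (extModel n) Prod.fst q

/-- The action form `ϑ_H = p_i dx^i - H dt` on `ℝ × T^*M`. -/
def actionForm (H : ℝ × Cotangent n M → ℝ) (q : ℝ × Cotangent n M) :
    TangentSpace (extModel n) q →L[ℝ] ℝ :=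
  (tautologicalForm q.2).comp (mfderiv (extModel n) (cotModel n) Prod.snd q) - H q • dtForm q

/-- The two-form `ω_H = -dϑ_H` on `ℝ × T^*M`. -/
def actionTwoForm (H : ℝ × Cotangent n M → ℝ) (q : ℝ × Cotangent n M) :
    TangentSpace (extModel n) q [⋀^Fin 2]→L[ℝ] ℝ :=
  -mextDerivOne (extModel n) (actionForm H) q

/-- The form `ω^n` on `T^*M`. -/
def liouvilleForm (z : Cotangent n M) :
    TangentSpace (cotModel n) z [⋀^Fin (2 * n)]→ₗ[ℝ] ℝ :=
  wedgePow (symplecticForm z).toAlternatingMap n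

/-- The form `dt ∧ ω_H^n` on `ℝ × T^*M`. -/
def extLiouvilleForm (H : ℝ × Cotangent n M → ℝ) (q : ℝ × Cotangent n M) :
    TangentSpace (extModel n) q [⋀^Fin (1 + 2 * n)]→ₗ[ℝ] ℝ :=
  wedge (AlternatingMap.ofSubsingleton ℝ (TangentSpace (extModel n) q) ℝ (0 : Fin 1)
      (dtForm q).toLinearMap)
    (wedgePow (actionTwoForm H q).toAlternatingMap n)

/-- The suspended Hamiltonian vector field `∂/∂t + X_{H_t}` on `ℝ × T^*M`. -/
def extHamiltonianField (H : ℝ × Cotangent n M → ℝ) (q : ℝ × Cotangent n M) :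
    TangentSpace (extModel n) q :=
  ((1 : ℝ), hamiltonianField (fun z => H (q.1, z)) q.2)

end Cotangent

/-! ### Time-independent hybrid optimal control problems -/

/-- A time-independent hybrid control system on `M` together with a running cost. The guard is the
zero set `S` of a smooth function `h`, defined on an open set `W`, whose differential does not
vanish on `S`; so `S` is an embedded hypersurface. Only the values of `f`, `cost` at controls in `V`,
of `h` on `W` and of `Δ` on `S` matter. -/
structure HybridControlSystem (n m : ℕ) (M : Type*) [TopologicalSpace M]
    [ChartedSpace (EuclideanSpace ℝ (Fin n)) M] [IsManifold (𝓡 n) ∞ M] where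
  /-- admissible controls -/
  U : Set (EuclideanSpace ℝ (Fin m))
  isClosed_U : IsClosed U
  V : Set (EuclideanSpace ℝ (Fin m))
  isOpen_V : IsOpen V
  U_subset_V : U ⊆ V
  /-- controlled vector field -/
  f : (x : M) → EuclideanSpace ℝ (Fin m) → TangentSpace (𝓡 n) x
  smooth_f : ContMDiffOn ((𝓡 n).prod (𝓡 m)) (𝓡 n).tangent ∞
    (fun q : M × EuclideanSpace ℝ (Fin m) => (⟨q.1, f q.1 q.2⟩ : TangentBundle (𝓡 n) M))
    (Set.univ ×ˢ V)
  /-- running cost -/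
  cost : M → EuclideanSpace ℝ (Fin m) → ℝ
  smooth_cost : ContMDiffOn ((𝓡 n).prod (𝓡 m)) 𝓘(ℝ, ℝ) ∞
    (fun q : M × EuclideanSpace ℝ (Fin m) => cost q.1 q.2) (Set.univ ×ˢ V)
  W : Set M
  isOpen_W : IsOpen W
  h : M → ℝ
  smooth_h : ContMDiffOn (𝓡 n) 𝓘(ℝ, ℝ) ∞ h W
  dh_ne_zero : ∀ x ∈ W, h x = 0 → mvfderiv (𝓡 n) h x ≠ 0
  /-- reset -/
  Δ : M → M
  smooth_Δ : ContMDiffOn (𝓡 n) (𝓡 n) ∞ Δ {x ∈ W | h x = 0}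
  Δ_notMem : ∀ x ∈ W, h x = 0 → Δ x ∉ {x ∈ W | h x = 0}

namespace HybridControlSystem

variable {n m : ℕ} {M : Type*} [TopologicalSpace M] [ChartedSpace (EuclideanSpace ℝ (Fin n)) M]
  [IsManifold (𝓡 n) ∞ M] (C : HybridControlSystem n m M)

/-- The guard `S = h⁻¹(0)`. -/
def S : Set M := {x ∈ C.W | C.h x = 0}

/-- The control Hamiltonian `Ĥ(x, p, u) = ℓ(x, u) + ⟨p, f(x, u)⟩`. -/
def controlHamiltonian (z : Cotangent n M) (u : EuclideanSpace ℝ (Fin m)) : ℝ :=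
  C.cost (cotProj z) u + covector z (C.f (cotProj z) u)

/-- The optimal Hamiltonian `H(x, p) = min_u Ĥ(x, p, u)`. -/
def H (z : Cotangent n M) : ℝ := sInf (C.controlHamiltonian z '' C.U)

/-- The minimum that defines the optimal Hamiltonian is attained, and the optimal Hamiltonian is
smooth. -/
structure IsRegular : Prop where
  exists_min : ∀ z : Cotangent n M, ∃ u ∈ C.U, IsMinOn (C.controlHamiltonian z) C.U u
  smooth_H : ContMDiff (cotModel n) 𝓘(ℝ, ℝ) ∞ C.H

/-- `π^* dh` as a covector at `z ∈ T^*M`. -/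
def dhPull (z : Cotangent n M) : TangentSpace (cotModel n) z →L[ℝ] ℝ :=
  (mvfderiv (𝓡 n) C.h (cotProj z)).comp (mfderiv (cotModel n) (𝓡 n) cotProj z)

/-- The extended guard `S^*` of outward pointing momenta. -/
def extendedGuard : Set (Cotangent n M) :=
  {z | cotProj z ∈ C.S ∧ 0 < C.dhPull z (hamiltonianField C.H z)}

/-- `R : S^* → T^*M` is smooth, covers `Δ`, and satisfies `(id × R)^* ϑ_H = ι^* ϑ_H` on
`ℝ × S^*`. The tangent space of `ℝ × S^*` at `(t, z)` consists of the vectors whose `T^*M`-component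
is annihilated by `π^* dh`. -/
structure IsExtendedReset (R : Cotangent n M → Cotangent n M) : Prop where
  smooth : ContMDiffOn (cotModel n) (cotModel n) ∞ R C.extendedGuard
  proj : ∀ z ∈ C.extendedGuard, cotProj (R z) = C.Δ (cotProj z)
  action : ∀ (t : ℝ), ∀ z ∈ C.extendedGuard, ∀ v : TangentSpace (extModel n) (t, z),
    C.dhPull z (mfderiv (extModel n) (cotModel n) Prod.snd (t, z) v) = 0 →
    actionForm (fun q => C.H q.2) (t, R z)
        (mfderivWithin (extModel n) (extModel n) (Prod.map id R)
          (Set.univ ×ˢ C.extendedGuard) (t, z) v) =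
      actionForm (fun q => C.H q.2) (t, z) v

/-- The lifted hybrid Hamiltonian system `(T^*M, S^*, X_H, R)`. -/
def lift (R : Cotangent n M → Cotangent n M) : HybridSystem (cotModel n) (Cotangent n M) where
  guard := C.extendedGuard
  field := hamiltonianField C.H
  reset := R

end HybridControlSystem

/-! ### Time-dependent hybrid optimal control problems -/

/-- A time-dependent hybrid control system on `M` together with a running cost. The guard is the
zero set `S ⊆ ℝ × M` of a smooth function `h`, defined on an open set `W ⊆ ℝ × M`, whose
differential does not vanish on `S`. At `(t, x) ∈ S` the state `x` is reset to `Δ (t, x)`. -/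
structure TimeHybridControlSystem (n m : ℕ) (M : Type*) [TopologicalSpace M]
    [ChartedSpace (EuclideanSpace ℝ (Fin n)) M] [IsManifold (𝓡 n) ∞ M] where
  /-- admissible controls -/
  U : Set (EuclideanSpace ℝ (Fin m))
  isClosed_U : IsClosed U
  V : Set (EuclideanSpace ℝ (Fin m))
  isOpen_V : IsOpen V
  U_subset_V : U ⊆ V
  /-- controlled vector field -/
  f : ℝ → (x : M) → EuclideanSpace ℝ (Fin m) → TangentSpace (𝓡 n) x
  smooth_f : ContMDiffOn ((𝓘(ℝ, ℝ).prod (𝓡 n)).prod (𝓡 m)) (𝓡 n).tangent ∞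
    (fun q : (ℝ × M) × EuclideanSpace ℝ (Fin m) =>
      (⟨q.1.2, f q.1.1 q.1.2 q.2⟩ : TangentBundle (𝓡 n) M))
    (Set.univ ×ˢ V)
  /-- running cost -/
  cost : ℝ → M → EuclideanSpace ℝ (Fin m) → ℝ
  smooth_cost : ContMDiffOn ((𝓘(ℝ, ℝ).prod (𝓡 n)).prod (𝓡 m)) 𝓘(ℝ, ℝ) ∞
    (fun q : (ℝ × M) × EuclideanSpace ℝ (Fin m) => cost q.1.1 q.1.2 q.2) (Set.univ ×ˢ V)
  W : Set (ℝ × M)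
  isOpen_W : IsOpen W
  h : ℝ × M → ℝ
  smooth_h : ContMDiffOn (𝓘(ℝ, ℝ).prod (𝓡 n)) 𝓘(ℝ, ℝ) ∞ h W
  dh_ne_zero : ∀ y ∈ W, h y = 0 → mvfderiv (𝓘(ℝ, ℝ).prod (𝓡 n)) h y ≠ 0
  /-- reset -/
  Δ : ℝ × M → M
  smooth_Δ : ContMDiffOn (𝓘(ℝ, ℝ).prod (𝓡 n)) (𝓡 n) ∞ Δ {y ∈ W | h y = 0}
  Δ_notMem : ∀ y ∈ W, h y = 0 → (y.1, Δ y) ∉ {y ∈ W | h y = 0}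

namespace TimeHybridControlSystem

variable {n m : ℕ} {M : Type*} [TopologicalSpace M] [ChartedSpace (EuclideanSpace ℝ (Fin n)) M]
  [IsManifold (𝓡 n) ∞ M] (C : TimeHybridControlSystem n m M)

/-- The guard `S = h⁻¹(0) ⊆ ℝ × M`. -/
def S : Set (ℝ × M) := {y ∈ C.W | C.h y = 0}

/-- The control Hamiltonian `Ĥ(t, x, p, u) = ℓ(t, x, u) + ⟨p, f(t, x, u)⟩`. -/
def controlHamiltonian (q : ℝ × Cotangent n M) (u : EuclideanSpace ℝ (Fin m)) : ℝ :=
  C.cost q.1 (cotProj q.2) u + covector q.2 (C.f q.1 (cotProj q.2) u)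

/-- The optimal Hamiltonian `H(t, x, p) = min_u Ĥ(t, x, p, u)`. -/
def H (q : ℝ × Cotangent n M) : ℝ := sInf (C.controlHamiltonian q '' C.U)

/-- The minimum that defines the optimal Hamiltonian is attained, and the optimal Hamiltonian is
smooth. -/
structure IsRegular : Prop where
  exists_min : ∀ q : ℝ × Cotangent n M, ∃ u ∈ C.U, IsMinOn (C.controlHamiltonian q) C.U u
  smooth_H : ContMDiff (extModel n) 𝓘(ℝ, ℝ) ∞ C.H

/-- `(id × π)^* dh` as a covector at `q ∈ ℝ × T^*M`. -/
def dhPull (q : ℝ × Cotangent n M) : TangentSpace (extModel n) q →L[ℝ] ℝ :=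
  (mvfderiv (𝓘(ℝ, ℝ).prod (𝓡 n)) C.h (extProj q)).comp
    (mfderiv (extModel n) (𝓘(ℝ, ℝ).prod (𝓡 n)) extProj q)

/-- The extended guard `S^* ⊆ ℝ × T^*M`, where `h` increases along the suspended Hamiltonian
vector field. -/
def extendedGuard : Set (ℝ × Cotangent n M) :=
  {q | extProj q ∈ C.S ∧ 0 < C.dhPull q (extHamiltonianField C.H q)}

/-- The map `(t, z) ↦ (t, R (t, z))`. -/
def timeReset (R : ℝ × Cotangent n M → Cotangent n M) (q : ℝ × Cotangent n M) :
    ℝ × Cotangent n M := (q.1, R q)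

/-- `R : S^* → T^*M` is smooth, covers `Δ`, and the map `(t, z) ↦ (t, R (t, z))` from `S^*` to
`ℝ × T^*M` pulls `ϑ_H` back to `ι^* ϑ_H`. The tangent space of `S^*` at `q` is the kernel of
`(id × π)^* dh`. -/
structure IsExtendedReset (R : ℝ × Cotangent n M → Cotangent n M) : Prop where
  smooth : ContMDiffOn (extModel n) (cotModel n) ∞ R C.extendedGuard
  proj : ∀ q ∈ C.extendedGuard, cotProj (R q) = C.Δ (extProj q)
  action : ∀ q ∈ C.extendedGuard, ∀ v : TangentSpace (extModel n) q, C.dhPull q v = 0 →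
    actionForm C.H (timeReset R q)
        (mfderivWithin (extModel n) (extModel n) (timeReset R) C.extendedGuard q v) =
      actionForm C.H q v

/-- The lifted hybrid Hamiltonian system on `ℝ × T^*M`. -/
def lift (R : ℝ × Cotangent n M → Cotangent n M) :
    HybridSystem (extModel n) (ℝ × Cotangent n M) where
  guard := C.extendedGuard
  field := extHamiltonianField C.H
  reset := timeReset R

end TimeHybridControlSystem

end

/-!
The action form `ϑ_H` and the field `∂_t + X_H` on `ℝ × T^*M` satisfy `i_X dϑ_H = 0`, and nothing
else about them matters: let `θ` be a one-form on a manifold, `X` a vector field in the kernel of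
`dθ`, and let the reset preserve the restriction of `θ` to a hypersurface transverse to `X`. Along a
local flow `θ` changes by an exact form, because `L_X θ = d (i_X θ)`. The map that flows to the
guard differs from a local flow by a displacement along `X`, which `dθ` does not see, and the reset
preserves `dθ` on the guard. So each local step of an execution preserves `dθ`.

The hybrid flow itself need not be a composition of such steps near a given point, since the
executions of nearby points may follow different itineraries. There are only countably many
itineraries in a countable family of local steps, so by Baire's theorem the flow agrees with a
single composition near each point of a dense open set, and `dθ` is preserved everywhere by
continuity.

A time-independent system is suspended over `ℝ`, and the symplectic form is recovered as the
restriction of `-dϑ_H` to the vectors tangent to `T^*M`.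
-/

noncomputable section

/-! ### Wedge powers of a two-form -/

section Exterior

variable {V V' : Type*} [AddCommGroup V] [Module ℝ V] [AddCommGroup V'] [Module ℝ V']

theorem domCoprod_compLinearMap {R N₁ N₂ U U' ιa ιb : Type*} [Fintype ιa] [Fintype ιb]
    [DecidableEq ιa] [DecidableEq ιb] [CommRing R] [AddCommGroup N₁] [Module R N₁]
    [AddCommGroup N₂] [Module R N₂] [AddCommGroup U] [Module R U] [AddCommGroup U'] [Module R U']
    (a : U [⋀^ιa]→ₗ[R] N₁) (b : U [⋀^ιb]→ₗ[R] N₂) (L : U' →ₗ[R] U) :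
    (a.domCoprod b).compLinearMap L = (a.compLinearMap L).domCoprod (b.compLinearMap L) := by
  ext v
  simp only [AlternatingMap.compLinearMap_apply, AlternatingMap.domCoprod_apply,
    sum_apply]
  refine Finset.sum_congr rfl fun σ _ => ?_
  induction σ using Quotient.inductionOn' with
  | h σ => rfl

theorem wedge_compLinearMap {k l : ℕ} (a : V [⋀^Fin k]→ₗ[ℝ] ℝ) (b : V [⋀^Fin l]→ₗ[ℝ] ℝ)
    (L : V' →ₗ[ℝ] V) :
    (wedge a b).compLinearMap L = wedge (a.compLinearMap L) (b.compLinearMap L) := by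
  ext v
  simp only [wedge, ← domCoprod_compLinearMap]
  rfl

theorem wedge_zero_right {k l : ℕ} (a : V [⋀^Fin k]→ₗ[ℝ] ℝ) :
    wedge a (0 : V [⋀^Fin l]→ₗ[ℝ] ℝ) = 0 := by
  have h : a.domCoprod (0 : V [⋀^Fin l]→ₗ[ℝ] ℝ) = 0 := by
    rw [← AlternatingMap.domCoprod'_apply, TensorProduct.tmul_zero, map_zero]
  ext v
  simp [wedge, h]

theorem wedgePow_compLinearMap (W : V [⋀^Fin 2]→ₗ[ℝ] ℝ) (L : V' →ₗ[ℝ] V) (k : ℕ) :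
    (wedgePow W k).compLinearMap L = wedgePow (W.compLinearMap L) k := by
  induction k with
  | zero => rfl
  | succ k ih => exact (wedge_compLinearMap _ _ _).trans (by rw [ih]; rfl)

/-- The tensor product `A ⊗ B` of two scalar multilinear maps. Its first `k` arguments are those
of `A`. -/
def tensor {k l : ℕ} (A : MultilinearMap ℝ (fun _ : Fin k => V) ℝ)
    (B : MultilinearMap ℝ (fun _ : Fin l => V) ℝ) :
    MultilinearMap ℝ (fun _ : Fin (k + l) => V) ℝ :=
  ((LinearMap.mul' ℝ ℝ).compMultilinearMap (A.domCoprod B)).domDomCongr finSumFinEquiv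

theorem tensor_apply {k l : ℕ} (A : MultilinearMap ℝ (fun _ : Fin k => V) ℝ)
    (B : MultilinearMap ℝ (fun _ : Fin l => V) ℝ) (v : Fin (k + l) → V) :
    tensor A B v = A (fun i => v (Fin.castAdd l i)) * B (fun i => v (Fin.natAdd k i)) := by
  simp [tensor]

theorem alternatization_domDomCongr {R N U ι ι' : Type*} [Fintype ι] [Fintype ι']
    [DecidableEq ι] [DecidableEq ι'] [Semiring R] [AddCommGroup N] [Module R N] [AddCommMonoid U]
    [Module R U] (A : MultilinearMap R (fun _ : ι => U) N) (e : ι ≃ ι') :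
    (A.domDomCongr e).alternatization = A.alternatization.domDomCongr e := by
  ext v
  simp only [MultilinearMap.alternatization_apply, AlternatingMap.domDomCongr_apply,
    MultilinearMap.domDomCongr_apply]
  refine (Fintype.sum_equiv e.permCongr _ _ fun σ => ?_).symm
  simp [Equiv.Perm.sign_permCongr]

theorem wedge_alternatization {k l : ℕ} (A : MultilinearMap ℝ (fun _ : Fin k => V) ℝ)
    (B : MultilinearMap ℝ (fun _ : Fin l => V) ℝ) :
    wedge A.alternatization B.alternatization = (tensor A B).alternatization := by
  rw [tensor, alternatization_domDomCongr,
    LinearMap.compMultilinearMap_alternatization, MultilinearMap.domCoprod_alternization]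
  rfl

/-- The tensor power `B ⊗ ⋯ ⊗ B` of a bilinear map. -/
def tensorPow (B : MultilinearMap ℝ (fun _ : Fin 2 => V) ℝ) :
    (k : ℕ) → MultilinearMap ℝ (fun _ : Fin (2 * k) => V) ℝ
  | 0 => MultilinearMap.constOfIsEmpty ℝ (fun _ : Fin 0 => V) 1
  | k + 1 => tensor (tensorPow B k) B

theorem wedgePow_alternatization (B : MultilinearMap ℝ (fun _ : Fin 2 => V) ℝ) (k : ℕ) :
    wedgePow B.alternatization k = (tensorPow B k).alternatization := by
  induction k with
  | zero =>
    ext v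
    have : Unique (Equiv.Perm (Fin (2 * 0))) := inferInstanceAs (Unique (Equiv.Perm (Fin 0)))
    rw [MultilinearMap.alternatization_apply, Fintype.sum_unique,
      ← Unique.eq_default (1 : Equiv.Perm (Fin (2 * 0)))]
    simp [wedgePow, tensorPow]
  | succ k ih =>
    rw [tensorPow, ← wedge_alternatization, ← ih]
    rfl

/-- The position of the `j`-th argument of the `i`-th factor in a tensor power of a bilinear
map. -/
def pairIndex {k : ℕ} (i : Fin k) (j : Fin 2) : Fin (2 * k) := ⟨2 * i + j, by omega⟩

theorem tensorPow_apply (B : MultilinearMap ℝ (fun _ : Fin 2 => V) ℝ) (k : ℕ)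
    (v : Fin (2 * k) → V) : tensorPow B k v = ∏ i : Fin k, B (fun j => v (pairIndex i j)) := by
  induction k with
  | zero => rfl
  | succ k ih =>
    rw [tensorPow, tensor_apply, ih, Fin.prod_univ_castSucc]
    rfl

/-- The enumeration of `1 + 2 k` indices as a single index followed by `k` pairs. -/
def pairEquiv (k : ℕ) : Fin 1 ⊕ (Fin k × Fin 2) ≃ Fin (1 + 2 * k) :=
  (Equiv.sumCongr (Equiv.refl _) (finProdFinEquiv.trans (finCongr (mul_comm k 2)))).trans
    finSumFinEquiv

theorem pairEquiv_inr {k : ℕ} (i : Fin k) (j : Fin 2) :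
    pairEquiv k (Sum.inr (i, j)) = Fin.natAdd 1 (pairIndex i j) := by
  ext
  simp [pairEquiv, pairIndex, add_comm]

theorem pairEquiv_inl {k : ℕ} (i : Fin 1) : pairEquiv k (Sum.inl i) = Fin.castAdd (2 * k) i := by
  simp [pairEquiv]

theorem tensor_tensorPow_apply_comp_pairEquiv_symm {k : ℕ}
    (A : MultilinearMap ℝ (fun _ : Fin 1 => V) ℝ) (B : MultilinearMap ℝ (fun _ : Fin 2 => V) ℝ)
    (c : Fin 1 ⊕ (Fin k × Fin 2) → V) :
    tensor A (tensorPow B k) (fun i => c ((pairEquiv k).symm i)) =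
      A (fun i => c (Sum.inl i)) * ∏ i, B (fun j => c (Sum.inr (i, j))) := by
  simp only [tensor_apply, tensorPow_apply, ← pairEquiv_inl, ← pairEquiv_inr,
    Equiv.symm_apply_apply]

theorem sign_eq_prod_of_permutes_pairs {ι κ ν : Type*} [DecidableEq ι] [Fintype ι]
    [DecidableEq κ] [Fintype κ] [DecidableEq ν] [Fintype ν] {τ : Equiv.Perm (ν ⊕ (κ × ι))}
    {p : κ → κ} {s : κ → Equiv.Perm ι} (hι : Even (Fintype.card ι)) [Nonempty ι]
    (hinl : ∀ i, τ (Sum.inl i) = Sum.inl i)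
    (hinr : ∀ i j, τ (Sum.inr (i, j)) = Sum.inr (p i, s i j)) :
    Equiv.Perm.sign τ = ∏ i, Equiv.Perm.sign (s i) := by
  have hp : Function.Injective p := by
    intro i i' hii
    obtain ⟨j⟩ := ‹Nonempty ι›
    have : τ (Sum.inr (i, (s i).symm j)) = τ (Sum.inr (i', (s i').symm j)) := by
      simp [hinr, hii]
    exact congrArg Prod.fst (Sum.inr_injective (τ.injective this))
  let q : Equiv.Perm κ := Equiv.ofBijective p (Finite.injective_iff_bijective.1 hp)
  have hτ : τ = Equiv.Perm.sumCongr (1 : Equiv.Perm ν)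
      (Equiv.prodCongrLeft (fun _ : ι => q) * Equiv.prodCongrRight s) := by
    ext x
    rcases x with i | ⟨i, j⟩
    · simp [hinl]
    · simp [hinr, q, Equiv.prodCongrLeft, Equiv.prodCongrRight]
  rw [hτ, Equiv.Perm.sign_sumCongr, Equiv.Perm.sign_mul, Equiv.Perm.sign_prodCongrLeft,
    Equiv.Perm.sign_prodCongrRight, Equiv.Perm.sign_one, one_mul, Finset.prod_const,
    Finset.card_univ, Int.units_pow_eq_pow_mod_two, Nat.even_iff.1 hι, pow_zero, one_mul]

theorem wedge_wedgePow_apply_comp_pairEquiv_symm (a : V →ₗ[ℝ] ℝ) (W : V [⋀^Fin 2]→ₗ[ℝ] ℝ)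
    {k : ℕ} (c : Fin 1 ⊕ (Fin k × Fin 2) → V) :
    wedge (AlternatingMap.ofSubsingleton ℝ V ℝ (0 : Fin 1) a) (wedgePow W k)
        (fun i => c ((pairEquiv k).symm i)) =
      (2⁻¹ : ℝ) ^ k * ∑ τ : Equiv.Perm (Fin 1 ⊕ (Fin k × Fin 2)), Equiv.Perm.sign τ •
        (a (c (τ (Sum.inl 0))) * ∏ i, W (fun j => c (τ (Sum.inr (i, j))))) := by
  let A : MultilinearMap ℝ (fun _ : Fin 1 => V) ℝ :=
    MultilinearMap.ofSubsingleton ℝ V ℝ (0 : Fin 1) a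
  let B : MultilinearMap ℝ (fun _ : Fin 2 => V) ℝ := ((2⁻¹ : ℝ) • W).toMultilinearMap
  have hA : AlternatingMap.ofSubsingleton ℝ V ℝ (0 : Fin 1) a = A.alternatization := by
    ext v
    simp [MultilinearMap.alternatization_apply, A]
  have hB : W = B.alternatization := by
    rw [AlternatingMap.coe_alternatization]
    ext v
    simp
  rw [hA, hB, wedgePow_alternatization, wedge_alternatization, ← hB,
    MultilinearMap.alternatization_apply, ← (pairEquiv k).permCongr.sum_comp, Finset.mul_sum]
  refine Finset.sum_congr rfl fun τ _ => ?_
  have hval := tensor_tensorPow_apply_comp_pairEquiv_symm A B (c ∘ τ)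
  simp only [Equiv.Perm.sign_permCongr, MultilinearMap.domDomCongr_apply,
    Equiv.permCongr_apply, Equiv.symm_apply_apply, Function.comp_apply] at hval ⊢
  rw [hval]
  simp only [A, B, MultilinearMap.ofSubsingleton_apply_apply, AlternatingMap.coe_multilinearMap,
    AlternatingMap.smul_apply, smul_eq_mul, Finset.prod_mul_distrib, Finset.prod_const,
    Finset.card_univ, Fintype.card_fin]
  rw [mul_smul_comm, mul_left_comm]

/-- Vectors `e i`, `f i` on which the two-form `W` has its Darboux normal form. -/
structure IsDarbouxFamily {ι : Type*} [DecidableEq ι] (W : V [⋀^Fin 2]→ₗ[ℝ] ℝ)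
    (e f : ι → V) : Prop where
  apply_left : ∀ i j, W ![e i, e j] = 0
  apply_right : ∀ i j, W ![f i, f j] = 0
  apply_left_right : ∀ i j, W ![e i, f j] = if i = j then 1 else 0

namespace IsDarbouxFamily

section

variable {ι : Type*} [DecidableEq ι] {W : V [⋀^Fin 2]→ₗ[ℝ] ℝ} {e f : ι → V}

theorem apply_right_left (h : IsDarbouxFamily W e f) (i j : ι) :
    W ![f i, e j] = if i = j then -1 else 0 := by
  have hswap := W.map_swap ![e j, f i] (show (0 : Fin 2) ≠ 1 by decide)
  rw [show ![e j, f i] ∘ Equiv.swap (0 : Fin 2) 1 = ![f i, e j] by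
    ext x; fin_cases x <;> rfl, h.apply_left_right] at hswap
  rw [hswap]
  by_cases hij : i = j
  · simp [hij]
  · simp [hij, Ne.symm hij]

theorem exists_perm_of_apply_ne_zero (h : IsDarbouxFamily W e f) {x y : ι × Fin 2}
    (hxy : W ![![e x.1, f x.1] x.2, ![e y.1, f y.1] y.2] ≠ 0) :
    y.1 = x.1 ∧ ∃ s : Equiv.Perm (Fin 2), s 0 = x.2 ∧ s 1 = y.2 := by
  obtain ⟨i, j⟩ := x
  obtain ⟨i', j'⟩ := y
  have hii : i = i' := by
    by_contra hii
    fin_cases j <;> fin_cases j' <;>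
      simp [h.apply_left, h.apply_right, h.apply_left_right, h.apply_right_left, hii] at hxy
  refine ⟨hii.symm, ?_⟩
  fin_cases j <;> fin_cases j'
  · simp [h.apply_left] at hxy
  · exact ⟨1, rfl, rfl⟩
  · exact ⟨Equiv.swap 0 1, rfl, rfl⟩
  · simp [h.apply_right] at hxy

theorem apply_perm (h : IsDarbouxFamily W e f) (i : ι) (s : Equiv.Perm (Fin 2)) :
    W (fun j => ![e i, f i] (s j)) = Equiv.Perm.sign s := by
  rw [show (fun j => ![e i, f i] (s j)) = ![e i, f i] ∘ s from rfl, W.map_perm,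
    h.apply_left_right, if_pos rfl]
  simp [Units.smul_def]

end

variable {k : ℕ} {W : V [⋀^Fin 2]→ₗ[ℝ] ℝ} {e f : Fin k → V} {a : V →ₗ[ℝ] ℝ} {T : V}

/-- The permutations `τ` that contribute to the value of `a ∧ W ∧ ⋯ ∧ W` permute the pairs
`(e i, f i)` and the members of each pair; the signs of the latter permutations cancel. -/
theorem sign_smul_mul_prod_eq (h : IsDarbouxFamily W e f) (he : ∀ i, a (e i) = 0)
    (hf : ∀ i, a (f i) = 0) {c : Fin 1 ⊕ (Fin k × Fin 2) → V}
    (hc : c = Sum.elim (fun _ => T) fun x => ![e x.1, f x.1] x.2)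
    {τ : Equiv.Perm (Fin 1 ⊕ (Fin k × Fin 2))}
    (hτ : a (c (τ (Sum.inl 0))) * ∏ i, W (fun j => c (τ (Sum.inr (i, j)))) ≠ 0) :
    Equiv.Perm.sign τ • (a (c (τ (Sum.inl 0))) * ∏ i, W (fun j => c (τ (Sum.inr (i, j))))) =
      a T := by
  subst hc
  obtain ⟨ha, hW⟩ := mul_ne_zero_iff.1 hτ
  rw [Finset.prod_ne_zero_iff] at hW
  have hinl : τ (Sum.inl 0) = Sum.inl 0 := by
    rcases hτ0 : τ (Sum.inl 0) with i | ⟨i, j⟩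
    · rw [Subsingleton.elim i 0]
    · rw [hτ0] at ha
      fin_cases j <;> simp [he, hf] at ha
  have hinr : ∀ i j, ∃ x, τ (Sum.inr (i, j)) = Sum.inr x := by
    intro i j
    rcases hij : τ (Sum.inr (i, j)) with l | x
    · rw [Subsingleton.elim l 0, ← hinl] at hij
      simpa using τ.injective hij
    · exact ⟨x, rfl⟩
  choose x hx using hinr
  have hpair : ∀ i, (x i 1).1 = (x i 0).1 ∧ ∃ s : Equiv.Perm (Fin 2), s 0 = (x i 0).2 ∧
      s 1 = (x i 1).2 := by
    intro i
    refine h.exists_perm_of_apply_ne_zero ?_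
    convert hW i (Finset.mem_univ i) using 2
    ext j
    fin_cases j <;> simp [hx]
  choose hfst s hs₀ hs₁ using hpair
  have hperm : ∀ i j, τ (Sum.inr (i, j)) = Sum.inr ((x i 0).1, s i j) := by
    intro i j
    rw [hx]
    fin_cases j
    · simp [hs₀]
    · simp [hs₁, ← hfst]
  rw [sign_eq_prod_of_permutes_pairs (by decide)
    (fun i => by rw [Subsingleton.elim i 0, hinl]) hperm, hinl]
  simp only [hperm, Sum.elim_inl, Sum.elim_inr, h.apply_perm, Units.smul_def, zsmul_eq_mul]
  rw [Units.coe_prod, Int.cast_prod, mul_left_comm, ← Finset.prod_mul_distrib]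
  simp [← Int.cast_mul, ← Units.val_mul]

theorem wedge_wedgePow_ne_zero (h : IsDarbouxFamily W e f) (hT : a T ≠ 0)
    (he : ∀ i, a (e i) = 0) (hf : ∀ i, a (f i) = 0) :
    wedge (AlternatingMap.ofSubsingleton ℝ V ℝ (0 : Fin 1) a) (wedgePow W k) ≠ 0 := by
  intro hzero
  let c : Fin 1 ⊕ (Fin k × Fin 2) → V := Sum.elim (fun _ => T) fun x => ![e x.1, f x.1] x.2
  let term (τ : Equiv.Perm (Fin 1 ⊕ (Fin k × Fin 2))) : ℝ :=
    Equiv.Perm.sign τ • (a (c (τ (Sum.inl 0))) * ∏ i, W (fun j => c (τ (Sum.inr (i, j)))))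
  have hsum : (2⁻¹ : ℝ) ^ k * ∑ τ, term τ = 0 := by
    rw [← wedge_wedgePow_apply_comp_pairEquiv_symm, hzero, AlternatingMap.zero_apply]
  have hterm : ∀ τ, 0 ≤ a T * term τ := by
    intro τ
    by_cases hτ : a (c (τ (Sum.inl 0))) * ∏ i, W (fun j => c (τ (Sum.inr (i, j)))) = 0
    · simp [term, hτ]
    · rw [show term τ = a T from h.sign_smul_mul_prod_eq he hf rfl hτ]
      exact mul_self_nonneg _
  have hone : 0 < a T * term 1 := by
    have hpair (i : Fin k) : W (fun j => ![e i, f i] j) = 1 := by simpa using h.apply_perm i 1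
    rw [show term 1 = a T by simp [term, c, hpair]]
    exact mul_self_pos.2 hT
  refine (Finset.sum_pos' (fun τ _ => hterm τ) ⟨1, Finset.mem_univ _, hone⟩).ne' ?_
  rw [← Finset.mul_sum, (mul_eq_zero.1 hsum).resolve_left (by positivity), mul_zero]

theorem wedgePow_ne_zero (h : IsDarbouxFamily W e f) : wedgePow W k ≠ 0 := by
  intro hzero
  have happly (v w : V) :
      W.compLinearMap (LinearMap.snd ℝ ℝ V) ![((0 : ℝ), v), ((0 : ℝ), w)] = W ![v, w] := by
    rw [AlternatingMap.compLinearMap_apply]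
    congr 1
    ext i
    fin_cases i <;> rfl
  have hprod : IsDarbouxFamily (W.compLinearMap (LinearMap.snd ℝ ℝ V))
      (fun i => ((0 : ℝ), e i)) (fun i => ((0 : ℝ), f i)) := by
    constructor <;> intro i j <;> rw [happly]
    exacts [h.apply_left i j, h.apply_right i j, h.apply_left_right i j]
  refine hprod.wedge_wedgePow_ne_zero (a := LinearMap.fst ℝ ℝ V) (T := (1, 0)) (by simp)
    (fun _ => rfl) (fun _ => rfl) ?_
  rw [← wedgePow_compLinearMap, hzero, AlternatingMap.zero_compLinearMap, wedge_zero_right]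

end IsDarbouxFamily

end Exterior

/-! ### Differentiable dependence of a local flow on the initial point -/

section LocalFlow

open Metric Set Filter Topology

variable {F : Type*} [NormedAddCommGroup F] [NormedSpace ℝ F]

theorem gronwallBound_zero_eq_mul (K δ x : ℝ) :
    gronwallBound 0 K δ x = δ * gronwallBound 0 K 1 x := by
  by_cases hK : K = 0
  · simp [hK, gronwallBound_K0]
  · simp only [gronwallBound_of_K_ne_0 hK]
    ring

theorem norm_le_gronwallBound_abs {f f' : ℝ → F} {ε K δ : ℝ}
    (hf : ∀ s ∈ Ioo (-ε) ε, HasDerivAt f (f' s) s) (h0 : f 0 = 0)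
    (hbound : ∀ s ∈ Ioo (-ε) ε, ‖f' s‖ ≤ K * ‖f s‖ + δ) {s : ℝ} (hs : s ∈ Ioo (-ε) ε) :
    ‖f s‖ ≤ gronwallBound 0 K δ |s| := by
  wlog hs0 : 0 ≤ s generalizing f f' s
  · have hneg {u : ℝ} (hu : u ∈ Ioo (-ε) ε) : -u ∈ Ioo (-ε) ε := ⟨neg_lt_neg hu.2, neg_lt.1 hu.1⟩
    have hreflected := this (f := fun u => f (-u)) (f' := fun u => -f' (-u))
      (fun u hu => by
        simpa [Function.comp_def] using
          HasDerivAt.scomp u (hf (-u) (hneg hu)) (hasDerivAt_neg u))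
      (by simpa using h0) (fun u hu => by simpa using hbound (-u) (hneg hu)) (hneg hs)
      (by linarith)
    simpa using hreflected
  have hsub {u : ℝ} (hu : u ∈ Icc 0 s) : u ∈ Ioo (-ε) ε :=
    ⟨by linarith [hs.1, hs.2, hu.1], hu.2.trans_lt hs.2⟩
  simpa [abs_of_nonneg hs0] using norm_le_gronwallBound_of_norm_deriv_right_le
    (δ := 0) (K := K) (ε := δ)
    (fun u hu => (hf u (hsub hu)).continuousAt.continuousWithinAt)
    (fun u hu => (hf u (hsub (Ico_subset_Icc_self hu))).hasDerivWithinAt) (by simp [h0])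
    (fun u hu => hbound u (hsub (Ico_subset_Icc_self hu))) s (right_mem_Icc.2 hs0)

theorem norm_sub_sub_fderiv_apply_le_of_lipschitzOnWith {G : Type*} [NormedAddCommGroup G]
    [NormedSpace ℝ G] {X : F → G} {S : Set F} {C : NNReal} (hS : Convex ℝ S)
    (hX : ∀ y ∈ S, DifferentiableAt ℝ X y) (hC : LipschitzOnWith C (fderiv ℝ X) S) {a b : F}
    (ha : a ∈ S) (hb : b ∈ S) : ‖X b - X a - fderiv ℝ X a (b - a)‖ ≤ C * ‖b - a‖ ^ 2 := by
  have hbound : ∀ z ∈ S ∩ closedBall a ‖b - a‖, ‖fderiv ℝ X z - fderiv ℝ X a‖ ≤ C * ‖b - a‖ := by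
    rintro z ⟨hzS, hz⟩
    rw [← dist_eq_norm]
    exact (hC.dist_le_mul z hzS a ha).trans (by gcongr; exact hz)
  refine ((hS.inter (convex_closedBall a ‖b - a‖)).norm_image_sub_le_of_norm_hasFDerivWithin_le'
    (fun z hz => (hX z hz.1).hasFDerivAt.hasFDerivWithinAt) hbound ⟨ha, by simp⟩
    ⟨hb, by simp [dist_eq_norm]⟩).trans_eq (by ring)

/-- `φ` is a local flow of `X` for times in `(-ε, ε)` and initial points in the ball of radius `r`
about `x₀`, with values in the ball of radius `R`, and `A` solves the variational equation of `X`
along `φ`. That `A` is the derivative of `φ` with respect to the initial point is a theorem: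
`IsLocalFlow.hasFDerivAt`. -/
structure IsLocalFlow (X : F → F) (x₀ : F) (R r ε : ℝ) (φ : ℝ × F → F) (A : ℝ × F → F →L[ℝ] F) :
    Prop where
  r_pos : 0 < r
  ε_pos : 0 < ε
  r_le : r ≤ R
  differentiableAt_field : ∀ y ∈ ball x₀ R, DifferentiableAt ℝ X y
  lipschitz_field : ∃ K, LipschitzOnWith K X (ball x₀ R)
  lipschitz_fderiv_field : ∃ C, LipschitzOnWith C (fderiv ℝ X) (ball x₀ R)
  zero : ∀ x ∈ ball x₀ r, φ (0, x) = x
  zero_deriv : ∀ x ∈ ball x₀ r, A (0, x) = ContinuousLinearMap.id ℝ F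
  mem : ∀ s ∈ Ioo (-ε) ε, ∀ x ∈ ball x₀ r, φ (s, x) ∈ ball x₀ R
  hasDerivAt : ∀ s ∈ Ioo (-ε) ε, ∀ x ∈ ball x₀ r,
    HasDerivAt (fun u => φ (u, x)) (X (φ (s, x))) s
  hasDerivAt_deriv : ∀ s ∈ Ioo (-ε) ε, ∀ x ∈ ball x₀ r,
    HasDerivAt (fun u => A (u, x)) (fderiv ℝ X (φ (s, x)) ∘L A (s, x)) s
  lipschitz : ∃ L, ∀ s ∈ Ioo (-ε) ε, LipschitzOnWith L (fun x => φ (s, x)) (ball x₀ r)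
  continuousOn : ContinuousOn φ (Ioo (-ε) ε ×ˢ ball x₀ r)
  continuousOn_deriv : ContinuousOn A (Ioo (-ε) ε ×ˢ ball x₀ r)

namespace IsLocalFlow

variable {X : F → F} {x₀ : F} {R r ε : ℝ} {φ : ℝ × F → F} {A : ℝ × F → F →L[ℝ] F}

theorem zero_mem (hφ : IsLocalFlow X x₀ R r ε φ A) : (0 : ℝ) ∈ Ioo (-ε) ε :=
  ⟨neg_lt_zero.2 hφ.ε_pos, hφ.ε_pos⟩

/-- Grönwall: the remainder solves the linearised equation up to a quadratic error. -/
theorem exists_norm_sub_sub_le (hφ : IsLocalFlow X x₀ R r ε φ A) {x : F} (hx : x ∈ ball x₀ r)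
    {s : ℝ} (hs : s ∈ Ioo (-ε) ε) :
    ∃ c : ℝ, ∀ y ∈ ball x₀ r, ‖φ (s, y) - φ (s, x) - A (s, x) (y - x)‖ ≤ c * ‖y - x‖ ^ 2 := by
  obtain ⟨K, hK⟩ := hφ.lipschitz_field
  obtain ⟨C, hC⟩ := hφ.lipschitz_fderiv_field
  obtain ⟨L, hL⟩ := hφ.lipschitz
  refine ⟨C * L ^ 2 * gronwallBound 0 K 1 |s|, fun y hy => ?_⟩
  rw [mul_right_comm, ← gronwallBound_zero_eq_mul]
  refine norm_le_gronwallBound_abs (f := fun u => φ (u, y) - φ (u, x) - A (u, x) (y - x))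
    (f' := fun u => X (φ (u, y)) - X (φ (u, x)) - fderiv ℝ X (φ (u, x)) (A (u, x) (y - x)))
    (fun u hu => ((hφ.hasDerivAt u hu y hy).sub (hφ.hasDerivAt u hu x hx)).sub
      (by simpa using (hφ.hasDerivAt_deriv u hu x hx).clm_apply (hasDerivAt_const u (y - x))))
    (by simp [hφ.zero _ hx, hφ.zero _ hy, hφ.zero_deriv _ hx]) (fun u hu => ?_) hs
  have htaylor : ‖X (φ (u, y)) - X (φ (u, x)) - fderiv ℝ X (φ (u, x)) (φ (u, y) - φ (u, x))‖ ≤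
      C * L ^ 2 * ‖y - x‖ ^ 2 := by
    have hdist : ‖φ (u, y) - φ (u, x)‖ ≤ L * ‖y - x‖ := by
      simpa only [dist_eq_norm] using (hL u hu).dist_le_mul y hy x hx
    calc _ ≤ C * ‖φ (u, y) - φ (u, x)‖ ^ 2 :=
          norm_sub_sub_fderiv_apply_le_of_lipschitzOnWith (convex_ball x₀ R)
            hφ.differentiableAt_field hC (hφ.mem u hu x hx) (hφ.mem u hu y hy)
      _ ≤ C * (L * ‖y - x‖) ^ 2 := by gcongr
      _ = C * L ^ 2 * ‖y - x‖ ^ 2 := by ring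
  have hlinear : ‖fderiv ℝ X (φ (u, x)) (φ (u, y) - φ (u, x) - A (u, x) (y - x))‖ ≤
      K * ‖φ (u, y) - φ (u, x) - A (u, x) (y - x)‖ :=
    ContinuousLinearMap.le_of_opNorm_le _
      (norm_fderiv_le_of_lipschitzOn ℝ (isOpen_ball.mem_nhds (hφ.mem u hu x hx)) hK) _
  calc ‖X (φ (u, y)) - X (φ (u, x)) - fderiv ℝ X (φ (u, x)) (A (u, x) (y - x))‖
      = ‖fderiv ℝ X (φ (u, x)) (φ (u, y) - φ (u, x) - A (u, x) (y - x)) +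
          (X (φ (u, y)) - X (φ (u, x)) - fderiv ℝ X (φ (u, x)) (φ (u, y) - φ (u, x)))‖ := by
        congr 1
        simp only [map_sub]
        abel
    _ ≤ _ := norm_add_le_of_le hlinear htaylor

theorem hasFDerivAt (hφ : IsLocalFlow X x₀ R r ε φ A) {s : ℝ} (hs : s ∈ Ioo (-ε) ε) {x : F}
    (hx : x ∈ ball x₀ r) : HasFDerivAt (fun y => φ (s, y)) (A (s, x)) x := by
  obtain ⟨c, hc⟩ := hφ.exists_norm_sub_sub_le hx hs
  rw [hasFDerivAt_iff_isLittleO]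
  refine (Asymptotics.IsBigO.of_bound c ?_).trans_isLittleO
    (Asymptotics.isLittleO_pow_sub_sub x one_lt_two)
  filter_upwards [isOpen_ball.mem_nhds hx] with y hy
  simpa using hc y hy

theorem continuousOn_toSpanSingleton_field (hφ : IsLocalFlow X x₀ R r ε φ A) :
    ContinuousOn (fun q => ContinuousLinearMap.toSpanSingleton ℝ (X (φ q)))
      (Ioo (-ε) ε ×ˢ ball x₀ r) := by
  obtain ⟨K, hK⟩ := hφ.lipschitz_field
  exact (ContinuousLinearMap.toSpanSingletonCLE (𝕜 := ℝ) (E := F)).continuous.comp_continuousOn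
    (hK.continuousOn.comp hφ.continuousOn fun q hq => hφ.mem q.1 hq.1 q.2 hq.2)

theorem hasFDerivAt_uncurry (hφ : IsLocalFlow X x₀ R r ε φ A) {q : ℝ × F}
    (hq : q ∈ Ioo (-ε) ε ×ˢ ball x₀ r) :
    HasFDerivAt φ ((ContinuousLinearMap.toSpanSingleton ℝ (X (φ q))).coprod (A q)) q := by
  have hnhds := (isOpen_Ioo.prod isOpen_ball).mem_nhds hq
  exact (hasStrictFDerivAt_uncurry_coprod (u := q) (f := fun s x => φ (s, x))
    (f₁ := fun s x => ContinuousLinearMap.toSpanSingleton ℝ (X (φ (s, x))))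
    (f₂ := fun s x => A (s, x))
    (Filter.mem_of_superset hnhds fun v hv => (hφ.hasDerivAt v.1 hv.1 v.2 hv.2).hasFDerivAt)
    (Filter.mem_of_superset hnhds fun v hv => hφ.hasFDerivAt hv.1 hv.2)
    (hφ.continuousOn_toSpanSingleton_field.continuousAt hnhds)
    (hφ.continuousOn_deriv.continuousAt hnhds)).hasFDerivAt

end IsLocalFlow

end LocalFlow

section LocalFlowExistence

open Metric Set Filter Topology

variable {F : Type*} [NormedAddCommGroup F] [NormedSpace ℝ F]

theorem exists_forall_hasDerivAt_lipschitzOnWith_of_contDiffAt [CompleteSpace F] {Y : F → F}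
    {y₀ : F} (hY : ContDiffAt ℝ 1 Y y₀) {U : Set F} (hU : U ∈ 𝓝 y₀) :
    ∃ ε > 0, ∃ ρ > 0, ∃ (L : NNReal) (α : ℝ × F → F), (∀ y ∈ ball y₀ ρ, α (0, y) = y) ∧
      (∀ s ∈ Ioo (-ε) ε, ∀ y ∈ ball y₀ ρ, α (s, y) ∈ U) ∧
      (∀ s ∈ Ioo (-ε) ε, ∀ y ∈ ball y₀ ρ, HasDerivAt (fun u => α (u, y)) (Y (α (s, y))) s) ∧
      (∀ s ∈ Ioo (-ε) ε, LipschitzOnWith L (fun y => α (s, y)) (ball y₀ ρ)) ∧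
      ContinuousOn α (Ioo (-ε) ε ×ˢ ball y₀ ρ) := by
  obtain ⟨δ, hδ, a, ρ, L, K, hρ, hpicard⟩ := IsPicardLindelof.of_contDiffAt_one hY
  obtain ⟨α, hα, L', hL'⟩ :=
    (hpicard 0).exists_forall_mem_closedBall_eq_hasDerivWithinAt_lipschitzOnWith
  simp only [zero_sub, zero_add] at hα hL'
  have hcont : ContinuousOn (fun q : ℝ × F => α q.2 q.1) (Icc (-δ) δ ×ˢ closedBall y₀ ρ) :=
    (continuousOn_prod_of_continuousOn_lipschitzOnWith (Function.uncurry α) L'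
      (fun x hx => HasDerivWithinAt.continuousOn (hα x hx).2) hL').comp
      continuous_swap.continuousOn fun q hq => ⟨hq.2, hq.1⟩
  have hnear : {q : ℝ × F | α q.2 q.1 ∈ U} ∈ 𝓝 ((0 : ℝ), y₀) := by
    refine (hcont.continuousAt (prod_mem_nhds (Icc_mem_nhds (by linarith) hδ)
      (closedBall_mem_nhds y₀ hρ))).preimage_mem_nhds ?_
    rwa [(hα y₀ (mem_closedBall_self ρ.2)).1]
  obtain ⟨η, hη, hηU⟩ := Metric.mem_nhds_iff.1 hnear
  have hIoo : Ioo (-min δ η) (min δ η) ⊆ Ioo (-δ) δ :=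
    Ioo_subset_Ioo (neg_le_neg (min_le_left _ _)) (min_le_left _ _)
  have hball : ball y₀ (min ρ η) ⊆ closedBall y₀ ρ :=
    (ball_subset_ball (min_le_left _ _)).trans ball_subset_closedBall
  refine ⟨min δ η, lt_min hδ hη, min ρ η, lt_min hρ hη, L', fun q => α q.2 q.1,
    fun y hy => (hα y (hball hy)).1, fun s hs y hy => hηU (?_ : (s, y) ∈ ball ((0 : ℝ), y₀) η),
    fun s hs y hy => ((hα y (hball hy)).2 s (Ioo_subset_Icc_self (hIoo hs))).hasDerivAt
      (Icc_mem_nhds (hIoo hs).1 (hIoo hs).2),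
    fun s hs => (hL' s (Ioo_subset_Icc_self (hIoo hs))).mono hball,
    hcont.mono (prod_mono (hIoo.trans Ioo_subset_Icc_self) hball)⟩
  rw [mem_ball, Prod.dist_eq, Real.dist_eq, sub_zero]
  exact max_lt ((abs_lt.2 hs).trans_le (min_le_right _ _))
    ((mem_ball.1 hy).trans_le (min_le_right _ _))

/-- The vector field on `F × (F →L[ℝ] F)` whose integral curves are the pairs formed by an integral
curve of `X` and a solution of the variational equation along it. -/
def variationalField (X : F → F) (p : F × (F →L[ℝ] F)) : F × (F →L[ℝ] F) :=
  (X p.1, fderiv ℝ X p.1 ∘L p.2)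

theorem contDiffAt_variationalField {X : F → F} {x₀ : F} (hX : ContDiffAt ℝ 2 X x₀)
    (B : F →L[ℝ] F) : ContDiffAt ℝ 1 (variationalField X) (x₀, B) :=
  (ContDiffAt.comp (x₀, B) (hX.of_le (by norm_num)) contDiffAt_fst).prodMk
    ((ContDiffAt.comp (x₀, B) (hX.fderiv_right (m := 1) (by norm_num)) contDiffAt_fst).clm_comp
      contDiffAt_snd)

theorem exists_ball_lipschitzOnWith_fderiv {X : F → F} {x₀ : F} (hX : ContDiffAt ℝ 2 X x₀)
    {B : Set F} (hB : B ∈ 𝓝 x₀) :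
    ∃ R > 0, ball x₀ R ⊆ B ∧ (∀ y ∈ ball x₀ R, DifferentiableAt ℝ X y) ∧
      (∃ K, LipschitzOnWith K X (ball x₀ R)) ∧ ∃ C, LipschitzOnWith C (fderiv ℝ X) (ball x₀ R) := by
  obtain ⟨K, s, hs, hK⟩ := (hX.of_le (by norm_num : (1 : WithTop ℕ∞) ≤ 2)).exists_lipschitzOnWith
  obtain ⟨C, t, ht, hC⟩ := (hX.fderiv_right (m := 1) (by norm_num)).exists_lipschitzOnWith
  have hdiff : {y | DifferentiableAt ℝ X y} ∈ 𝓝 x₀ :=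
    (hX.eventually (by simp)).mono fun y hy => hy.differentiableAt (by simp)
  obtain ⟨R, hR, hsub⟩ := Metric.mem_nhds_iff.1 (inter_mem (inter_mem hB hdiff) (inter_mem hs ht))
  exact ⟨R, hR, fun y hy => (hsub hy).1.1, fun y hy => (hsub hy).1.2,
    ⟨K, hK.mono fun y hy => (hsub hy).2.1⟩, C, hC.mono fun y hy => (hsub hy).2.2⟩

theorem exists_isLocalFlow [CompleteSpace F] {X : F → F} {x₀ : F} (hX : ContDiffAt ℝ 2 X x₀)
    {B : Set F} (hB : B ∈ 𝓝 x₀) :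
    ∃ R r ε φ A, ball x₀ R ⊆ B ∧ IsLocalFlow X x₀ R r ε φ A := by
  obtain ⟨R, hR, hRB, hdiff, hlip, hlip'⟩ := exists_ball_lipschitzOnWith_fderiv hX hB
  obtain ⟨ε, hε, ρ, hρ, L, α, hzero, hmem, hderiv, hL, hcont⟩ :=
    exists_forall_hasDerivAt_lipschitzOnWith_of_contDiffAt
      (contDiffAt_variationalField hX (ContinuousLinearMap.id ℝ F))
      (continuous_fst.continuousAt.preimage_mem_nhds (ball_mem_nhds x₀ hR))
  let init : F → F × (F →L[ℝ] F) := fun x => (x, ContinuousLinearMap.id ℝ F)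
  have hinit : MapsTo init (ball x₀ (min ρ R)) (ball (init x₀) ρ) := fun x hx => by
    rw [mem_ball, Prod.dist_eq, dist_self]
    exact max_lt (hx.trans_le (min_le_left _ _)) hρ
  have hcont_init : ContinuousOn (fun q : ℝ × F => α (q.1, init q.2))
      (Ioo (-ε) ε ×ˢ ball x₀ (min ρ R)) :=
    hcont.comp (by fun_prop) fun q hq => ⟨hq.1, hinit hq.2⟩
  have hinit_isometry : Isometry init := Isometry.of_dist_eq fun x y => by simp [init, Prod.dist_eq]
  refine ⟨R, min ρ R, ε, fun q => (α (q.1, init q.2)).1, fun q => (α (q.1, init q.2)).2, hRB,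
    { r_pos := lt_min hρ hR
      ε_pos := hε
      r_le := min_le_right _ _
      differentiableAt_field := hdiff
      lipschitz_field := hlip
      lipschitz_fderiv_field := hlip'
      zero := fun x hx => by rw [hzero _ (hinit hx)]
      zero_deriv := fun x hx => by rw [hzero _ (hinit hx)]
      mem := fun s hs x hx => hmem s hs _ (hinit hx)
      hasDerivAt := fun s hs x hx => (hderiv s hs _ (hinit hx)).fst
      hasDerivAt_deriv := fun s hs x hx => (hderiv s hs _ (hinit hx)).snd
      lipschitz := ⟨_, fun s hs => (LipschitzWith.prod_fst.comp_lipschitzOnWith (hL s hs)).comp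
        hinit_isometry.lipschitz.lipschitzOnWith hinit⟩
      continuousOn := hcont_init.fst
      continuousOn_deriv := hcont_init.snd }⟩

namespace IsLocalFlow

variable {X : F → F} {x₀ : F} {R r ε : ℝ} {φ : ℝ × F → F} {A : ℝ × F → F →L[ℝ] F}

theorem fderiv_apply (hφ : IsLocalFlow X x₀ R r ε φ A) {q : ℝ × F}
    (hq : q ∈ Ioo (-ε) ε ×ˢ ball x₀ r) (u : ℝ) (v : F) :
    fderiv ℝ φ q (u, v) = u • X (φ q) + A q v := by
  simp [(hφ.hasFDerivAt_uncurry hq).fderiv]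

theorem contDiffOn (hφ : IsLocalFlow X x₀ R r ε φ A) :
    ContDiffOn ℝ 1 φ (Ioo (-ε) ε ×ˢ ball x₀ r) := by
  rw [← zero_add (1 : WithTop ℕ∞),
    contDiffOn_succ_iff_fderiv_of_isOpen (isOpen_Ioo.prod isOpen_ball), contDiffOn_zero]
  refine ⟨fun q hq => (hφ.hasFDerivAt_uncurry hq).differentiableAt.differentiableWithinAt, by simp,
    ContinuousOn.congr ?_ fun q hq => (hφ.hasFDerivAt_uncurry hq).fderiv⟩
  simp only [← ContinuousLinearMap.comp_fst_add_comp_snd]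
  exact (hφ.continuousOn_toSpanSingleton_field.clm_comp continuousOn_const).add
    (hφ.continuousOn_deriv.clm_comp continuousOn_const)

theorem eq_of_solution (hφ : IsLocalFlow X x₀ R r ε φ A) {a b : ℝ} {c : ℝ → F} (hab : a ≤ b)
    (hba : b - a < ε) (hc : ∀ s ∈ Icc a b, HasDerivWithinAt c (X (c s)) (Icc a b) s)
    (hmem : ∀ s ∈ Icc a b, c s ∈ ball x₀ R) (hca : c a ∈ ball x₀ r) : φ (b - a, c a) = c b := by
  obtain ⟨K, hK⟩ := hφ.lipschitz_field
  have htime {s : ℝ} (hs : s ∈ Icc a b) : s - a ∈ Ioo (-ε) ε :=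
    ⟨by linarith [hs.1, hφ.ε_pos], by linarith [hs.2]⟩
  have hflow {s : ℝ} (hs : s ∈ Icc a b) :
      HasDerivAt (fun u => φ (u - a, c a)) (X (φ (s - a, c a))) s := by
    simpa [Function.comp_def] using
      HasDerivAt.scomp s (hφ.hasDerivAt (s - a) (htime hs) _ hca) ((hasDerivAt_id s).sub_const a)
  exact ODE_solution_unique_of_mem_Icc_right (v := fun _ => X) (s := fun _ => ball x₀ R) (K := K)
    (f := fun u => φ (u - a, c a)) (g := c) (fun _ _ => hK)
    (fun s hs => (hflow hs).continuousAt.continuousWithinAt)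
    (fun s hs => (hflow (Ico_subset_Icc_self hs)).hasDerivWithinAt)
    (fun s hs => hφ.mem _ (htime (Ico_subset_Icc_self hs)) _ hca)
    (fun s hs => (hc s hs).continuousWithinAt)
    (fun s hs => (hc s (Ico_subset_Icc_self hs)).mono_of_mem_nhdsWithin
      (Icc_mem_nhdsGE_of_mem hs))
    (fun s hs => hmem s (Ico_subset_Icc_self hs)) (by simp [hφ.zero _ hca]) (right_mem_Icc.2 hab)

end IsLocalFlow

end LocalFlowExistence

/-! ### The exterior derivative of a field of covectors on a normed space -/

section Curl

open Metric Set Filter Topology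

variable {F F' : Type*} [NormedAddCommGroup F] [NormedSpace ℝ F]
  [NormedAddCommGroup F'] [NormedSpace ℝ F']

/-- The exterior derivative `dθ(v, w) = ∂_v θ(w) - ∂_w θ(v)` of a field of covectors `θ` on a normed
space. -/
def curl (θ : F → F →L[ℝ] ℝ) (e v w : F) : ℝ := fderiv ℝ θ e v w - fderiv ℝ θ e w v

theorem curl_smul_left (θ : F → F →L[ℝ] ℝ) (e v w : F) (c : ℝ) :
    curl θ e (c • v) w = c * curl θ e v w := by
  simp [curl, mul_sub]

theorem curl_add_left (θ : F → F →L[ℝ] ℝ) (e v v' w : F) :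
    curl θ e (v + v') w = curl θ e v w + curl θ e v' w := by
  simp only [curl, map_add, add_apply]
  ring

theorem curl_swap (θ : F → F →L[ℝ] ℝ) (e v w : F) : curl θ e w v = -curl θ e v w := by
  simp [curl]

theorem curl_congr_of_eventuallyEq {θ θ' : F → F →L[ℝ] ℝ} {e : F} (h : θ =ᶠ[𝓝 e] θ') :
    curl θ e = curl θ' e := by
  ext v w
  simp [curl, h.fderiv_eq]

theorem curl_pullback {θ : F' → F' →L[ℝ] ℝ} {f : F → F'} {x : F}
    (hθ : DifferentiableAt ℝ θ (f x)) (hf : ContDiffAt ℝ 2 f x) (v w : F) :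
    curl (fun y => θ (f y) ∘L fderiv ℝ f y) x v w =
      curl θ (f x) (fderiv ℝ f x v) (fderiv ℝ f x w) := by
  have hf' : DifferentiableAt ℝ (fderiv ℝ f) x :=
    (hf.fderiv_right (m := 1) (by norm_num)).differentiableAt (by simp)
  have hθf : HasFDerivAt (fun y => θ (f y)) (fderiv ℝ θ (f x) ∘L fderiv ℝ f x) x :=
    hθ.hasFDerivAt.comp x (hf.differentiableAt (by simp)).hasFDerivAt
  have hsymm : fderiv ℝ (fderiv ℝ f) x v w = fderiv ℝ (fderiv ℝ f) x w v :=
    (hf.isSymmSndFDerivAt (by simp)).eq v w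
  simp only [curl, (hθf.clm_comp hf'.hasFDerivAt).fderiv]
  simp [hsymm]

theorem hasDerivAt_curl_apply {θ : F → F →L[ℝ] ℝ} {γ a b : ℝ → F} {γ' a' b' : F} {t : ℝ}
    (hθ : ContDiffAt ℝ 2 θ (γ t)) (hγ : HasDerivAt γ γ' t) (ha : HasDerivAt a a' t)
    (hb : HasDerivAt b b' t) :
    HasDerivAt (fun u => curl θ (γ u) (a u) (b u))
      (fderiv ℝ (fderiv ℝ θ) (γ t) γ' (a t) (b t) - fderiv ℝ (fderiv ℝ θ) (γ t) γ' (b t) (a t) +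
        curl θ (γ t) a' (b t) + curl θ (γ t) (a t) b') t := by
  have hθ' : HasDerivAt (fun u => fderiv ℝ θ (γ u)) (fderiv ℝ (fderiv ℝ θ) (γ t) γ') t :=
    ((hθ.fderiv_right (m := 1) (by norm_num)).differentiableAt
      (by simp)).hasFDerivAt.comp_hasDerivAt t hγ
  refine (((hθ'.clm_apply ha).clm_apply hb).sub ((hθ'.clm_apply hb).clm_apply ha)).congr_deriv ?_
  simp only [curl, add_apply]
  ring

theorem fderiv_fderiv_apply_field_of_curl_eq_zero {θ : F → F →L[ℝ] ℝ} {X : F → F} {y : F}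
    (hθ : ContDiffAt ℝ 2 θ y) (hX : DifferentiableAt ℝ X y)
    (hker : ∀ᶠ z in 𝓝 y, ∀ w, curl θ z (X z) w = 0) (v w : F) :
    fderiv ℝ (fderiv ℝ θ) y v (X y) w - fderiv ℝ (fderiv ℝ θ) y v w (X y) +
      curl θ y (fderiv ℝ X y v) w = 0 := by
  have hline : HasDerivAt (fun u : ℝ => y + u • v) v 0 := by
    simpa using ((hasDerivAt_id (0 : ℝ)).smul_const v).const_add y
  have hy : y + (0 : ℝ) • v = y := by simp
  have hderiv := hasDerivAt_curl_apply (hy.symm ▸ hθ) hline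
    ((hy.symm ▸ hX.hasFDerivAt : HasFDerivAt X (fderiv ℝ X y) _).comp_hasDerivAt 0 hline)
    (hasDerivAt_const 0 w)
  have hzero : (fun u : ℝ => curl θ (y + u • v) (X (y + u • v)) w) =ᶠ[𝓝 0] fun _ => 0 :=
    (hline.continuousAt.eventually (hy.symm ▸ hker)).mono fun u hu => hu w
  simpa [curl] using hderiv.unique ((hasDerivAt_const 0 0).congr_of_eventuallyEq hzero)

/-- Cartan's formula: `L_X dθ = d(i_X dθ) = 0`. -/
theorem lieDerivative_curl_eq_zero {θ : F → F →L[ℝ] ℝ} {X : F → F} {y : F}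
    (hθ : ContDiffAt ℝ 2 θ y) (hX : DifferentiableAt ℝ X y)
    (hker : ∀ᶠ z in 𝓝 y, ∀ w, curl θ z (X z) w = 0) (v w : F) :
    fderiv ℝ (fderiv ℝ θ) y (X y) v w - fderiv ℝ (fderiv ℝ θ) y (X y) w v +
      curl θ y (fderiv ℝ X y v) w + curl θ y v (fderiv ℝ X y w) = 0 := by
  have hsymm : ∀ a b, fderiv ℝ (fderiv ℝ θ) y a b = fderiv ℝ (fderiv ℝ θ) y b a :=
    (hθ.isSymmSndFDerivAt (by simp)).eq
  have hv := fderiv_fderiv_apply_field_of_curl_eq_zero hθ hX hker v w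
  have hw := fderiv_fderiv_apply_field_of_curl_eq_zero hθ hX hker w v
  rw [hsymm v w, hsymm v (X y)] at hv
  rw [hsymm w (X y), curl_swap] at hw
  linarith

theorem IsLocalFlow.curl_apply {θ : F → F →L[ℝ] ℝ} {X : F → F} {x₀ : F} {R r ε : ℝ}
    {φ : ℝ × F → F} {A : ℝ × F → F →L[ℝ] F} (hφ : IsLocalFlow X x₀ R r ε φ A)
    (hθ : ContDiffOn ℝ 2 θ (ball x₀ R)) (hker : ∀ y ∈ ball x₀ R, ∀ w, curl θ y (X y) w = 0)
    {q : ℝ × F} (hq : q ∈ Ioo (-ε) ε ×ˢ ball x₀ r) (v w : F) :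
    curl θ (φ q) (A q v) (A q w) = curl θ q.2 v w := by
  obtain ⟨s, x⟩ := q
  obtain ⟨hs, hx⟩ : s ∈ Ioo (-ε) ε ∧ x ∈ ball x₀ r := hq
  have hA (a : F) {u : ℝ} (hu : u ∈ Ioo (-ε) ε) :
      HasDerivAt (fun u => A (u, x) a) (fderiv ℝ X (φ (u, x)) (A (u, x) a)) u := by
    simpa using (hφ.hasDerivAt_deriv u hu x hx).clm_apply (hasDerivAt_const u a)
  have hderiv : ∀ u ∈ Ioo (-ε) ε,
      HasDerivAt (fun u => curl θ (φ (u, x)) (A (u, x) v) (A (u, x) w)) 0 u := fun u hu => by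
    have hnhds := isOpen_ball.mem_nhds (hφ.mem u hu x hx)
    have hθu := hθ.contDiffAt hnhds
    exact (hasDerivAt_curl_apply hθu (hφ.hasDerivAt u hu x hx) (hA v hu) (hA w hu)).congr_deriv
      (lieDerivative_curl_eq_zero hθu (hφ.differentiableAt_field _ (hφ.mem u hu x hx))
        (Filter.mem_of_superset hnhds hker) _ _)
  have hconst := isOpen_Ioo.is_const_of_deriv_eq_zero isPreconnected_Ioo
    (fun u hu => (hderiv u hu).differentiableAt.differentiableWithinAt)
    (fun u hu => (hderiv u hu).deriv) hs hφ.zero_mem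
  simpa [hφ.zero x hx, hφ.zero_deriv x hx] using hconst

end Curl

section HitTime

open Set Filter Topology

variable {F : Type*} [NormedAddCommGroup F] [NormedSpace ℝ F]

theorem isInvertible_of_apply_one_ne_zero {L : ℝ →L[ℝ] ℝ} (h : L 1 ≠ 0) : L.IsInvertible := by
  refine ⟨ContinuousLinearEquiv.unitsEquivAut ℝ (Units.mk0 _ h), ?_⟩
  ext
  simp

/-- The implicit function theorem for the time at which a flow meets a transversal hypersurface. -/
theorem exists_hitTime [CompleteSpace F] {φ : ℝ × F → F} {h : F → ℝ} {e₀ X₀ : F}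
    {n : WithTop ℕ∞} (hn : n ≠ 0) (hφ : ContDiffAt ℝ n φ (0, e₀)) (hφ₀ : φ (0, e₀) = e₀)
    (hX : HasDerivAt (fun s => φ (s, e₀)) X₀ 0) (hh : ContDiffAt ℝ n h e₀) (h₀ : h e₀ = 0)
    (hX₀ : fderiv ℝ h e₀ X₀ ≠ 0) :
    ∃ τ : F → ℝ, ContDiffAt ℝ n τ e₀ ∧ τ e₀ = 0 ∧ (∀ᶠ e in 𝓝 e₀, h (φ (τ e, e)) = 0) ∧
      ∀ᶠ q : ℝ × F in 𝓝 (0, e₀), h (φ q) = 0 → τ q.2 = q.1 := by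
  have hf : ContDiffAt ℝ n (fun p : F × ℝ => h (φ (p.2, p.1))) (e₀, 0) :=
    ContDiffAt.comp (e₀, (0 : ℝ)) (g := h) (by simpa [hφ₀] using hh)
      (ContDiffAt.comp (e₀, (0 : ℝ)) (g := φ) hφ (contDiffAt_snd.prodMk contDiffAt_fst))
  have hinv : (fderiv ℝ (fun p : F × ℝ => h (φ (p.2, p.1))) (e₀, 0) ∘L
      ContinuousLinearMap.inr ℝ F ℝ).IsInvertible := by
    refine isInvertible_of_apply_one_ne_zero ?_
    have hvertical : HasDerivAt (fun s : ℝ => (e₀, s)) ((0 : F), (1 : ℝ)) 0 :=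
      (hasDerivAt_const _ _).prodMk (hasDerivAt_id _)
    have hhφ : HasFDerivAt h (fderiv ℝ h e₀) (φ (0, e₀)) := by
      rw [hφ₀]
      exact (hh.differentiableAt hn).hasFDerivAt
    have hhφ' := hhφ.comp_hasDerivAt (0 : ℝ) hX
    have hchain :=
      ((hf.differentiableAt hn).hasFDerivAt.comp_hasDerivAt (0 : ℝ) hvertical).unique hhφ'
    simpa [hchain] using hX₀
  refine ⟨hf.implicitFunction hn hinv, hf.contDiffAt_implicitFunction hn hinv,
    hf.implicitFunction_apply_self hn hinv, ?_, ?_⟩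
  · filter_upwards [hf.eventually_apply_implicitFunction hn hinv] with e he
    simpa [hφ₀, h₀] using he
  · filter_upwards [(continuous_swap.tendsto ((0 : ℝ), e₀)).eventually
      (hf.eventually_apply_eq_iff_implicitFunction hn hinv)] with q hq hzero
    exact hq.1 (by simpa [hφ₀, h₀] using hzero)

end HitTime

section PullsBack

variable {F : Type*} [NormedAddCommGroup F] [NormedSpace ℝ F] {K : Type*} [TopologicalSpace K]
  {J : ModelWithCorners ℝ F K} {N : Type*} [TopologicalSpace N] [ChartedSpace K N]
  {F' : Type*} [NormedAddCommGroup F'] [NormedSpace ℝ F'] {K' : Type*} [TopologicalSpace K']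
  {J' : ModelWithCorners ℝ F' K'} {N' : Type*} [TopologicalSpace N'] [ChartedSpace K' N']
  {F'' : Type*} [NormedAddCommGroup F''] [NormedSpace ℝ F''] {K'' : Type*} [TopologicalSpace K'']
  {J'' : ModelWithCorners ℝ F'' K''} {N'' : Type*} [TopologicalSpace N''] [ChartedSpace K'' N'']

variable (J J') in
/-- `f` is differentiable at `z` and pulls the field of bilinear forms `B'` back to `B` there. The
forms are bare functions of two tangent vectors, which is all that composing pullbacks involves. -/
def PullsBackAt (f : N → N') (B' : (z : N') → TangentSpace J' z → TangentSpace J' z → ℝ)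
    (B : (z : N) → TangentSpace J z → TangentSpace J z → ℝ) (z : N) : Prop :=
  ∃ f' : TangentSpace J z →L[ℝ] TangentSpace J' (f z), HasMFDerivAt J J' f z f' ∧
    ∀ v w, B' (f z) (f' v) (f' w) = B z v w

namespace PullsBackAt

variable {B : (z : N) → TangentSpace J z → TangentSpace J z → ℝ}
  {B' : (z : N') → TangentSpace J' z → TangentSpace J' z → ℝ}
  {B'' : (z : N'') → TangentSpace J'' z → TangentSpace J'' z → ℝ} {f g : N → N'} {z : N}

theorem comp {g : N' → N''} (hg : PullsBackAt J' J'' g B'' B' (f z))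
    (hf : PullsBackAt J J' f B' B z) : PullsBackAt J J'' (g ∘ f) B'' B z := by
  obtain ⟨f', hf', hfB⟩ := hf
  obtain ⟨g', hg', hgB⟩ := hg
  exact ⟨g' ∘L f', hg'.comp z hf', fun v w => (hgB _ _).trans (hfB v w)⟩

theorem mdifferentiableAt (hf : PullsBackAt J J' f B' B z) : MDifferentiableAt J J' f z := by
  obtain ⟨f', hf', -⟩ := hf
  exact hf'.mdifferentiableAt

theorem continuousAt (hf : PullsBackAt J J' f B' B z) : ContinuousAt f z :=
  hf.mdifferentiableAt.continuousAt

theorem apply_mfderiv (hf : PullsBackAt J J' f B' B z) (v w : TangentSpace J z) :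
    B' (f z) (mfderiv J J' f z v) (mfderiv J J' f z w) = B z v w := by
  obtain ⟨f', hf', hfB⟩ := hf
  rw [hf'.mfderiv]
  exact hfB v w

/-- If `g^* B'' = f^* B'`, then `(g ∘ σ)^* B'' = σ^* f^* B' = (f ∘ σ)^* B'`. -/
theorem comp_of_comp {F₀ : Type*} [NormedAddCommGroup F₀] [NormedSpace ℝ F₀] {K₀ : Type*}
    [TopologicalSpace K₀] {J₀ : ModelWithCorners ℝ F₀ K₀} {N₀ : Type*} [TopologicalSpace N₀]
    [ChartedSpace K₀ N₀] {B₀ : (z : N₀) → TangentSpace J₀ z → TangentSpace J₀ z → ℝ}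
    {σ : N₀ → N} {g : N → N''} {z : N₀}
    (hg : PullsBackAt J J'' g B''
      (fun y v w => B' (f y) (mfderiv J J' f y v) (mfderiv J J' f y w)) (σ z))
    (hf : MDifferentiableAt J J' f (σ z)) (hσ : MDifferentiableAt J₀ J σ z)
    (hcomp : PullsBackAt J₀ J' (f ∘ σ) B' B₀ z) : PullsBackAt J₀ J'' (g ∘ σ) B'' B₀ z := by
  have hfσ : PullsBackAt J₀ J σ (fun y v w => B' (f y) (mfderiv J J' f y v) (mfderiv J J' f y w))
      B₀ z := by
    refine ⟨_, hσ.hasMFDerivAt, fun v w => ?_⟩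
    have h := hcomp.apply_mfderiv v w
    rw [mfderiv_comp z hf hσ] at h
    exact h
  exact hg.comp hfσ

theorem congr_of_eventuallyEq (hf : PullsBackAt J J' f B' B z) (h : g =ᶠ[nhds z] f) :
    PullsBackAt J J' g B' B z := by
  obtain ⟨f', hf', hfB⟩ := hf
  have hpull : ∀ y, y = f z → ∀ v w, B' y (f' v) (f' w) = B z v w := by
    rintro _ rfl v w
    exact hfB v w
  exact ⟨f', hf'.congr_of_eventuallyEq h, hpull _ h.eq_of_nhds⟩

end PullsBackAt

end PullsBack

/-! ### One-forms and vector fields in charts -/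

section Charts

open Metric Set Filter Topology

variable {F : Type*} [NormedAddCommGroup F] [NormedSpace ℝ F] {K : Type*} [TopologicalSpace K]
  {J : ModelWithCorners ℝ F K} {N : Type*} [TopologicalSpace N] [ChartedSpace K N]

variable (J) in
/-- The derivative of the preferred chart at `z₀`, with values in the model space. -/
def chartDeriv (z₀ z : N) : TangentSpace J z →L[ℝ] F :=
  mfderiv J 𝓘(ℝ, F) (extChartAt J z₀) z

variable (J) in
/-- The derivative of the inverse of the preferred chart at `z₀`. -/
def chartSymmDeriv (z₀ : N) (e : F) : F →L[ℝ] TangentSpace J ((extChartAt J z₀).symm e) :=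
  mfderiv 𝓘(ℝ, F) J (extChartAt J z₀).symm e

variable (J) in
/-- The expression of a field of covectors in the preferred chart at `z₀`. -/
def covectorInChart (θ : (z : N) → TangentSpace J z →L[ℝ] ℝ) (z₀ : N) (e : F) : F →L[ℝ] ℝ :=
  (θ ((extChartAt J z₀).symm e)) ∘L (chartSymmDeriv J z₀ e)

variable (J) in
/-- The expression of a vector field in the preferred chart at `z₀`. -/
def fieldInChart (X : (z : N) → TangentSpace J z) (z₀ : N) (e : F) : F :=
  chartDeriv J z₀ ((extChartAt J z₀).symm e) (X ((extChartAt J z₀).symm e))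

variable (J) in
/-- The exterior derivative of a field of covectors, as a field of bilinear forms. -/
def mextDerivBilin (θ : (z : N) → TangentSpace J z →L[ℝ] ℝ) (z : N) (v w : TangentSpace J z) : ℝ :=
  mextDerivOne J θ z ![v, w]

variable (J) in
/-- The exterior derivative of a field of covectors, computed in the preferred chart at `z₀`, as a
field of bilinear forms on the model space. -/
def chartForm (θ : (z : N) → TangentSpace J z →L[ℝ] ℝ) (z₀ : N) (e : F)
    (v w : TangentSpace 𝓘(ℝ, F) e) : ℝ := curl (covectorInChart J θ z₀) e v w

variable (J) in
/-- A field of covectors that is of class `C²` in the preferred charts. -/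
def IsSmoothCovectorField (θ : (z : N) → TangentSpace J z →L[ℝ] ℝ) : Prop :=
  ∀ z₀, ContDiffOn ℝ 2 (covectorInChart J θ z₀) (extChartAt J z₀).target

variable (J) in
/-- A vector field that is of class `C²` in the preferred charts. -/
def IsSmoothVectorField (X : (z : N) → TangentSpace J z) : Prop :=
  ∀ z₀, ContDiffOn ℝ 2 (fieldInChart J X z₀) (extChartAt J z₀).target

theorem exists_mem_target_extChartAt_symm_eq {z₀ z : N} (hz : z ∈ (extChartAt J z₀).source) :
    ∃ e ∈ (extChartAt J z₀).target, (extChartAt J z₀).symm e = z :=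
  ⟨_, (extChartAt J z₀).map_source hz, (extChartAt J z₀).left_inv hz⟩

section C1

variable [IsManifold J 1 N]

theorem hasMFDerivAt_chart {z₀ z : N} (hz : z ∈ (extChartAt J z₀).source) :
    HasMFDerivAt J 𝓘(ℝ, F) (extChartAt J z₀) z (chartDeriv J z₀ z) :=
  (mdifferentiableAt_extChartAt (by simpa using hz)).hasMFDerivAt

variable [J.Boundaryless] {z₀ z₁ z : N} {e : F}

theorem hasMFDerivAt_chart_symm (he : e ∈ (extChartAt J z₀).target) :
    HasMFDerivAt 𝓘(ℝ, F) J (extChartAt J z₀).symm e (chartSymmDeriv J z₀ e) := by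
  have h := mdifferentiableWithinAt_extChartAt_symm he
  rw [J.range_eq_univ, mdifferentiableWithinAt_univ] at h
  exact h.hasMFDerivAt

theorem chartDeriv_chartSymmDeriv (he : e ∈ (extChartAt J z₀).target) (v : F) :
    chartDeriv J z₀ ((extChartAt J z₀).symm e) (chartSymmDeriv J z₀ e v) = v := by
  have h := mfderiv_extChartAt_comp_mfderivWithin_extChartAt_symm (I := J) he
  rw [J.range_eq_univ, mfderivWithin_univ] at h
  exact congrArg (fun L : F →L[ℝ] F => L v) h

theorem chartSymmDeriv_chartDeriv_symm (he : e ∈ (extChartAt J z₀).target)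
    (v : TangentSpace J ((extChartAt J z₀).symm e)) :
    chartSymmDeriv J z₀ e (chartDeriv J z₀ ((extChartAt J z₀).symm e) v) = v := by
  have h := mfderivWithin_extChartAt_symm_comp_mfderiv_extChartAt (I := J) he
  rw [J.range_eq_univ, mfderivWithin_univ] at h
  exact congrArg (fun L : F →L[ℝ] F => L v) h

theorem chartDeriv_surjective (hz : z ∈ (extChartAt J z₀).source) :
    Function.Surjective (chartDeriv J z₀ z) := by
  obtain ⟨e, he, rfl⟩ := exists_mem_target_extChartAt_symm_eq hz
  exact Function.RightInverse.surjective (chartDeriv_chartSymmDeriv he)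

theorem covectorInChart_apply_chartDeriv (θ : (z : N) → TangentSpace J z →L[ℝ] ℝ)
    (hz : z ∈ (extChartAt J z₀).source) (v : TangentSpace J z) :
    covectorInChart J θ z₀ (extChartAt J z₀ z) (chartDeriv J z₀ z v) = θ z v := by
  obtain ⟨e, he, rfl⟩ := exists_mem_target_extChartAt_symm_eq hz
  rw [(extChartAt J z₀).right_inv he, covectorInChart, ContinuousLinearMap.comp_apply,
    chartSymmDeriv_chartDeriv_symm he]

theorem hasFDerivAt_chart_change (he : e ∈ (extChartAt J z₁).target)
    (he' : (extChartAt J z₁).symm e ∈ (extChartAt J z₀).source) :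
    HasFDerivAt (extChartAt J z₀ ∘ (extChartAt J z₁).symm)
      (chartDeriv J z₀ ((extChartAt J z₁).symm e) ∘L chartSymmDeriv J z₁ e) e :=
  hasMFDerivAt_iff_hasFDerivAt.1 ((hasMFDerivAt_chart he').comp e (hasMFDerivAt_chart_symm he))

theorem fderiv_chart_change_chartDeriv (hz₁ : z ∈ (extChartAt J z₁).source)
    (hz₀ : z ∈ (extChartAt J z₀).source) (v : TangentSpace J z) :
    fderiv ℝ (extChartAt J z₀ ∘ (extChartAt J z₁).symm) (extChartAt J z₁ z)
      (chartDeriv J z₁ z v) = chartDeriv J z₀ z v := by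
  obtain ⟨e, he, rfl⟩ := exists_mem_target_extChartAt_symm_eq hz₁
  rw [(extChartAt J z₁).right_inv he, (hasFDerivAt_chart_change he hz₀).fderiv,
    ContinuousLinearMap.comp_apply, chartSymmDeriv_chartDeriv_symm he]

theorem covectorInChart_eq_comp_fderiv_chart_change (θ : (z : N) → TangentSpace J z →L[ℝ] ℝ)
    (he : e ∈ (extChartAt J z₁).target)
    (he' : (extChartAt J z₁).symm e ∈ (extChartAt J z₀).source) :
    covectorInChart J θ z₁ e =
      covectorInChart J θ z₀ ((extChartAt J z₀ ∘ (extChartAt J z₁).symm) e) ∘L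
        fderiv ℝ (extChartAt J z₀ ∘ (extChartAt J z₁).symm) e := by
  ext v
  rw [(hasFDerivAt_chart_change he he').fderiv]
  exact (covectorInChart_apply_chartDeriv θ he' _).symm

end C1

variable [J.Boundaryless] {θ : (z : N) → TangentSpace J z →L[ℝ] ℝ} {z₀ z₁ z : N} {e : F}

theorem mextDerivBilin_eq_chartForm_self
    (hθ : DifferentiableAt ℝ (covectorInChart J θ z) (extChartAt J z z)) (v w : TangentSpace J z) :
    mextDerivBilin J θ z v w =
      chartForm J θ z (extChartAt J z z) (chartDeriv J z z v) (chartDeriv J z z w) := by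
  have hform : formInChart J (fun y => ContinuousAlternatingMap.ofSubsingleton ℝ
      (TangentSpace J y) ℝ (0 : Fin 1) (θ y)) z = fun e =>
      ContinuousAlternatingMap.ofSubsingleton ℝ F ℝ (0 : Fin 1) (covectorInChart J θ z e) := by
    funext e
    simp only [formInChart, covectorInChart, J.range_eq_univ, mfderivWithin_univ]
    rfl
  have hdiff : DifferentiableAt ℝ (fun e => ContinuousAlternatingMap.ofSubsingleton ℝ F ℝ
      (0 : Fin 1) (covectorInChart J θ z e)) (extChartAt J z z) :=
    (ContinuousAlternatingMap.ofSubsingletonLIE (𝕜 := ℝ) (E := F) (F := ℝ)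
      (0 : Fin 1)).differentiable.differentiableAt.comp _ hθ
  have hflip : ∀ u : F, fderiv ℝ (fun e => covectorInChart J θ z e u) (extChartAt J z z) =
      (fderiv ℝ (covectorInChart J θ z) (extChartAt J z z)).flip u := fun u => by
    rw [fderiv_clm_apply hθ (differentiableAt_const u)]
    simp
  rw [mextDerivBilin, mextDerivOne, mextDeriv, hform, J.range_eq_univ, extDerivWithin_univ]
  refine (extDeriv_apply hdiff (fun i => chartDeriv J z z (![v, w] i))).trans ?_
  rw [Fin.sum_univ_two]
  simp only [ContinuousAlternatingMap.ofSubsingleton_apply_apply, Fin.removeNth, hflip]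
  simp [chartForm, curl, sub_eq_add_neg]

theorem IsSmoothCovectorField.differentiableAt (hθ : IsSmoothCovectorField J θ)
    (he : e ∈ (extChartAt J z₀).target) : DifferentiableAt ℝ (covectorInChart J θ z₀) e :=
  ((hθ z₀).contDiffAt ((isOpen_extChartAt_target z₀).mem_nhds he)).differentiableAt (by simp)

section C2

variable [IsManifold J 2 N]

theorem contDiffAt_chart_change (he : e ∈ (extChartAt J z₁).target)
    (he' : (extChartAt J z₁).symm e ∈ (extChartAt J z₀).source) :
    ContDiffAt ℝ 2 (extChartAt J z₀ ∘ (extChartAt J z₁).symm) e := by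
  rw [← contMDiffAt_iff_contDiffAt]
  refine ContMDiffAt.comp e (contMDiffAt_extChartAt' (by simpa using he')) ?_
  exact (contMDiffOn_extChartAt_symm z₁).contMDiffAt ((isOpen_extChartAt_target z₁).mem_nhds he)

theorem chartForm_chart_change (hθ : IsSmoothCovectorField J θ)
    (hz₁ : z ∈ (extChartAt J z₁).source) (hz₀ : z ∈ (extChartAt J z₀).source)
    (v w : TangentSpace J z) :
    chartForm J θ z₁ (extChartAt J z₁ z) (chartDeriv J z₁ z v) (chartDeriv J z₁ z w) =
      chartForm J θ z₀ (extChartAt J z₀ z) (chartDeriv J z₀ z v) (chartDeriv J z₀ z w) := by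
  have : IsManifold J 1 N := IsManifold.of_le (n := 2) (by norm_num)
  have htarget := (extChartAt J z₁).map_source hz₁
  have hsymm : (extChartAt J z₁).symm (extChartAt J z₁ z) = z := (extChartAt J z₁).left_inv hz₁
  have hchange : (extChartAt J z₀ ∘ (extChartAt J z₁).symm) (extChartAt J z₁ z) =
      extChartAt J z₀ z := congrArg (extChartAt J z₀) hsymm
  have hsource : ∀ᶠ e in 𝓝 (extChartAt J z₁ z),
      (extChartAt J z₁).symm e ∈ (extChartAt J z₀).source :=
    (continuousAt_extChartAt_symm'' htarget).preimage_mem_nhds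
      ((isOpen_extChartAt_source z₀).mem_nhds (hsymm.symm ▸ hz₀))
  have hpull : covectorInChart J θ z₁ =ᶠ[𝓝 (extChartAt J z₁ z)] fun e =>
      covectorInChart J θ z₀ ((extChartAt J z₀ ∘ (extChartAt J z₁).symm) e) ∘L
        fderiv ℝ (extChartAt J z₀ ∘ (extChartAt J z₁).symm) e := by
    filter_upwards [(isOpen_extChartAt_target z₁).mem_nhds htarget, hsource] with e he he'
    exact covectorInChart_eq_comp_fderiv_chart_change θ he he'
  unfold chartForm
  rw [curl_congr_of_eventuallyEq hpull,
    curl_pullback (hchange.symm ▸ hθ.differentiableAt ((extChartAt J z₀).map_source hz₀))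
      (contDiffAt_chart_change htarget (hsymm.symm ▸ hz₀)), hchange,
    fderiv_chart_change_chartDeriv hz₁ hz₀, fderiv_chart_change_chartDeriv hz₁ hz₀]

theorem mextDerivBilin_eq_chartForm (hθ : IsSmoothCovectorField J θ)
    (hz : z ∈ (extChartAt J z₀).source) (v w : TangentSpace J z) :
    mextDerivBilin J θ z v w =
      chartForm J θ z₀ (extChartAt J z₀ z) (chartDeriv J z₀ z v) (chartDeriv J z₀ z w) := by
  rw [mextDerivBilin_eq_chartForm_self (hθ.differentiableAt (mem_extChartAt_target z)),
    chartForm_chart_change hθ (mem_extChartAt_source z) hz]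

theorem pullsBackAt_chart (hθ : IsSmoothCovectorField J θ) (hz : z ∈ (extChartAt J z₀).source) :
    PullsBackAt J 𝓘(ℝ, F) (extChartAt J z₀) (chartForm J θ z₀) (mextDerivBilin J θ) z := by
  have : IsManifold J 1 N := IsManifold.of_le (n := 2) (by norm_num)
  exact ⟨_, hasMFDerivAt_chart hz, fun v w => (mextDerivBilin_eq_chartForm hθ hz v w).symm⟩

theorem pullsBackAt_chart_symm (hθ : IsSmoothCovectorField J θ)
    (he : e ∈ (extChartAt J z₀).target) :
    PullsBackAt 𝓘(ℝ, F) J (extChartAt J z₀).symm (mextDerivBilin J θ) (chartForm J θ z₀) e := by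
  have : IsManifold J 1 N := IsManifold.of_le (n := 2) (by norm_num)
  have hpull (v w : F) : mextDerivBilin J θ ((extChartAt J z₀).symm e) (chartSymmDeriv J z₀ e v)
      (chartSymmDeriv J z₀ e w) = chartForm J θ z₀ e v w := by
    rw [mextDerivBilin_eq_chartForm hθ ((extChartAt J z₀).map_target he),
      chartDeriv_chartSymmDeriv he, chartDeriv_chartSymmDeriv he, (extChartAt J z₀).right_inv he]
  exact ⟨_, hasMFDerivAt_chart_symm he, hpull⟩

theorem pullsBackAt_curl_of_eventually_pullback_eq {E : Type*} [NormedAddCommGroup E]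
    [NormedSpace ℝ E] {s : E → N} {α : E → E →L[ℝ] ℝ} {e : E} (hθ : IsSmoothCovectorField J θ)
    (hs : ContMDiffAt 𝓘(ℝ, E) J 2 s e)
    (hα : ∀ᶠ y in 𝓝 e, ∀ v : E, α y v = θ (s y) (mfderiv 𝓘(ℝ, E) J s y v)) :
    PullsBackAt 𝓘(ℝ, E) J s (mextDerivBilin J θ) (curl α) e := by
  have : IsManifold J 1 N := IsManifold.of_le (n := 2) (by norm_num)
  have hf : ContDiffAt ℝ 2 (extChartAt J (s e) ∘ s) e :=
    contMDiffAt_iff_contDiffAt.1 (contMDiffAt_extChartAt.comp e hs)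
  have hsource : ∀ᶠ y in 𝓝 e, s y ∈ (extChartAt J (s e)).source :=
    hs.continuousAt.preimage_mem_nhds (extChartAt_source_mem_nhds (s e))
  have hdiff : ∀ᶠ y in 𝓝 e, MDifferentiableAt 𝓘(ℝ, E) J s y :=
    ((contMDiffAt_iff_contMDiffAt_nhds (by simp)).1 hs).mono fun y hy =>
      hy.mdifferentiableAt (by simp)
  have hfderiv : ∀ᶠ y in 𝓝 e, ∀ v : E, fderiv ℝ (extChartAt J (s e) ∘ s) y v =
      chartDeriv J (s e) (s y) (mfderiv 𝓘(ℝ, E) J s y v) := by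
    filter_upwards [hsource, hdiff] with y hy hsy v
    have h : HasFDerivAt (extChartAt J (s e) ∘ s)
        (chartDeriv J (s e) (s y) ∘L mfderiv 𝓘(ℝ, E) J s y : E →L[ℝ] F) y :=
      hasMFDerivAt_iff_hasFDerivAt.1 ((hasMFDerivAt_chart hy).comp y hsy.hasMFDerivAt)
    rw [h.fderiv]
    rfl
  have hpull : α =ᶠ[𝓝 e] fun y => covectorInChart J θ (s e) ((extChartAt J (s e) ∘ s) y) ∘L
      fderiv ℝ (extChartAt J (s e) ∘ s) y := by
    filter_upwards [hα, hsource, hfderiv] with y hy hsy hfy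
    ext v
    rw [hy, ContinuousLinearMap.comp_apply, hfy, Function.comp_apply,
      covectorInChart_apply_chartDeriv θ hsy]
  refine ⟨_, hdiff.self_of_nhds.hasMFDerivAt, fun v w => ?_⟩
  calc mextDerivBilin J θ (s e) (mfderiv 𝓘(ℝ, E) J s e v) (mfderiv 𝓘(ℝ, E) J s e w)
      = curl (covectorInChart J θ (s e)) ((extChartAt J (s e) ∘ s) e)
          (fderiv ℝ (extChartAt J (s e) ∘ s) e v) (fderiv ℝ (extChartAt J (s e) ∘ s) e w) :=
        (mextDerivBilin_eq_chartForm hθ (mem_extChartAt_source (s e)) _ _).trans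
          (congrArg₂ (curl _ _) (hfderiv.self_of_nhds v).symm (hfderiv.self_of_nhds w).symm)
    _ = curl (fun y => covectorInChart J θ (s e) ((extChartAt J (s e) ∘ s) y) ∘L
          fderiv ℝ (extChartAt J (s e) ∘ s) y) e v w :=
        (curl_pullback (f := extChartAt J (s e) ∘ s)
          (hθ.differentiableAt (mem_extChartAt_target (s e))) hf v w).symm
    _ = curl α e v w := congrFun₂ (curl_congr_of_eventuallyEq hpull).symm v w

end C2

end Charts

/-! ### Flow boxes -/

section FlowBoxes

open Metric Set Filter Topology

variable {F : Type*} [NormedAddCommGroup F] [NormedSpace ℝ F] {K : Type*} [TopologicalSpace K]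
  {J : ModelWithCorners ℝ F K} {N : Type*} [TopologicalSpace N] [ChartedSpace K N]

/-- The vector field `X` is characteristic for the one-form `θ`: both are of class `C²` and `X` lies
in the kernel of `dθ`. -/
structure IsCharacteristic (J : ModelWithCorners ℝ F K) {N : Type*} [TopologicalSpace N]
    [ChartedSpace K N] (θ : (z : N) → TangentSpace J z →L[ℝ] ℝ) (X : (z : N) → TangentSpace J z) :
    Prop where
  smooth_form : IsSmoothCovectorField J θ
  smooth_field : IsSmoothVectorField J X
  ker : ∀ z w, mextDerivBilin J θ z (X z) w = 0

variable {θ : (z : N) → TangentSpace J z →L[ℝ] ℝ} {X : (z : N) → TangentSpace J z} {z₀ : N}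
  {e₀ : F} {R r ε : ℝ} {φ : ℝ × F → F} {A : ℝ × F → F →L[ℝ] F}

theorem isOpen_chart_preimage (z₀ : N) {B : Set F} (hB : IsOpen B) :
    IsOpen ((extChartAt J z₀).source ∩ extChartAt J z₀ ⁻¹' B) :=
  (continuousOn_extChartAt z₀).isOpen_inter_preimage (isOpen_extChartAt_source z₀) hB

theorem hasDerivWithinAt_chart_of_isMIntegralCurveOn [IsManifold J 1 N] {γ : ℝ → N} {s : Set ℝ}
    (hγ : IsMIntegralCurveOn γ X s) {t : ℝ} (ht : t ∈ s) (hz : γ t ∈ (extChartAt J z₀).source) :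
    HasDerivWithinAt (fun u => extChartAt J z₀ (γ u))
      (fieldInChart J X z₀ (extChartAt J z₀ (γ t))) s t := by
  have hcomp : HasFDerivWithinAt (fun u => extChartAt J z₀ (γ u))
      (chartDeriv J z₀ (γ t) ∘L ContinuousLinearMap.toSpanSingleton ℝ (X (γ t)) : ℝ →L[ℝ] F) s t :=
    ((hasMFDerivAt_chart hz).comp_hasMFDerivWithinAt t (hγ t ht)).hasFDerivWithinAt
  have hfield : fieldInChart J X z₀ (extChartAt J z₀ (γ t)) =
      (chartDeriv J z₀ (γ t) ∘L ContinuousLinearMap.toSpanSingleton ℝ (X (γ t)) : ℝ →L[ℝ] F) 1 := by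
    rw [fieldInChart, (extChartAt J z₀).left_inv hz]
    simp
  rw [hfield]
  exact hcomp.hasDerivWithinAt

theorem IsLocalFlow.eq_of_isMIntegralCurveOn [IsManifold J 1 N]
    (hφ : IsLocalFlow (fieldInChart J X z₀) e₀ R r ε φ A) {γ : ℝ → N} {a b : ℝ} (hab : a ≤ b)
    (hba : b - a < ε) (hγ : IsMIntegralCurveOn γ X (Icc a b))
    (hmem : ∀ s ∈ Icc a b, γ s ∈ (extChartAt J z₀).source ∩ extChartAt J z₀ ⁻¹' ball e₀ r) :
    φ (b - a, extChartAt J z₀ (γ a)) = extChartAt J z₀ (γ b) :=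
  hφ.eq_of_solution (c := fun u => extChartAt J z₀ (γ u)) hab hba
    (fun s hs => hasDerivWithinAt_chart_of_isMIntegralCurveOn hγ hs (hmem s hs).1)
    (fun s hs => ball_subset_ball hφ.r_le (hmem s hs).2) (hmem a (left_mem_Icc.2 hab)).2

namespace IsCharacteristic

theorem exists_isLocalFlow [CompleteSpace F] [J.Boundaryless] (hX : IsCharacteristic J θ X)
    (z₀ : N) : ∃ (R r ε : ℝ) (φ : ℝ × F → F) (A : ℝ × F → F →L[ℝ] F),
      ball (extChartAt J z₀ z₀) R ⊆ (extChartAt J z₀).target ∧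
        IsLocalFlow (fieldInChart J X z₀) (extChartAt J z₀ z₀) R r ε φ A :=
  _root_.exists_isLocalFlow ((hX.smooth_field z₀).contDiffAt (extChartAt_target_mem_nhds z₀))
    (extChartAt_target_mem_nhds z₀)

variable [J.Boundaryless] [IsManifold J 2 N]

theorem curl_covectorInChart_fieldInChart (hX : IsCharacteristic J θ X) {e : F}
    (he : e ∈ (extChartAt J z₀).target) (w : F) :
    curl (covectorInChart J θ z₀) e (fieldInChart J X z₀ e) w = 0 := by
  have : IsManifold J 1 N := IsManifold.of_le (n := 2) (by norm_num)
  have hker := hX.ker ((extChartAt J z₀).symm e) (chartSymmDeriv J z₀ e w)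
  rwa [mextDerivBilin_eq_chartForm hX.smooth_form ((extChartAt J z₀).map_target he),
    chartDeriv_chartSymmDeriv he, (extChartAt J z₀).right_inv he] at hker

theorem curl_fderiv_localFlow (hX : IsCharacteristic J θ X)
    (hφ : IsLocalFlow (fieldInChart J X z₀) e₀ R r ε φ A)
    (hR : ball e₀ R ⊆ (extChartAt J z₀).target) {q : ℝ × F} (hq : q ∈ Ioo (-ε) ε ×ˢ ball e₀ r)
    (p₁ p₂ : ℝ × F) :
    curl (covectorInChart J θ z₀) (φ q) (fderiv ℝ φ q p₁) (fderiv ℝ φ q p₂) =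
      curl (covectorInChart J θ z₀) q.2 p₁.2 p₂.2 := by
  have hker {e : F} (he : e ∈ ball e₀ R) (w : F) :=
    hX.curl_covectorInChart_fieldInChart (hR he) w
  have hφq : φ q ∈ ball e₀ R := hφ.mem _ hq.1 _ hq.2
  obtain ⟨a, v⟩ := p₁
  obtain ⟨b, w⟩ := p₂
  rw [hφ.fderiv_apply hq, hφ.fderiv_apply hq, curl_add_left, curl_smul_left, hker hφq, curl_swap,
    curl_add_left, curl_smul_left, hker hφq, curl_swap,
    hφ.curl_apply ((hX.smooth_form z₀).mono hR) fun e he w => hker he w]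
  · simp
  · exact hq

/-- The flow time `T` may depend on the point: `X` lies in the kernel of `dθ`, so the variation of
`T` does not contribute. -/
theorem pullsBackAt_localFlow (hX : IsCharacteristic J θ X)
    (hφ : IsLocalFlow (fieldInChart J X z₀) e₀ R r ε φ A)
    (hR : ball e₀ R ⊆ (extChartAt J z₀).target)
    {F' : Type*} [NormedAddCommGroup F'] [NormedSpace ℝ F'] {K' : Type*} [TopologicalSpace K']
    {J' : ModelWithCorners ℝ F' K'} {N' : Type*} [TopologicalSpace N'] [ChartedSpace K' N']
    {B : (z : N') → TangentSpace J' z → TangentSpace J' z → ℝ} {T : N' → ℝ} {Q : N' → F} {y : N'}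
    (hT : MDifferentiableAt J' 𝓘(ℝ, ℝ) T y) (hQ : PullsBackAt J' 𝓘(ℝ, F) Q (chartForm J θ z₀) B y)
    (hTQ : (T y, Q y) ∈ Ioo (-ε) ε ×ˢ ball e₀ r) :
    PullsBackAt J' 𝓘(ℝ, F) (fun y => φ (T y, Q y)) (chartForm J θ z₀) B y := by
  obtain ⟨Q', hQ', hQB⟩ := hQ
  have hpair : HasMFDerivAt J' 𝓘(ℝ, ℝ × F) (fun y => (T y, Q y)) y
      ((mfderiv J' 𝓘(ℝ, ℝ) T y).prod Q') :=
    ⟨hT.continuousAt.prodMk hQ'.1, hT.hasMFDerivAt.2.prodMk hQ'.2⟩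
  have hφTQ := (hφ.hasFDerivAt_uncurry hTQ).differentiableAt.hasFDerivAt.hasMFDerivAt
  exact ⟨_, hφTQ.comp y hpair, fun v w =>
    (hX.curl_fderiv_localFlow hφ hR hTQ _ _).trans (hQB v w)⟩

end IsCharacteristic

variable (J θ X) in
/-- A flow box of `X`: an open set with a local flow that preserves `dθ`, also for flow times that
depend on the point. Only the values of `map` at times of absolute value less than `radius` and at
points of `dom` matter. -/
structure FlowBox where
  dom : Set N
  radius : ℝ
  map : ℝ → N → N
  isOpen_dom : IsOpen dom
  radius_pos : 0 < radius
  pullsBackAt : ∀ {T : N → ℝ} {Q : N → N} {y : N}, MDifferentiableAt J 𝓘(ℝ, ℝ) T y →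
    PullsBackAt J J Q (mextDerivBilin J θ) (mextDerivBilin J θ) y → T y ∈ Ioo (-radius) radius →
    Q y ∈ dom →
    PullsBackAt J J (fun y => map (T y) (Q y)) (mextDerivBilin J θ) (mextDerivBilin J θ) y
  map_eq : ∀ {γ : ℝ → N} {a b : ℝ}, a ≤ b → b - a < radius → IsMIntegralCurveOn γ X (Icc a b) →
    (∀ s ∈ Icc a b, γ s ∈ dom) → map (b - a) (γ a) = γ b

theorem IsCharacteristic.exists_flowBox [CompleteSpace F] [J.Boundaryless] [IsManifold J 2 N]
    (hX : IsCharacteristic J θ X) (z₀ : N) : ∃ b : FlowBox J θ X, z₀ ∈ b.dom := by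
  have : IsManifold J 1 N := IsManifold.of_le (n := 2) (by norm_num)
  obtain ⟨R, r, ε, φ, A, hR, hφ⟩ := hX.exists_isLocalFlow z₀
  refine ⟨{
    dom := (extChartAt J z₀).source ∩ extChartAt J z₀ ⁻¹' ball (extChartAt J z₀ z₀) r
    radius := ε
    map := fun s y => (extChartAt J z₀).symm (φ (s, extChartAt J z₀ y))
    isOpen_dom := isOpen_chart_preimage z₀ isOpen_ball
    radius_pos := hφ.ε_pos
    pullsBackAt := fun {T Q y} hT hQ hTy hQy => ?_
    map_eq := fun {γ a b} hab hba hγ hmem => ?_ }, mem_extChartAt_source z₀, mem_ball_self hφ.r_pos⟩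
  · exact (pullsBackAt_chart_symm hX.smooth_form (hR (hφ.mem _ hTy _ hQy.2))).comp
      (f := fun y => φ (T y, extChartAt J z₀ (Q y)))
      (hX.pullsBackAt_localFlow hφ hR hT ((pullsBackAt_chart hX.smooth_form hQy.1).comp hQ)
        ⟨hTy, hQy.2⟩)
  · rw [hφ.eq_of_isMIntegralCurveOn hab hba hγ hmem,
      (extChartAt J z₀).left_inv (hmem b (right_mem_Icc.2 hab)).1]

end FlowBoxes

/-! ### Crossing a guard -/

section Crossing

open Metric Set Filter Topology

variable {F : Type*} [NormedAddCommGroup F] [NormedSpace ℝ F] {K : Type*} [TopologicalSpace K]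
  {J : ModelWithCorners ℝ F K} {N : Type*} [TopologicalSpace N] [ChartedSpace K N]

variable (J) in
/-- The part of the zero set of `g` in `W` where `g` increases along `X`. -/
def crossingSet (X : (z : N) → TangentSpace J z) (W : Set N) (g : N → ℝ) : Set N :=
  {z ∈ W | g z = 0 ∧ 0 < mvfderiv J g z (X z)}

variable (J) in
/-- The reset `ρ` pulls the one-form `θ` back to its restriction to the crossing set of `g`. The
tangent space of the crossing set is encoded as the kernel of `dg`. -/
structure IsActionReset (θ : (z : N) → TangentSpace J z →L[ℝ] ℝ) (X : (z : N) → TangentSpace J z)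
    (W : Set N) (g : N → ℝ) (ρ : N → N) : Prop where
  isOpen : IsOpen W
  smooth_defining : ContMDiffOn J 𝓘(ℝ, ℝ) 2 g W
  smooth_reset : ContMDiffOn J J 2 ρ (crossingSet J X W g)
  action : ∀ z ∈ crossingSet J X W g, ∀ v : TangentSpace J z, mvfderiv J g z v = 0 →
    θ (ρ z) (mfderivWithin J J ρ (crossingSet J X W g) z v) = θ z v

/-- A partially defined map that takes a certain time and preserves `dθ`. Only the values of `time`
and `map` on `dom` matter. -/
structure FlowStep (J : ModelWithCorners ℝ F K) {N : Type*} [TopologicalSpace N] [ChartedSpace K N]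
    (θ : (z : N) → TangentSpace J z →L[ℝ] ℝ) where
  dom : Set N
  time : N → ℝ
  map : N → N
  isOpen_dom : IsOpen dom
  mdifferentiableAt : ∀ y ∈ dom, MDifferentiableAt J 𝓘(ℝ, ℝ) time y
  pullsBackAt : ∀ y ∈ dom, PullsBackAt J J map (mextDerivBilin J θ) (mextDerivBilin J θ) y

/-- A local step that follows the field `X` until it hits `S` and then applies the reset `ρ`. -/
structure HitBox (J : ModelWithCorners ℝ F K) {N : Type*} [TopologicalSpace N] [ChartedSpace K N]
    (θ : (z : N) → TangentSpace J z →L[ℝ] ℝ) (X : (z : N) → TangentSpace J z) (S : Set N)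
    (ρ : N → N) extends FlowStep J θ where
  radius : ℝ
  radius_pos : 0 < radius
  map_eq : ∀ {γ : ℝ → N} {a b : ℝ}, a ≤ b → b - a < radius → IsMIntegralCurveOn γ X (Icc a b) →
    (∀ s ∈ Icc a b, γ s ∈ dom) → γ b ∈ S → time (γ a) = b - a ∧ map (γ a) = ρ (γ b)

theorem exists_retraction_zeroSet [CompleteSpace F] {h : F → ℝ} {e₀ ν : F} {n : ℕ∞ω} (hn : n ≠ 0)
    (hh : ContDiffAt ℝ n h e₀) (h₀ : h e₀ = 0) (hν : fderiv ℝ h e₀ ν ≠ 0) :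
    ∃ r : F → F, ContDiffAt ℝ n r e₀ ∧ r e₀ = e₀ ∧ (∀ᶠ e in 𝓝 e₀, h (r e) = 0) ∧
      ∀ᶠ e in 𝓝 e₀, h e = 0 → r e = e := by
  obtain ⟨τ, hτ, hτ₀, hτh, hτu⟩ := exists_hitTime (φ := fun q : ℝ × F => q.2 + q.1 • ν) (e₀ := e₀)
    (X₀ := ν) (h := h) hn (by fun_prop) (by simp)
    (by simpa using ((hasDerivAt_id (0 : ℝ)).smul_const ν).const_add e₀) hh h₀ hν
  refine ⟨fun e => e + τ e • ν, contDiffAt_id.add (hτ.smul contDiffAt_const), by simp [hτ₀],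
    hτh, ?_⟩
  have hzero : Tendsto (fun e : F => ((0 : ℝ), e)) (𝓝 e₀) (𝓝 (0, e₀)) :=
    (Continuous.prodMk_right (0 : ℝ)).tendsto e₀
  filter_upwards [hzero.eventually hτu] with e he heh
  simp [he (by simpa using heh)]

namespace IsActionReset

variable {θ : (z : N) → TangentSpace J z →L[ℝ] ℝ} {X : (z : N) → TangentSpace J z} {W : Set N}
  {g : N → ℝ} {ρ : N → N} {z₀ : N}

theorem mdifferentiableAt_defining (hA : IsActionReset J θ X W g ρ) {z : N} (hz : z ∈ W) :
    MDifferentiableAt J 𝓘(ℝ, ℝ) g z :=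
  (hA.smooth_defining.contMDiffAt (hA.isOpen.mem_nhds hz)).mdifferentiableAt (by simp)

section Pullback

variable {F' : Type*} [NormedAddCommGroup F'] [NormedSpace ℝ F'] {K' : Type*} [TopologicalSpace K']
  {J' : ModelWithCorners ℝ F' K'} {N' : Type*} [TopologicalSpace N'] [ChartedSpace K' N']

theorem mvfderiv_mfderiv_eq_zero (hA : IsActionReset J θ X W g ρ) {s : N' → N} {y : N'}
    (hs : MDifferentiableAt J' J s y) (hmem : ∀ᶠ x in 𝓝 y, s x ∈ crossingSet J X W g)
    (v : TangentSpace J' y) : mvfderiv J g (s y) (mfderiv J' J s y v) = 0 := by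
  have hcomp := (hA.mdifferentiableAt_defining hmem.self_of_nhds.1).hasMFDerivAt.comp y
    hs.hasMFDerivAt
  have hconst : HasMFDerivAt J' 𝓘(ℝ, ℝ) (g ∘ s) y 0 :=
    (hasMFDerivAt_const (0 : ℝ) y).congr_of_eventuallyEq (hmem.mono fun x hx => hx.2.1)
  exact congrArg (fun L => L v) (hasMFDerivAt_unique hcomp hconst)

theorem apply_mfderiv_comp (hA : IsActionReset J θ X W g ρ) {s : N' → N} {y : N'}
    (hs : MDifferentiableAt J' J s y) (hmem : ∀ᶠ x in 𝓝 y, s x ∈ crossingSet J X W g)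
    (v : TangentSpace J' y) :
    θ (ρ (s y)) (mfderiv J' J (ρ ∘ s) y v) = θ (s y) (mfderiv J' J s y v) := by
  have hρ := ((hA.smooth_reset _ hmem.self_of_nhds).mdifferentiableWithinAt
    (by simp)).hasMFDerivWithinAt
  have hcomp := (hρ.comp y (hs.hasMFDerivAt.hasMFDerivWithinAt
    (s := s ⁻¹' crossingSet J X W g)) Subset.rfl).hasMFDerivAt hmem
  rw [hcomp.mfderiv]
  exact hA.action _ hmem.self_of_nhds _ (hA.mvfderiv_mfderiv_eq_zero hs hmem v)

end Pullback

section Boundaryless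

variable [J.Boundaryless] [IsManifold J 2 N]

theorem pullsBackAt_reset_comp (hA : IsActionReset J θ X W g ρ) (hθ : IsSmoothCovectorField J θ)
    {E : Type*} [NormedAddCommGroup E] [NormedSpace ℝ E] {s : E → N} {e : E}
    (hs : ContMDiffAt 𝓘(ℝ, E) J 2 s e) (hmem : ∀ᶠ y in 𝓝 e, s y ∈ crossingSet J X W g) :
    PullsBackAt 𝓘(ℝ, E) J (ρ ∘ s) (mextDerivBilin J θ)
      (fun y v w => mextDerivBilin J θ (s y) (mfderiv 𝓘(ℝ, E) J s y v)
        (mfderiv 𝓘(ℝ, E) J s y w)) e := by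
  set α : E → E →L[ℝ] ℝ := fun y => θ (s y) ∘L mfderiv 𝓘(ℝ, E) J s y
  have hs_pull : PullsBackAt 𝓘(ℝ, E) J s (mextDerivBilin J θ) (curl α) e :=
    pullsBackAt_curl_of_eventually_pullback_eq hθ hs (Eventually.of_forall fun y v => rfl)
  have hρs : ContMDiffAt 𝓘(ℝ, E) J 2 (ρ ∘ s) e :=
    ((hA.smooth_reset _ hmem.self_of_nhds).comp e (hs.contMDiffWithinAt
      (s := s ⁻¹' crossingSet J X W g)) Subset.rfl).contMDiffAt hmem
  have hρs_pull : PullsBackAt 𝓘(ℝ, E) J (ρ ∘ s) (mextDerivBilin J θ) (curl α) e := by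
    refine pullsBackAt_curl_of_eventually_pullback_eq hθ hρs ?_
    filter_upwards [(contMDiffAt_iff_contMDiffAt_nhds (by simp)).1 hs, hmem.eventually_nhds]
      with y hy hymem v
    exact (hA.apply_mfderiv_comp (hy.mdifferentiableAt (by simp)) hymem v).symm
  refine ⟨_, hρs_pull.mdifferentiableAt.hasMFDerivAt, fun v w => ?_⟩
  exact (hρs_pull.apply_mfderiv v w).trans (hs_pull.apply_mfderiv v w).symm

theorem contDiffAt_chart (hA : IsActionReset J θ X W g ρ) (hz₀ : z₀ ∈ W) :
    ContDiffAt ℝ 2 (g ∘ (extChartAt J z₀).symm) (extChartAt J z₀ z₀) :=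
  contMDiffAt_iff_contDiffAt.1 <| ContMDiffAt.comp_of_eq
    (hA.smooth_defining.contMDiffAt (hA.isOpen.mem_nhds hz₀))
    ((contMDiffOn_extChartAt_symm z₀).contMDiffAt (extChartAt_target_mem_nhds z₀))
    (extChartAt_to_inv z₀)

theorem fderiv_chart_field (hA : IsActionReset J θ X W g ρ) {e : F}
    (he : e ∈ (extChartAt J z₀).target) (heW : (extChartAt J z₀).symm e ∈ W) :
    fderiv ℝ (g ∘ (extChartAt J z₀).symm) e (fieldInChart J X z₀ e) =
      mvfderiv J g ((extChartAt J z₀).symm e) (X ((extChartAt J z₀).symm e)) := by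
  have : IsManifold J 1 N := IsManifold.of_le (n := 2) (by norm_num)
  have hcomp : HasFDerivAt (g ∘ (extChartAt J z₀).symm)
      (mvfderiv J g ((extChartAt J z₀).symm e) ∘L chartSymmDeriv J z₀ e) e :=
    hasMFDerivAt_iff_hasFDerivAt.1
      ((hA.mdifferentiableAt_defining heW).hasMFDerivAt.comp e (hasMFDerivAt_chart_symm he))
  rw [hcomp.fderiv, ContinuousLinearMap.comp_apply, fieldInChart, chartSymmDeriv_chartDeriv_symm he]

theorem fderiv_chart_field_pos (hA : IsActionReset J θ X W g ρ)
    (hz₀ : z₀ ∈ crossingSet J X W g) :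
    0 < fderiv ℝ (g ∘ (extChartAt J z₀).symm) (extChartAt J z₀ z₀)
      (fieldInChart J X z₀ (extChartAt J z₀ z₀)) := by
  have hsymm : (extChartAt J z₀).symm (extChartAt J z₀ z₀) = z₀ := extChartAt_to_inv z₀
  rw [hA.fderiv_chart_field (mem_extChartAt_target z₀) (hsymm.symm ▸ hz₀.1), hsymm]
  exact hz₀.2.2

theorem eventually_mem_crossingSet (hA : IsActionReset J θ X W g ρ)
    (hX : IsSmoothVectorField J X) (hz₀ : z₀ ∈ crossingSet J X W g) :
    ∀ᶠ e in 𝓝 (extChartAt J z₀ z₀), g ((extChartAt J z₀).symm e) = 0 →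
      (extChartAt J z₀).symm e ∈ crossingSet J X W g := by
  have hW : ∀ᶠ e in 𝓝 (extChartAt J z₀ z₀), (extChartAt J z₀).symm e ∈ W :=
    (continuousAt_extChartAt_symm z₀).preimage_mem_nhds
      (hA.isOpen.mem_nhds ((extChartAt_to_inv (I := J) z₀).symm ▸ hz₀.1))
  have hcont : ContinuousAt (fun e => fderiv ℝ (g ∘ (extChartAt J z₀).symm) e
      (fieldInChart J X z₀ e)) (extChartAt J z₀ z₀) :=
    ((hA.contDiffAt_chart hz₀.1).fderiv_right (m := 1) (by norm_num)).continuousAt.clm_apply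
      ((hX z₀).contDiffAt (extChartAt_target_mem_nhds z₀)).continuousAt
  filter_upwards [extChartAt_target_mem_nhds z₀, hW,
    hcont.eventually_const_lt (hA.fderiv_chart_field_pos hz₀)] with e he heW hpos hg
  exact ⟨heW, hg, hA.fderiv_chart_field he heW ▸ hpos⟩

variable {R r ε : ℝ} {φ : ℝ × F → F} {A : ℝ × F → F →L[ℝ] F}

/-- The hit map `e ↦ φ (τ e, e)` is only of class `C¹`, too little for pulling back the derivative
of a form through it. The reset is therefore first composed with the `C²` retraction `s`. -/
theorem eventually_pullsBackAt_hitMap (hA : IsActionReset J θ X W g ρ)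
    (hX : IsCharacteristic J θ X)
    (hφ : IsLocalFlow (fieldInChart J X z₀) (extChartAt J z₀ z₀) R r ε φ A)
    (hR : ball (extChartAt J z₀ z₀) R ⊆ (extChartAt J z₀).target) {τ : F → ℝ} {s : F → N}
    (hτ : ContDiffAt ℝ 1 τ (extChartAt J z₀ z₀)) (hτ₀ : τ (extChartAt J z₀ z₀) = 0)
    (hτg : ∀ᶠ e in 𝓝 (extChartAt J z₀ z₀), g ((extChartAt J z₀).symm (φ (τ e, e))) = 0)
    (hs : ContMDiffAt 𝓘(ℝ, F) J 2 s (extChartAt J z₀ z₀))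
    (hs_mem : ∀ᶠ e in 𝓝 (extChartAt J z₀ z₀), s e ∈ crossingSet J X W g)
    (hs_fix : ∀ᶠ e in 𝓝 (extChartAt J z₀ z₀), g ((extChartAt J z₀).symm e) = 0 →
      s e = (extChartAt J z₀).symm e) :
    ∀ᶠ e in 𝓝 (extChartAt J z₀ z₀), PullsBackAt 𝓘(ℝ, F) J (fun e => ρ (s (φ (τ e, e))))
      (mextDerivBilin J θ) (chartForm J θ z₀) e := by
  have hcenter := mem_ball_self (x := extChartAt J z₀ z₀) hφ.r_pos
  have hdom : ∀ᶠ e in 𝓝 (extChartAt J z₀ z₀),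
      (τ e, e) ∈ Ioo (-ε) ε ×ˢ ball (extChartAt J z₀ z₀) r :=
    (hτ.continuousAt.prodMk continuousAt_id).preimage_mem_nhds
      ((isOpen_Ioo.prod isOpen_ball).mem_nhds ⟨hτ₀ ▸ hφ.zero_mem, hcenter⟩)
  have hhit : Tendsto (fun e => φ (τ e, e)) (𝓝 (extChartAt J z₀ z₀))
      (𝓝 (extChartAt J z₀ z₀)) := by
    have hcont : ContinuousAt (fun e => φ (τ e, e)) (extChartAt J z₀ z₀) :=
      ContinuousAt.comp (g := φ) (hφ.hasFDerivAt_uncurry hdom.self_of_nhds).continuousAt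
        (hτ.continuousAt.prodMk continuousAt_id)
    simpa only [ContinuousAt, hτ₀, hφ.zero _ hcenter] using hcont
  have hfix : ∀ᶠ e in 𝓝 (extChartAt J z₀ z₀),
      s (φ (τ e, e)) = (extChartAt J z₀).symm (φ (τ e, e)) := by
    filter_upwards [hhit.eventually hs_fix, hτg] with e he hg using he hg
  filter_upwards [hdom, hτ.eventually (by simp), hfix.eventually_nhds,
    hhit.eventually ((contMDiffAt_iff_contMDiffAt_nhds (by simp)).1 hs),
    hhit.eventually hs_mem.eventually_nhds] with e he hτe hfix_e hs_e hmem_e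
  have hflow : PullsBackAt 𝓘(ℝ, F) 𝓘(ℝ, F) (fun e => φ (τ e, e)) (chartForm J θ z₀)
      (chartForm J θ z₀) e :=
    hX.pullsBackAt_localFlow hφ hR (Q := id) (hτe.differentiableAt (by simp)).mdifferentiableAt
      ⟨_, hasMFDerivAt_id _, fun _ _ => rfl⟩ he
  refine PullsBackAt.comp_of_comp (σ := fun e => φ (τ e, e))
    (hA.pullsBackAt_reset_comp hX.smooth_form hs_e hmem_e) (hs_e.mdifferentiableAt (by simp))
    hflow.mdifferentiableAt ?_
  exact ((pullsBackAt_chart_symm hX.smooth_form (hR (hφ.mem _ he.1 _ he.2))).comp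
    (f := fun e => φ (τ e, e)) hflow).congr_of_eventuallyEq hfix_e

variable [CompleteSpace F]

theorem exists_retraction_crossingSet (hA : IsActionReset J θ X W g ρ)
    (hX : IsSmoothVectorField J X) (hz₀ : z₀ ∈ crossingSet J X W g) :
    ∃ s : F → N, ContMDiffAt 𝓘(ℝ, F) J 2 s (extChartAt J z₀ z₀) ∧
      (∀ᶠ e in 𝓝 (extChartAt J z₀ z₀), s e ∈ crossingSet J X W g) ∧
      ∀ᶠ e in 𝓝 (extChartAt J z₀ z₀), g ((extChartAt J z₀).symm e) = 0 →
        s e = (extChartAt J z₀).symm e := by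
  obtain ⟨r, hr, hr₀, hrg, hrfix⟩ := exists_retraction_zeroSet two_ne_zero
    (hA.contDiffAt_chart hz₀.1) (by simpa using hz₀.2.1) (hA.fderiv_chart_field_pos hz₀).ne'
  have htendsto : Tendsto r (𝓝 (extChartAt J z₀ z₀)) (𝓝 (extChartAt J z₀ z₀)) := by
    simpa only [ContinuousAt, hr₀] using hr.continuousAt
  refine ⟨(extChartAt J z₀).symm ∘ r, ?_, ?_, ?_⟩
  · exact ContMDiffAt.comp_of_eq
      ((contMDiffOn_extChartAt_symm z₀).contMDiffAt (extChartAt_target_mem_nhds z₀))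
      hr.contMDiffAt hr₀
  · filter_upwards [htendsto.eventually (hA.eventually_mem_crossingSet hX hz₀), hrg] with e he hg
    exact he hg
  · filter_upwards [hrfix] with e he hg
    rw [Function.comp_apply, he hg]

theorem exists_hitTime_localFlow (hA : IsActionReset J θ X W g ρ)
    (hz₀ : z₀ ∈ crossingSet J X W g)
    (hφ : IsLocalFlow (fieldInChart J X z₀) (extChartAt J z₀ z₀) R r ε φ A) :
    ∃ τ : F → ℝ, ContDiffAt ℝ 1 τ (extChartAt J z₀ z₀) ∧ τ (extChartAt J z₀ z₀) = 0 ∧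
      (∀ᶠ e in 𝓝 (extChartAt J z₀ z₀), g ((extChartAt J z₀).symm (φ (τ e, e))) = 0) ∧
      ∀ᶠ q : ℝ × F in 𝓝 (0, extChartAt J z₀ z₀),
        g ((extChartAt J z₀).symm (φ q)) = 0 → τ q.2 = q.1 := by
  have hcenter := mem_ball_self (x := extChartAt J z₀ z₀) hφ.r_pos
  have hφ₀ := hφ.zero _ hcenter
  have hderiv := hφ.hasDerivAt 0 hφ.zero_mem _ hcenter
  rw [hφ₀] at hderiv
  exact exists_hitTime one_ne_zero (hφ.contDiffOn.contDiffAt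
      ((isOpen_Ioo.prod isOpen_ball).mem_nhds ⟨hφ.zero_mem, hcenter⟩)) hφ₀ hderiv
    ((hA.contDiffAt_chart hz₀.1).of_le (by norm_num)) (by simpa using hz₀.2.1)
    (hA.fderiv_chart_field_pos hz₀).ne'

theorem exists_hitBox (hA : IsActionReset J θ X W g ρ) (hX : IsCharacteristic J θ X)
    (hz₀ : z₀ ∈ crossingSet J X W g) :
    ∃ b : HitBox J θ X (crossingSet J X W g) ρ, z₀ ∈ b.dom := by
  have : IsManifold J 1 N := IsManifold.of_le (n := 2) (by norm_num)
  obtain ⟨R, r, ε, φ, A, hR, hφ⟩ := hX.exists_isLocalFlow z₀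
  obtain ⟨s, hs, hs_mem, hs_fix⟩ := hA.exists_retraction_crossingSet hX.smooth_field hz₀
  obtain ⟨τ, hτ, hτ₀, hτg, hτ_unique⟩ := hA.exists_hitTime_localFlow hz₀ hφ
  obtain ⟨δ, hδ, hball⟩ := Metric.eventually_nhds_iff_ball.1 <|
    Filter.Eventually.and (ball_mem_nhds _ hφ.r_pos) <|
      (hτ.eventually (by simp)).and <| hs_fix.and <|
      hA.eventually_pullsBackAt_hitMap hX hφ hR hτ hτ₀ hτg hs hs_mem hs_fix
  obtain ⟨δ', hδ', hball'⟩ := Metric.eventually_nhds_iff_ball.1 hτ_unique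
  refine ⟨{
    dom := (extChartAt J z₀).source ∩
      extChartAt J z₀ ⁻¹' ball (extChartAt J z₀ z₀) (min δ δ')
    time := fun y => τ (extChartAt J z₀ y)
    map := fun y => ρ (s (φ (τ (extChartAt J z₀ y), extChartAt J z₀ y)))
    radius := min ε δ'
    isOpen_dom := isOpen_chart_preimage z₀ isOpen_ball
    mdifferentiableAt := fun y ⟨hy, hyB⟩ => ?_
    pullsBackAt := fun y ⟨hy, hyB⟩ => ?_
    radius_pos := lt_min hφ.ε_pos hδ'
    map_eq := fun {γ a b} hab hba hγ hmem hγS => ?_ },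
    mem_extChartAt_source z₀, mem_ball_self (lt_min hδ hδ')⟩
  · have hτy := (hball _ (ball_subset_ball (min_le_left _ _) hyB)).2.1.differentiableAt (by simp)
    exact hτy.mdifferentiableAt.comp y (hasMFDerivAt_chart hy).mdifferentiableAt
  · exact (hball _ (ball_subset_ball (min_le_left _ _) hyB)).2.2.2.comp
      (pullsBackAt_chart hX.smooth_form hy)
  · have hflow : φ (b - a, extChartAt J z₀ (γ a)) = extChartAt J z₀ (γ b) :=
      hφ.eq_of_isMIntegralCurveOn hab (hba.trans_le (min_le_left _ _)) hγ fun t ht =>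
        ⟨(hmem t ht).1, (hball _ (ball_subset_ball (min_le_left _ _) (hmem t ht).2)).1⟩
    obtain ⟨hb_source, hb_ball⟩ := hmem b (right_mem_Icc.2 hab)
    have hgb : g ((extChartAt J z₀).symm (extChartAt J z₀ (γ b))) = 0 := by
      rw [(extChartAt J z₀).left_inv hb_source, hγS.2.1]
    have hmem_ball : (b - a, extChartAt J z₀ (γ a)) ∈ ball (0, extChartAt J z₀ z₀) δ' := by
      rw [← ball_prod_same, Real.ball_eq_Ioo]
      exact ⟨⟨by linarith, by linarith [hba.trans_le (min_le_right _ _)]⟩,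
        ball_subset_ball (min_le_right _ _) (hmem a (left_mem_Icc.2 hab)).2⟩
    have hτa : τ (extChartAt J z₀ (γ a)) = b - a := hball' _ hmem_ball (hflow ▸ hgb)
    refine ⟨hτa, ?_⟩
    rw [hτa, hflow, (hball _ (ball_subset_ball (min_le_left _ _) hb_ball)).2.2.1 hgb,
      (extChartAt J z₀).left_inv hb_source]

end Boundaryless

end IsActionReset

end Crossing

/-! ### Words of local steps -/

section Words

open Metric Set Filter Topology

variable {F : Type*} [NormedAddCommGroup F] [NormedSpace ℝ F] {K : Type*} [TopologicalSpace K]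
  {J : ModelWithCorners ℝ F K} {N : Type*} [TopologicalSpace N] [ChartedSpace K N]
  {θ : (z : N) → TangentSpace J z →L[ℝ] ℝ} {X : (z : N) → TangentSpace J z} {S : Set N} {ρ : N → N}

namespace FlowStep

variable (J θ) in
/-- The step that does nothing. -/
protected def refl : FlowStep J θ where
  dom := univ
  time _ := 0
  map := id
  isOpen_dom := isOpen_univ
  mdifferentiableAt _ _ := mdifferentiableAt_const
  pullsBackAt _ _ := ⟨_, hasMFDerivAt_id _, fun _ _ => rfl⟩

/-- The composition of two steps, the first one being performed first. -/
protected def trans (s₁ s₂ : FlowStep J θ) : FlowStep J θ where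
  dom := s₁.dom ∩ s₁.map ⁻¹' s₂.dom
  time y := s₁.time y + s₂.time (s₁.map y)
  map := s₂.map ∘ s₁.map
  isOpen_dom := ContinuousOn.isOpen_inter_preimage
    (fun y hy => (s₁.pullsBackAt y hy).continuousAt.continuousWithinAt) s₁.isOpen_dom s₂.isOpen_dom
  mdifferentiableAt y hy := (s₁.mdifferentiableAt y hy.1).add
    ((s₂.mdifferentiableAt _ hy.2).comp y (s₁.pullsBackAt y hy.1).mdifferentiableAt)
  pullsBackAt y hy := (s₂.pullsBackAt _ hy.2).comp (s₁.pullsBackAt y hy.1)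

/-- The step `s` followed by the flow in the box `b` up to the total time `t`. -/
def thenFlow (s : FlowStep J θ) (b : FlowBox J θ X) (t : ℝ) : FlowStep J θ where
  dom := {y ∈ s.dom | s.map y ∈ b.dom ∧ t - s.time y ∈ Ioo (-b.radius) b.radius}
  time _ := t
  map y := b.map (t - s.time y) (s.map y)
  isOpen_dom := by
    have hcont : ContinuousOn (fun y => (s.map y, t - s.time y)) s.dom := fun y hy =>
      ((s.pullsBackAt y hy).continuousAt.prodMk
        (continuousAt_const.sub (s.mdifferentiableAt y hy).continuousAt)).continuousWithinAt
    exact hcont.isOpen_inter_preimage s.isOpen_dom (b.isOpen_dom.prod isOpen_Ioo)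
  mdifferentiableAt _ _ := mdifferentiableAt_const
  pullsBackAt y hy := b.pullsBackAt
    (mdifferentiableAt_const.sub (s.mdifferentiableAt y hy.1)) (s.pullsBackAt y hy.1) hy.2.2 hy.2.1

/-- The step `s` leads from `y` to `w` in time `t`. -/
structure Leads (s : FlowStep J θ) (t : ℝ) (y w : N) : Prop where
  mem : y ∈ s.dom
  time_eq : s.time y = t
  map_eq : s.map y = w

theorem leads_refl (y : N) : (FlowStep.refl J θ).Leads 0 y y := ⟨mem_univ y, rfl, rfl⟩

theorem Leads.trans {s₁ s₂ : FlowStep J θ} {t₁ t₂ : ℝ} {x y z : N} (hs₁ : s₁.Leads t₁ x y)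
    (hs₂ : s₂.Leads t₂ y z) : (s₁.trans s₂).Leads (t₁ + t₂) x z := by
  obtain ⟨hx, rfl, rfl⟩ := hs₁
  obtain ⟨hy, rfl, rfl⟩ := hs₂
  exact ⟨⟨hx, hy⟩, rfl, rfl⟩

theorem leads_thenFlow_iff {s : FlowStep J θ} {b : FlowBox J θ X} {t : ℝ} {y w : N} :
    (s.thenFlow b t).Leads t y w ↔ ∃ a z, s.Leads a y z ∧ z ∈ b.dom ∧
      t - a ∈ Ioo (-b.radius) b.radius ∧ b.map (t - a) z = w := by
  constructor
  · rintro ⟨⟨hy, hyb, hyt⟩, -, hw⟩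
    exact ⟨_, _, ⟨hy, rfl, rfl⟩, hyb, hyt, hw⟩
  · rintro ⟨_, _, ⟨hy, rfl, rfl⟩, hyb, hyt, hw⟩
    exact ⟨⟨hy, hyb, hyt⟩, rfl, hw⟩

theorem Leads.thenFlow {s : FlowStep J θ} {b : FlowBox J θ X} {γ : ℝ → N} {a c d t : ℝ} {y : N}
    (hs : s.Leads a y (γ c)) (hcd : c ≤ d) (hdc : d - c < b.radius)
    (hγ : IsMIntegralCurveOn γ X (Icc c d)) (hmem : ∀ u ∈ Icc c d, γ u ∈ b.dom)
    (ht : t - a = d - c) : (s.thenFlow b t).Leads t y (γ d) := by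
  refine leads_thenFlow_iff.2 ⟨a, γ c, hs, hmem c (left_mem_Icc.2 hcd), ?_, ?_⟩
  · rw [ht]
    exact ⟨by linarith [b.radius_pos], hdc⟩
  · rw [ht, b.map_eq hcd hdc hγ hmem]

variable {ι : Type*} (s : ι → FlowStep J θ)

/-- The composition of a word of steps. -/
def word : List ι → FlowStep J θ
  | [] => FlowStep.refl J θ
  | i :: l => (s i).trans (word l)

variable {s}

theorem Leads.append {l₁ l₂ : List ι} {t₁ t₂ : ℝ} {x y z : N} (hl₁ : (word s l₁).Leads t₁ x y)
    (hl₂ : (word s l₂).Leads t₂ y z) : (word s (l₁ ++ l₂)).Leads (t₁ + t₂) x z := by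
  induction l₁ generalizing t₁ x with
  | nil =>
    obtain ⟨-, rfl, rfl⟩ := hl₁
    rw [show (word s []).time x = 0 from rfl, zero_add]
    exact hl₂
  | cons i l ih =>
    obtain ⟨⟨hx, hl⟩, rfl, rfl⟩ := hl₁
    have htrans := Leads.trans (s₁ := s i) ⟨hx, rfl, rfl⟩ (ih ⟨hl, rfl, rfl⟩)
    rwa [← add_assoc] at htrans

theorem Leads.word_singleton {i : ι} {t : ℝ} {y z : N} (hi : (s i).Leads t y z) :
    (word s [i]).Leads t y z :=
  add_zero t ▸ hi.trans (leads_refl z)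

end FlowStep

section Letters

variable {β κ : Type*} (b : β → FlowBox J θ X) (k : κ → HitBox J θ X S ρ)

/-- The letters from which executions are composed: the flow in a box for a rational time, and the
flow up to the guard followed by the reset. Only rational times are allowed, for the sake of
countability. -/
def letterStep : (β × ℚ) ⊕ κ → FlowStep J θ
  | .inl (i, q) => (FlowStep.refl J θ).thenFlow (b i) q
  | .inr j => (k j).toFlowStep

variable {b k}

theorem exists_forall_mem_of_continuousOn {Y : Type*} [TopologicalSpace Y] {γ : ℝ → Y} {s : Set ℝ}
    {c a : ℝ} {O : Set Y} (hγ : ContinuousOn γ s) (hc : c ∈ s) (hO : IsOpen O) (hcO : γ c ∈ O)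
    (ha : 0 < a) : ∃ δ, 0 < δ ∧ δ ≤ a ∧ ∀ u ∈ s, |u - c| < δ → γ u ∈ O := by
  obtain ⟨δ, hδ, hball⟩ := Metric.mem_nhdsWithin_iff.1
    ((hγ c hc).preimage_mem_nhdsWithin (hO.mem_nhds hcO))
  exact ⟨min δ a, lt_min hδ ha, min_le_right _ _,
    fun u hu huc => hball ⟨mem_ball_iff_norm.2 (huc.trans_le (min_le_left _ _)), hu⟩⟩

variable (b k) in
/-- The times at which a word of letters has followed the curve `γ` from its start. -/
def reachedTimes (γ : ℝ → N) : Set ℝ :=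
  {c | ∃ l, (FlowStep.word (letterStep b k) l).Leads c (γ 0) (γ c)}

theorem exists_mem_reachedTimes_gt (hb : ∀ z, ∃ i, z ∈ (b i).dom) {γ : ℝ → N} {t x y : ℝ}
    (hγ : IsMIntegralCurveOn γ X (Icc 0 t)) (hx : x ∈ Ico 0 t) (hxy : x < y)
    (hx_closure : x ∈ closure (reachedTimes b k γ ∩ Icc 0 t)) :
    (reachedTimes b k γ ∩ Icc 0 t ∩ Ioc x y).Nonempty := by
  obtain ⟨i, hi⟩ := hb (γ x)
  obtain ⟨η, hη, hη_radius, hη_dom⟩ := exists_forall_mem_of_continuousOn hγ.continuousOn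
    ⟨hx.1, hx.2.le⟩ (b i).isOpen_dom hi (b i).radius_pos
  have hxyt : x < min y t := lt_min hxy hx.2
  obtain ⟨c, ⟨⟨l, hl⟩, hc⟩, hcx⟩ := Metric.mem_closure_iff.1 hx_closure
    (min (η / 2) (min y t - x)) (lt_min (half_pos hη) (sub_pos.2 hxyt))
  obtain ⟨⟨hcx_left, hcx_right⟩, hcy⟩ :=
    (lt_min_iff.1 hcx).imp abs_lt.1 fun h => (abs_lt.1 h).1
  obtain ⟨q, hq, hq'⟩ := exists_rat_btwn
    (show max 0 (x - c) < min (min y t - c) (η / 2) by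
      refine max_lt (lt_min ?_ ?_) (lt_min ?_ ?_) <;> linarith)
  obtain ⟨hq_pos, hxq⟩ := max_lt_iff.1 hq
  obtain ⟨hqy, hqη⟩ := lt_min_iff.1 hq'
  have hcq : c + q ≤ min y t := by linarith
  have hsub : Icc c (c + q) ⊆ Icc 0 t :=
    Icc_subset_Icc hc.1 (hcq.trans (min_le_right _ _))
  have hdom : ∀ u ∈ Icc c (c + q), γ u ∈ (b i).dom := fun u hu =>
    hη_dom u (hsub hu) (abs_lt.2 ⟨by linarith [hu.1], by linarith [hu.2]⟩)
  have hstep : (letterStep b k (.inl (i, q))).Leads q (γ c) (γ (c + q)) :=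
    (FlowStep.leads_refl (γ c)).thenFlow (by linarith) (by linarith) (hγ.mono hsub) hdom (by ring)
  refine ⟨c + q, ⟨⟨l ++ [.inl (i, q)], hl.append hstep.word_singleton⟩, ?_⟩, by linarith,
    hcq.trans (min_le_left _ _)⟩
  exact hsub (right_mem_Icc.2 (by linarith))

/-- Words reach times arbitrarily close to the end `t` of an integral curve, though not necessarily
`t` itself. -/
theorem mem_closure_reachedTimes (hb : ∀ z, ∃ i, z ∈ (b i).dom) {γ : ℝ → N} {t : ℝ} (ht : 0 ≤ t)
    (hγ : IsMIntegralCurveOn γ X (Icc 0 t)) : t ∈ closure (reachedTimes b k γ ∩ Icc 0 t) := by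
  have hsub : Icc 0 t ⊆ closure (reachedTimes b k γ ∩ Icc 0 t) :=
    IsClosed.Icc_subset_of_forall_exists_gt (isClosed_closure.inter isClosed_Icc)
      (subset_closure ⟨⟨[], FlowStep.leads_refl _⟩, left_mem_Icc.2 ht⟩) fun x hx y hxy =>
        (exists_mem_reachedTimes_gt hb hγ hx.2 hxy hx.1).mono
          (inter_subset_inter_left _ subset_closure)
  exact hsub (right_mem_Icc.2 ht)

theorem exists_leads_of_isOpen (hb : ∀ z, ∃ i, z ∈ (b i).dom) {γ : ℝ → N} {t δ : ℝ} {O : Set N}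
    (ht : 0 ≤ t) (hγ : IsMIntegralCurveOn γ X (Icc 0 t)) (hδ : 0 < δ) (hO : IsOpen O)
    (htO : γ t ∈ O) :
    ∃ l, ∃ c ∈ Icc 0 t, t - c < δ ∧ (∀ s ∈ Icc c t, γ s ∈ O) ∧
      (FlowStep.word (letterStep b k) l).Leads c (γ 0) (γ c) := by
  obtain ⟨η, hη, hηδ, hηO⟩ := exists_forall_mem_of_continuousOn hγ.continuousOn
    (right_mem_Icc.2 ht) hO htO hδ
  obtain ⟨c, ⟨⟨l, hl⟩, hc⟩, hct⟩ :=
    Metric.mem_closure_iff.1 (mem_closure_reachedTimes (k := k) hb ht hγ) η hη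
  have hct' : t - c < η := (le_abs_self _).trans_lt hct
  refine ⟨l, c, hc, hct'.trans_le hηδ, fun s hs => hηO s ⟨hc.1.trans hs.1, hs.2⟩ ?_, hl⟩
  exact abs_lt.2 ⟨by linarith [hs.1], by linarith [hs.2]⟩

/-- Countably many steps, one for each word and each final flow box, account for all executions. -/
theorem HybridSystem.Reaches.exists_leads {Y : HybridSystem J N} {b : β → FlowBox J θ Y.field}
    {k : κ → HitBox J θ Y.field Y.guard Y.reset} (hb : ∀ z, ∃ i, z ∈ (b i).dom)
    (hk : ∀ z ∈ Y.guard, ∃ j, z ∈ (k j).dom) {t : ℝ} {y w : N} (h : Y.Reaches t y w) :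
    ∃ l i, ((FlowStep.word (letterStep b k) l).thenFlow (b i) t).Leads t y w := by
  induction h with
  | flow t γ ht hγ _ =>
    obtain ⟨i, hi⟩ := hb (γ t)
    obtain ⟨l, c, hc, hct, hmem, hl⟩ := exists_leads_of_isOpen (k := k) hb ht hγ
      (b i).radius_pos (b i).isOpen_dom hi
    exact ⟨l, i, hl.thenFlow hc.2 hct (hγ.mono (Icc_subset_Icc_left hc.1)) hmem rfl⟩
  | reset τ t γ _ hτ _ hγ _ hτS _ ih =>
    obtain ⟨l', i, hrest⟩ := ih
    obtain ⟨a, z, hl', hz, ha, hmap_z⟩ := FlowStep.leads_thenFlow_iff.1 hrest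
    obtain ⟨j, hj⟩ := hk _ hτS
    obtain ⟨l, c, hc, hcτ, hmem, hl⟩ := exists_leads_of_isOpen (k := k) hb hτ hγ
      (k j).radius_pos (k j).isOpen_dom hj
    obtain ⟨htime, hmap⟩ :=
      (k j).map_eq hc.2 hcτ (hγ.mono (Icc_subset_Icc_left hc.1)) hmem hτS
    have hreset : (letterStep b k (.inr j)).Leads (τ - c) (γ c) (Y.reset (γ τ)) :=
      ⟨hmem c (left_mem_Icc.2 hc.2), htime, hmap⟩
    have hprefix := hl.append hreset.word_singleton
    rw [add_sub_cancel] at hprefix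
    have htime_eq : τ + t - (τ + a) = t - a := add_sub_add_left_eq_sub t a τ
    exact ⟨_, i, FlowStep.leads_thenFlow_iff.2
      ⟨_, z, hprefix.append hl', hz, htime_eq ▸ ha, htime_eq ▸ hmap_z⟩⟩

end Letters

end Words

/-! ### Preservation along executions -/

section Baire

open Set Filter Topology

/-- The closures of the sets where `f i = g i` cover `U`, hence by Baire's theorem the union of
their interiors is dense in `U`. -/
theorem frequently_exists_eventuallyEq {N N' ι : Type*} [TopologicalSpace N] [BaireSpace N]
    [TopologicalSpace N'] [T2Space N'] [Countable ι] {U : Set N} (hU : IsOpen U) {O : ι → Set N}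
    (hO : ∀ i, IsOpen (O i)) {f g : ι → N → N'} (hf : ∀ i, ContinuousOn (f i) (O i))
    (hg : ∀ i, ContinuousOn (g i) (O i)) (hcover : ∀ y ∈ U, ∃ i, y ∈ O i ∧ f i y = g i y) {x : N}
    (hx : x ∈ U) : ∃ᶠ y in 𝓝 x, ∃ i, y ∈ O i ∧ f i =ᶠ[𝓝 y] g i := by
  have hdense : Dense (⋃ i : Option ι,
      interior (i.elim Uᶜ fun i => closure {y ∈ O i | f i y = g i y})) := by
    refine dense_iUnion_interior_of_closed (Option.forall.2 ⟨hU.isClosed_compl, fun i =>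
      isClosed_closure⟩) (eq_univ_of_forall fun y => ?_)
    by_cases hy : y ∈ U
    · obtain ⟨i, hi⟩ := hcover y hy
      exact mem_iUnion.2 ⟨some i, subset_closure hi⟩
    · exact mem_iUnion.2 ⟨none, hy⟩
  rw [frequently_iff]
  intro V hV
  obtain ⟨z, ⟨hzV, hzU⟩, hz⟩ := hdense.inter_open_nonempty _ (isOpen_interior.inter hU)
    ⟨x, mem_interior_iff_mem_nhds.2 hV, hx⟩
  obtain ⟨i, hi⟩ := mem_iUnion.1 hz
  cases i with
  | none => exact absurd hzU (interior_subset hi)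
  | some i =>
    obtain ⟨y, ⟨hyV, hyi⟩, hyO, -⟩ := mem_closure_iff.1 (interior_subset hi) _
      (isOpen_interior.inter isOpen_interior) ⟨hzV, hi⟩
    refine ⟨y, interior_subset hyV, i, hyO, ?_⟩
    filter_upwards [isOpen_interior.mem_nhds hyi, (hO i).mem_nhds hyO] with u hu huO
    exact tendsto_nhds_unique_of_frequently_eq ((hf i).continuousAt ((hO i).mem_nhds huO))
      ((hg i).continuousAt ((hO i).mem_nhds huO))
      ((mem_closure_iff_frequently.1 (interior_subset hu)).mono fun _ h => h.2)

end Baire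

section ModelSpace

open Filter Topology

variable {E E' : Type*} [NormedAddCommGroup E] [NormedSpace ℝ E] [NormedAddCommGroup E']
  [NormedSpace ℝ E']

theorem continuousAt_curl {Y : Type*} [TopologicalSpace Y] {θ : E → E →L[ℝ] ℝ} {f v w : Y → E}
    {y : Y} (hθ : ContDiffAt ℝ 2 θ (f y)) (hf : ContinuousAt f y) (hv : ContinuousAt v y)
    (hw : ContinuousAt w y) : ContinuousAt (fun y => curl θ (f y) (v y) (w y)) y := by
  have hderiv : ContinuousAt (fun y => fderiv ℝ θ (f y)) y :=
    (hθ.fderiv_right (m := 1) (by norm_num)).continuousAt.comp hf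
  exact ((hderiv.clm_apply hv).clm_apply hw).sub ((hderiv.clm_apply hw).clm_apply hv)

theorem pullsBackAt_curl_of_frequently {θ : E → E →L[ℝ] ℝ} {θ' : E' → E' →L[ℝ] ℝ} {f : E → E'}
    {e : E} (hθ : ContDiffAt ℝ 2 θ e) (hθ' : ContDiffAt ℝ 2 θ' (f e)) (hf : ContDiffAt ℝ 2 f e)
    (hfreq : ∃ᶠ y in 𝓝 e, PullsBackAt 𝓘(ℝ, E) 𝓘(ℝ, E') f (curl θ') (curl θ) y) :
    PullsBackAt 𝓘(ℝ, E) 𝓘(ℝ, E') f (curl θ') (curl θ) e := by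
  have hderiv : ContinuousAt (fderiv ℝ f) e :=
    (hf.fderiv_right (m := 1) (by norm_num)).continuousAt
  refine ⟨_, (hf.differentiableAt (by simp)).hasFDerivAt.hasMFDerivAt, fun v w => ?_⟩
  refine tendsto_nhds_unique_of_frequently_eq
    (continuousAt_curl (v := fun y => fderiv ℝ f y v) (w := fun y => fderiv ℝ f y w) hθ'
      hf.continuousAt (hderiv.clm_apply continuousAt_const) (hderiv.clm_apply continuousAt_const))
    (continuousAt_curl (f := id) hθ continuousAt_id continuousAt_const continuousAt_const)
    (hfreq.mono fun y hy => ?_)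
  have happly := hy.apply_mfderiv v w
  rw [mfderiv_eq_fderiv] at happly
  exact happly

end ModelSpace

section Preservation

open Set Filter Topology

variable {F : Type*} [NormedAddCommGroup F] [NormedSpace ℝ F] {K : Type*} [TopologicalSpace K]
  {J : ModelWithCorners ℝ F K} {N : Type*} [TopologicalSpace N] [ChartedSpace K N]
  {θ : (z : N) → TangentSpace J z →L[ℝ] ℝ}

theorem PullsBackAt.of_comp_eventuallyEq_id {B : (z : N) → TangentSpace J z → TangentSpace J z → ℝ}
    {F' : Type*} [NormedAddCommGroup F'] [NormedSpace ℝ F'] {K' : Type*} [TopologicalSpace K']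
    {J' : ModelWithCorners ℝ F' K'} {N' : Type*} [TopologicalSpace N'] [ChartedSpace K' N']
    {B' : (z : N') → TangentSpace J' z → TangentSpace J' z → ℝ} {f : N → N'} {g : N' → N} {z : N}
    (hg : PullsBackAt J' J g B B' (f z)) (hf : MDifferentiableAt J J' f z)
    (hgf : g ∘ f =ᶠ[𝓝 z] id) : PullsBackAt J J' f B' B z := by
  have hid : PullsBackAt J J (g ∘ f) B B z :=
    PullsBackAt.congr_of_eventuallyEq ⟨_, hasMFDerivAt_id z, fun _ _ => rfl⟩ hgf
  refine ⟨_, hf.hasMFDerivAt, fun v w => ?_⟩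
  have happly := hid.apply_mfderiv v w
  rw [mfderiv_comp z hg.mdifferentiableAt hf] at happly
  exact (hg.apply_mfderiv _ _).symm.trans happly

variable [J.Boundaryless] [IsManifold J 2 N]

theorem PullsBackAt.of_frequently (hθ : IsSmoothCovectorField J θ) {Φ : N → N} {x : N}
    (hΦ : ContMDiffAt J J 2 Φ x)
    (hfreq : ∃ᶠ y in 𝓝 x, PullsBackAt J J Φ (mextDerivBilin J θ) (mextDerivBilin J θ) y) :
    PullsBackAt J J Φ (mextDerivBilin J θ) (mextDerivBilin J θ) x := by
  set χ := extChartAt J x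
  set χ' := extChartAt J (Φ x)
  have hx : χ.symm (χ x) = x := extChartAt_to_inv x
  have hsource : ∀ᶠ y in 𝓝 x, y ∈ χ.source ∧ Φ y ∈ χ'.source :=
    Filter.Eventually.and (extChartAt_source_mem_nhds x)
      (hΦ.continuousAt.preimage_mem_nhds (extChartAt_source_mem_nhds (Φ x)))
  have hΦ_chart : ContDiffAt ℝ 2 (χ' ∘ Φ ∘ χ.symm) (χ x) :=
    contMDiffAt_iff_contDiffAt.1 <| ContMDiffAt.comp_of_eq contMDiffAt_extChartAt
      (ContMDiffAt.comp_of_eq hΦ ((contMDiffOn_extChartAt_symm x).contMDiffAt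
        (extChartAt_target_mem_nhds x)) hx) (congrArg Φ hx)
  have hfreq_chart : ∃ᶠ e in 𝓝 (χ x), PullsBackAt 𝓘(ℝ, F) 𝓘(ℝ, F) (χ' ∘ Φ ∘ χ.symm)
      (chartForm J θ (Φ x)) (chartForm J θ x) e := by
    refine (continuousAt_extChartAt x).tendsto.frequently
      ((hfreq.and_eventually hsource).mono fun y ⟨hy, hyx, hyΦ⟩ => ?_)
    have hyy : χ.symm (χ y) = y := χ.left_inv hyx
    exact (pullsBackAt_chart hθ (hyy.symm ▸ hyΦ : Φ (χ.symm (χ y)) ∈ χ'.source)).comp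
      (f := Φ ∘ χ.symm) (PullsBackAt.comp (by rwa [hyy])
        (pullsBackAt_chart_symm hθ (χ.map_source hyx)))
  have hΦx : (χ' ∘ Φ ∘ χ.symm) (χ x) = χ' (Φ x) := congrArg (fun y => χ' (Φ y)) hx
  have hchart : PullsBackAt 𝓘(ℝ, F) 𝓘(ℝ, F) (χ' ∘ Φ ∘ χ.symm)
      (chartForm J θ (Φ x)) (chartForm J θ x) (χ x) :=
    pullsBackAt_curl_of_frequently ((hθ x).contDiffAt (extChartAt_target_mem_nhds x))
      ((hθ (Φ x)).contDiffAt (hΦx ▸ extChartAt_target_mem_nhds (Φ x))) hΦ_chart hfreq_chart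
  have hsymm := (pullsBackAt_chart_symm hθ (hΦx ▸ mem_extChartAt_target (Φ x))).comp hchart
  refine (hsymm.comp (pullsBackAt_chart hθ (mem_extChartAt_source x))).congr_of_eventuallyEq ?_
  filter_upwards [hsource] with y hy
  exact ((congrArg (fun u => χ'.symm (χ' (Φ u))) (χ.left_inv hy.1)).trans (χ'.left_inv hy.2)).symm

variable [BaireSpace N] [T2Space N] {ι : Type*} [Countable ι] {U : Set N} {Φ : N → N}
  {t : ℝ} {x : N}

theorem pullsBackAt_of_exists_leads {s : ι → FlowStep J θ} (hθ : IsSmoothCovectorField J θ)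
    (hU : IsOpen U) (hΦ : ContMDiffOn J J 2 Φ U)
    (hs : ∀ y ∈ U, ∃ i, (s i).Leads t y (Φ y)) (hx : x ∈ U) :
    PullsBackAt J J Φ (mextDerivBilin J θ) (mextDerivBilin J θ) x := by
  have hfreq := frequently_exists_eventuallyEq hU (O := fun i => U ∩ (s i).dom)
    (fun i => hU.inter (s i).isOpen_dom) (f := fun _ => Φ) (g := fun i => (s i).map)
    (fun i => hΦ.continuousOn.mono inter_subset_left)
    (fun i y hy => ((s i).pullsBackAt y hy.2).continuousAt.continuousWithinAt)
    (fun y hy => (hs y hy).imp fun i hi => ⟨⟨hy, hi.mem⟩, hi.map_eq.symm⟩) hx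
  refine PullsBackAt.of_frequently hθ (hΦ.contMDiffAt (hU.mem_nhds hx)) (hfreq.mono ?_)
  rintro y ⟨i, hy, hi⟩
  exact ((s i).pullsBackAt y hy.2).congr_of_eventuallyEq hi

theorem pullsBackAt_of_exists_leads_symm {s : ι → FlowStep J θ} (hθ : IsSmoothCovectorField J θ)
    (hU : IsOpen U) (hΦ : ContMDiffOn J J 2 Φ U)
    (hs : ∀ y ∈ U, ∃ i, (s i).Leads t (Φ y) y) (hx : x ∈ U) :
    PullsBackAt J J Φ (mextDerivBilin J θ) (mextDerivBilin J θ) x := by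
  have hΦ_at : ∀ y ∈ U, ContMDiffAt J J 2 Φ y := fun y hy => hΦ.contMDiffAt (hU.mem_nhds hy)
  have hfreq := frequently_exists_eventuallyEq hU (O := fun i => U ∩ Φ ⁻¹' (s i).dom)
    (fun i => hΦ.continuousOn.isOpen_inter_preimage hU (s i).isOpen_dom)
    (f := fun i => (s i).map ∘ Φ) (g := fun _ => id)
    (fun i y hy => (((s i).pullsBackAt _ hy.2).continuousAt.comp
      (hΦ_at y hy.1).continuousAt).continuousWithinAt)
    (fun _ => continuousOn_id)
    (fun y hy => (hs y hy).imp fun i hi => ⟨⟨hy, hi.mem⟩, hi.map_eq⟩) hx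
  refine PullsBackAt.of_frequently hθ (hΦ_at x hx) (hfreq.mono ?_)
  rintro y ⟨i, hy, hi⟩
  exact ((s i).pullsBackAt _ hy.2).of_comp_eventuallyEq_id
    ((hΦ_at y hy.1).mdifferentiableAt (by simp)) hi

end Preservation

section HybridFlow

open Set

variable {F : Type*} [NormedAddCommGroup F] [NormedSpace ℝ F] {K : Type*} [TopologicalSpace K]
  {J : ModelWithCorners ℝ F K} {N : Type*} [TopologicalSpace N] [ChartedSpace K N]
  {θ : (z : N) → TangentSpace J z →L[ℝ] ℝ}

theorem compLinearMap_eq_iff_apply_pair {V V' : Type*} [AddCommGroup V] [Module ℝ V]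
    [AddCommGroup V'] [Module ℝ V'] {a : V' [⋀^Fin 2]→ₗ[ℝ] ℝ} {b : V [⋀^Fin 2]→ₗ[ℝ] ℝ}
    {L : V →ₗ[ℝ] V'} : a.compLinearMap L = b ↔ ∀ v w, a ![L v, L w] = b ![v, w] := by
  refine ⟨?_, fun h => AlternatingMap.ext fun v => ?_⟩
  · rintro rfl v w
    rw [AlternatingMap.compLinearMap_apply, ← FinVec.etaExpand_eq fun i => L (![v, w] i)]
    rfl
  · rw [AlternatingMap.compLinearMap_apply, ← FinVec.etaExpand_eq fun i => L (v i),
      ← FinVec.etaExpand_eq v]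
    exact h (v 0) (v 1)

theorem exists_countable_subfamily_cover {Y ι : Type*} [TopologicalSpace Y]
    [SecondCountableTopology Y] {S : Set Y} {O : ι → Set Y} (hO : ∀ i, IsOpen (O i))
    (hS : ∀ y ∈ S, ∃ i, y ∈ O i) : ∃ T : Set ι, T.Countable ∧ ∀ y ∈ S, ∃ i : T, y ∈ O i := by
  obtain ⟨T, hT, hTO⟩ := TopologicalSpace.isOpen_iUnion_countable O hO
  refine ⟨T, hT, fun y hy => ?_⟩
  obtain ⟨i, hi, hyi⟩ := mem_iUnion₂.1 (hTO ▸ mem_iUnion.2 (hS y hy))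
  exact ⟨⟨i, hi⟩, hyi⟩

variable [J.Boundaryless] [IsManifold J 2 N] [FiniteDimensional ℝ F] [T2Space N]
  [SecondCountableTopology N] {Y : HybridSystem J N} {W : Set N} {g : N → ℝ}

theorem HybridSystem.IsFlowMapOn.pullsBackAt (hX : IsCharacteristic J θ Y.field)
    (hA : IsActionReset J θ Y.field W g Y.reset) (hG : Y.guard = crossingSet J Y.field W g) {t : ℝ}
    {Φ : N → N} {U : Set N} (hU : IsOpen U) (hflow : Y.IsFlowMapOn t Φ U)
    (hΦ : ContMDiffOn J J 2 Φ U) {x : N} (hx : x ∈ U) :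
    PullsBackAt J J Φ (mextDerivBilin J θ) (mextDerivBilin J θ) x := by
  have : CompleteSpace F := FiniteDimensional.complete ℝ F
  have : LocallyCompactSpace N := Manifold.locallyCompact_of_finiteDimensional J
  have hhit : ∀ z ∈ Y.guard, ∃ k : HitBox J θ Y.field Y.guard Y.reset, z ∈ k.dom :=
    hG ▸ fun z hz => hA.exists_hitBox hX hz
  obtain ⟨β, hβ, hβ_cover⟩ := exists_countable_subfamily_cover (S := univ)
    (fun b : FlowBox J θ Y.field => b.isOpen_dom) (fun z _ => hX.exists_flowBox z)
  obtain ⟨κ, hκ, hκ_cover⟩ := exists_countable_subfamily_cover (S := Y.guard)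
    (fun k : HitBox J θ Y.field Y.guard Y.reset => k.isOpen_dom) hhit
  have := hβ.to_subtype
  have := hκ.to_subtype
  have hleads : ∀ {t y w}, Y.Reaches t y w → ∃ i : List ((β × ℚ) ⊕ κ) × β,
      ((FlowStep.word (letterStep (fun b : β => b.1) (fun k : κ => k.1)) i.1).thenFlow i.2.1
        t).Leads t y w := fun h =>
    let ⟨l, i, hl⟩ := h.exists_leads (fun z => hβ_cover z (mem_univ z)) hκ_cover
    ⟨(l, i), hl⟩
  rcases le_or_gt 0 t with ht | ht
  · exact pullsBackAt_of_exists_leads hX.smooth_form hU hΦ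
      (fun y hy => hleads ((hflow y hy).1 ht)) hx
  · exact pullsBackAt_of_exists_leads_symm hX.smooth_form hU hΦ
      (fun y hy => hleads ((hflow y hy).2 ht)) hx

theorem HybridSystem.preserves_neg_mextDerivOne (hX : IsCharacteristic J θ Y.field)
    (hA : IsActionReset J θ Y.field W g Y.reset) (hG : Y.guard = crossingSet J Y.field W g) :
    Y.Preserves fun z => (-mextDerivOne J θ z).toAlternatingMap :=
  fun _ _ _ hU _ hflow hΦ _ hx _ => compLinearMap_eq_iff_apply_pair.2 fun v w => congrArg (- ·)
    ((hflow.pullsBackAt hX hA hG hU (hΦ.of_le (by norm_cast)) hx).apply_mfderiv v w)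

end HybridFlow

/-! ### Hamiltonian vector fields on a symplectic vector space -/

section LinearSymplectic

variable {F : Type*} [NormedAddCommGroup F] [NormedSpace ℝ F] (τ : F →L[ℝ] F →L[ℝ] ℝ)

/-- The constant two-form `-dτ`, for a one-form `τ` that depends linearly on its base point. It is
symplectic when `v ↦ negCurlForm τ v` is injective. -/
def negCurlForm : F →L[ℝ] F →L[ℝ] ℝ := τ.flip - τ

/-- The action form `τ - H dt` on `ℝ × F`. -/
def linearActionForm (H : ℝ × F → ℝ) (e : ℝ × F) : ℝ × F →L[ℝ] ℝ :=
  τ e.2 ∘L ContinuousLinearMap.snd ℝ ℝ F - H e • ContinuousLinearMap.fst ℝ ℝ F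

theorem negCurlForm_self (v : F) : negCurlForm τ v v = 0 := sub_self _

theorem curl_continuousLinearMap (e v w : F) : curl τ e v w = -negCurlForm τ v w := by
  rw [curl, τ.fderiv]
  exact (neg_sub _ _).symm

theorem isSmoothCovectorField_of_covectorInChart_eqOn {K N : Type*} [TopologicalSpace K]
    {J : ModelWithCorners ℝ F K} [TopologicalSpace N] [ChartedSpace K N]
    {θ : (z : N) → TangentSpace J z →L[ℝ] ℝ}
    (hθ : ∀ z₀, Set.EqOn (covectorInChart J θ z₀) τ (extChartAt J z₀).target) :
    IsSmoothCovectorField J θ := fun z₀ =>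
  τ.contDiff.contDiffOn.congr (hθ z₀)

variable {τ} {H : ℝ × F → ℝ} {e : ℝ × F} {s : Set (ℝ × F)} {k m : ℕ∞ω}

theorem negCurlForm_injective (hτ : ∀ v, (∀ w, negCurlForm τ v w = 0) → v = 0) :
    Function.Injective (negCurlForm τ) :=
  (injective_iff_map_eq_zero _).2 fun v hv => hτ v fun w =>
    congrArg (fun L : F →L[ℝ] ℝ => L w) hv

theorem contDiffOn_linearActionForm (hH : ContDiffOn ℝ m H s) :
    ContDiffOn ℝ m (linearActionForm τ H) s :=
  ((τ.contDiff.comp contDiff_snd).contDiffOn.clm_comp contDiffOn_const).sub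
    (hH.smul contDiffOn_const)

theorem curl_linearActionForm (hH : DifferentiableAt ℝ H e) (v w : ℝ × F) :
    curl (linearActionForm τ H) e v w =
      -negCurlForm τ v.2 w.2 - fderiv ℝ H e v * w.1 + fderiv ℝ H e w * v.1 := by
  have hτ : HasFDerivAt (fun e : ℝ × F => τ e.2 ∘L ContinuousLinearMap.snd ℝ ℝ F) _ e :=
    (((ContinuousLinearMap.compL ℝ (ℝ × F) F ℝ).flip (ContinuousLinearMap.snd ℝ ℝ F)) ∘L τ ∘L
      ContinuousLinearMap.snd ℝ ℝ F).hasFDerivAt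
  have hform : HasFDerivAt (linearActionForm τ H) _ e :=
    hτ.sub (hH.hasFDerivAt.smul_const (ContinuousLinearMap.fst ℝ ℝ F))
  rw [curl, hform.fderiv]
  simp only [negCurlForm, sub_apply, ContinuousLinearMap.comp_apply,
    ContinuousLinearMap.smulRight_apply, ContinuousLinearMap.flip_apply,
    ContinuousLinearMap.compL_apply, ContinuousLinearMap.coe_snd', ContinuousLinearMap.coe_fst',
    smul_apply, smul_eq_mul]
  ring

variable [FiniteDimensional ℝ F] (hτ : Function.Injective (negCurlForm τ))

variable (F) in
theorem finrank_continuousDual : Module.finrank ℝ (F →L[ℝ] ℝ) = Module.finrank ℝ F :=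
  (LinearMap.toContinuousLinearMap (𝕜 := ℝ) (E := F) (F' := ℝ)).symm.finrank_eq.trans
    Subspace.dual_finrank_eq

/-- The isomorphism from covectors to vectors given by the symplectic form `negCurlForm τ`: the
inverse of `v ↦ negCurlForm τ v`. -/
def symplecticSharp : (F →L[ℝ] ℝ) ≃L[ℝ] F :=
  (LinearMap.linearEquivOfInjective (negCurlForm τ).toLinearMap hτ
    (finrank_continuousDual F).symm).toContinuousLinearEquiv.symm

theorem negCurlForm_symplecticSharp (L : F →L[ℝ] ℝ) :
    negCurlForm τ (symplecticSharp hτ L) = L :=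
  (symplecticSharp hτ).symm_apply_apply L

/-- The suspended Hamiltonian vector field `∂/∂t + X_{H_t}` on `ℝ × F`. -/
def suspendedField (H : ℝ × F → ℝ) (e : ℝ × F) : ℝ × F :=
  (1, symplecticSharp hτ (fderiv ℝ H e ∘L ContinuousLinearMap.inr ℝ ℝ F))

theorem contDiffOn_suspendedField (hs : IsOpen s) (hH : ContDiffOn ℝ m H s) (hk : k + 1 ≤ m) :
    ContDiffOn ℝ k (suspendedField hτ H) s :=
  contDiffOn_const.prodMk ((symplecticSharp hτ).contDiff.comp_contDiffOn
    ((hH.fderiv_of_isOpen hs hk).clm_comp contDiffOn_const))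

theorem curl_linearActionForm_suspendedField (hH : DifferentiableAt ℝ H e) (w : ℝ × F) :
    curl (linearActionForm τ H) e (suspendedField hτ H e) w = 0 := by
  set L := fderiv ℝ H e
  set X := symplecticSharp hτ (L ∘L ContinuousLinearMap.inr ℝ ℝ F)
  have hX (u : F) : negCurlForm τ X u = L (0, u) :=
    congrArg (fun L : F →L[ℝ] ℝ => L u) (negCurlForm_symplecticSharp hτ _)
  have hL (s : ℝ) (u : F) : L (s, u) = s * L (1, 0) + L (0, u) := by
    rw [← smul_eq_mul, ← map_smul, ← map_add]
    simp
  have hLX : L (0, X) = 0 := (hX X).symm.trans (negCurlForm_self τ X)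
  have hfield : suspendedField hτ H e = (1, X) := rfl
  rw [curl_linearActionForm hH, hfield, hX, hL 1 X, hLX]
  change -L (0, w.2) - (1 * L (1, 0) + 0) * w.1 + L (w.1, w.2) * 1 = 0
  rw [hL w.1 w.2]
  ring

end LinearSymplectic

section ModelPhaseSpace

variable (A : Type*) [NormedAddCommGroup A] [NormedSpace ℝ A]

/-- The model vector space `{(x, p)}` of a cotangent bundle. -/
abbrev PhaseSpace := A × (A →L[ℝ] ℝ)

theorem finrank_phaseSpace [FiniteDimensional ℝ A] :
    Module.finrank ℝ (PhaseSpace A) = 2 * Module.finrank ℝ A := by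
  rw [Module.finrank_prod, finrank_continuousDual, two_mul]

/-- The tautological one-form `p dx` on `A × A*`, as a function of its base point. -/
def phaseTautologicalForm : PhaseSpace A →L[ℝ] PhaseSpace A →L[ℝ] ℝ :=
  ((ContinuousLinearMap.compL ℝ (PhaseSpace A) A ℝ).flip
    (ContinuousLinearMap.fst ℝ A (A →L[ℝ] ℝ))) ∘L ContinuousLinearMap.snd ℝ A (A →L[ℝ] ℝ)

variable {A}

theorem phaseTautologicalForm_apply (e v : PhaseSpace A) :
    phaseTautologicalForm A e v = e.2 v.1 := rfl

theorem negCurlForm_phaseTautologicalForm_apply (v w : PhaseSpace A) :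
    negCurlForm (phaseTautologicalForm A) v w = w.2 v.1 - v.2 w.1 := rfl

variable (A) in
theorem negCurlForm_phaseTautologicalForm_injective :
    Function.Injective (negCurlForm (phaseTautologicalForm A)) := by
  refine negCurlForm_injective fun v hv => Prod.ext
    (SeparatingDual.eq_zero_of_forall_dual_eq_zero (R := ℝ) fun p => ?_)
    (ContinuousLinearMap.ext fun a => ?_)
  · simpa [negCurlForm_phaseTautologicalForm_apply] using hv (0, p)
  · simpa [negCurlForm_phaseTautologicalForm_apply] using hv (a, 0)

theorem fderiv_slice {f : ℝ × A → ℝ} {e : ℝ × A} (hf : DifferentiableAt ℝ f e) :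
    fderiv ℝ (fun a => f (e.1, a)) e.2 = fderiv ℝ f e ∘L ContinuousLinearMap.inr ℝ ℝ A :=
  (HasFDerivAt.comp e.2 (g := f) (f := fun a => (e.1, a)) hf.hasFDerivAt
    (hasFDerivAt_prodMk_right e.1 e.2)).fderiv

end ModelPhaseSpace

/-! ### The cotangent bundle in charts -/

section BundleTopology

open Set

variable {B : Type*} (F : Type*) (E : B → Type*) [TopologicalSpace F] [TopologicalSpace B]
  [TopologicalSpace (Bundle.TotalSpace F E)] [∀ x, TopologicalSpace (E x)] [FiberBundle F E]

theorem t2Space_totalSpace [T2Space B] [T2Space F] : T2Space (Bundle.TotalSpace F E) := by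
  refine ⟨fun z z' hne => ?_⟩
  by_cases hp : z.proj = z'.proj
  · set e := trivializationAt F E z.proj
    have hz : z ∈ e.source := e.mem_source.2 (FiberBundle.mem_baseSet_trivializationAt' _)
    have hz' : z' ∈ e.source := e.mem_source.2 (hp ▸ FiberBundle.mem_baseSet_trivializationAt' _)
    obtain ⟨u, v, hu, hv, hzu, hzv, huv⟩ := t2_separation (fun h => hne (e.injOn hz hz' h))
    refine ⟨e.source ∩ e ⁻¹' u, e.source ∩ e ⁻¹' v,
      e.continuousOn.isOpen_inter_preimage e.open_source hu,
      e.continuousOn.isOpen_inter_preimage e.open_source hv, ⟨hz, hzu⟩, ⟨hz', hzv⟩, ?_⟩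
    exact (huv.preimage e).mono inter_subset_right inter_subset_right
  · obtain ⟨u, v, hu, hv, hzu, hzv, huv⟩ := t2_separation hp
    have hproj := FiberBundle.continuous_proj F E
    exact ⟨_, _, hu.preimage hproj, hv.preimage hproj, hzu, hzv, huv.preimage _⟩

theorem secondCountableTopology_totalSpace [SecondCountableTopology B]
    [SecondCountableTopology F] [∀ x, Inhabited (E x)] :
    SecondCountableTopology (Bundle.TotalSpace F E) := by
  obtain ⟨T, hT, hTB⟩ := exists_countable_subfamily_cover (S := univ)
    (fun x : B => (trivializationAt F E x).open_baseSet)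
    fun x _ => ⟨x, FiberBundle.mem_baseSet_trivializationAt' x⟩
  refine ChartedSpace.secondCountable_of_countable_cover (B × F)
    (s := (fun x : B => (⟨x, default⟩ : Bundle.TotalSpace F E)) '' T)
    (eq_univ_of_forall fun z => ?_) (hT.image _)
  obtain ⟨x, hz⟩ := hTB z.proj (mem_univ _)
  exact mem_iUnion₂.2 ⟨_, ⟨x, x.2, rfl⟩, (trivializationAt F E x.1).mem_source.2 hz⟩

end BundleTopology

section CotangentCharts

open Set

variable {n : ℕ} {M : Type*} [TopologicalSpace M] [ChartedSpace (EuclideanSpace ℝ (Fin n)) M]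
  [IsManifold (𝓡 n) ∞ M]

instance : IsManifold (cotModel n) ∞ (Cotangent n M) :=
  Bundle.TotalSpace.isManifold (n := ∞) (IB := 𝓡 n) _ _

instance [T2Space M] : T2Space (Cotangent n M) := t2Space_totalSpace _ _

instance [SecondCountableTopology M] : SecondCountableTopology (Cotangent n M) :=
  have (x : M) : Inhabited (TangentSpace (𝓡 n) x →L[ℝ] Bundle.Trivial M ℝ x) := ⟨0⟩
  secondCountableTopology_totalSpace _ _

theorem mem_cotangent_chart_source {z₀ z : Cotangent n M} :
    z ∈ (extChartAt (cotModel n) z₀).source ↔ z.proj ∈ (extChartAt (𝓡 n) z₀.proj).source := by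
  rw [FiberBundle.extChartAt]
  simp only [mfld_simps]
  exact ⟨fun h => h.1.1, fun h => ⟨⟨h, mem_univ _⟩, h⟩⟩

theorem cotangent_chart_fst (z₀ z : Cotangent n M) :
    (extChartAt (cotModel n) z₀ z).1 = extChartAt (𝓡 n) z₀.proj z.proj := by
  rw [FiberBundle.extChartAt]
  rfl

theorem cotangent_chart_snd {z₀ z : Cotangent n M} (hz : z ∈ (extChartAt (cotModel n) z₀).source)
    (v : EuclideanSpace ℝ (Fin n)) :
    (extChartAt (cotModel n) z₀ z).2 v =
      covector z ((chartSymmDeriv (𝓡 n) z₀.proj (extChartAt (𝓡 n) z₀.proj z.proj) v :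
        EuclideanSpace ℝ (Fin n))) := by
  have hz' := mem_cotangent_chart_source.1 hz
  rw [extChartAt_source] at hz'
  have hsymmL := TangentBundle.symmL_trivializationAt (I := 𝓡 n) hz'
  rw [(𝓡 n).range_eq_univ, mfderivWithin_univ] at hsymmL
  have htrivialization : ((trivializationAt (EuclideanSpace ℝ (Fin n) →L[ℝ] ℝ)
      (fun x : M => TangentSpace (𝓡 n) x →L[ℝ] Bundle.Trivial M ℝ x) z₀.proj) z).2 v =
      z.2 ((trivializationAt (EuclideanSpace ℝ (Fin n)) (TangentSpace (𝓡 n)) z₀.proj).symmL ℝ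
        z.proj v) := by
    rw [hom_trivializationAt_apply]
    simp only [ContinuousLinearMap.inCoordinates]
    simp
  rw [FiberBundle.extChartAt]
  exact htrivialization.trans (congrArg
    (fun L : EuclideanSpace ℝ (Fin n) →L[ℝ] EuclideanSpace ℝ (Fin n) => covector z (L v)) hsymmL)

variable (M) in
theorem contMDiff_cotProj : ContMDiff (cotModel n) (𝓡 n) ∞ (cotProj : Cotangent n M → M) :=
  Bundle.contMDiff_proj _

theorem mdifferentiableAt_cotProj (z : Cotangent n M) :
    MDifferentiableAt (cotModel n) (𝓡 n) cotProj z :=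
  (contMDiff_cotProj M z).mdifferentiableAt (by simp)

theorem chartDeriv_cotangent_fst {z₀ z : Cotangent n M}
    (hz : z ∈ (extChartAt (cotModel n) z₀).source) (v : TangentSpace (cotModel n) z) :
    (chartDeriv (cotModel n) z₀ z v).1 =
      chartDeriv (𝓡 n) z₀.proj z.proj (mfderiv (cotModel n) (𝓡 n) cotProj z v) := by
  have : IsManifold (𝓡 n) 1 M := IsManifold.of_le (n := ∞) (by simp)
  have hfst : HasMFDerivAt (cotModel n) 𝓘(ℝ, EuclideanSpace ℝ (Fin n))
      (fun z => (extChartAt (cotModel n) z₀ z).1) z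
      (ContinuousLinearMap.fst ℝ (EuclideanSpace ℝ (Fin n)) (EuclideanSpace ℝ (Fin n) →L[ℝ] ℝ) ∘L
        chartDeriv (cotModel n) z₀ z) :=
    (ContinuousLinearMap.fst ℝ (EuclideanSpace ℝ (Fin n))
      (EuclideanSpace ℝ (Fin n) →L[ℝ] ℝ)).hasFDerivAt.hasMFDerivAt.comp z (hasMFDerivAt_chart hz)
  have hproj : HasMFDerivAt (cotModel n) 𝓘(ℝ, EuclideanSpace ℝ (Fin n))
      (fun z : Cotangent n M => extChartAt (𝓡 n) z₀.proj (cotProj z)) z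
      (chartDeriv (𝓡 n) z₀.proj z.proj ∘L mfderiv (cotModel n) (𝓡 n) cotProj z) :=
    (hasMFDerivAt_chart (mem_cotangent_chart_source.1 hz)).comp z
      (mdifferentiableAt_cotProj z).hasMFDerivAt
  have heq : (fun z => (extChartAt (cotModel n) z₀ z).1) =
      fun z : Cotangent n M => extChartAt (𝓡 n) z₀.proj (cotProj z) :=
    funext fun z => cotangent_chart_fst z₀ z
  rw [heq] at hfst
  exact congrArg (fun L : PhaseSpace (EuclideanSpace ℝ (Fin n)) →L[ℝ] EuclideanSpace ℝ (Fin n) =>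
    L v) (hasMFDerivAt_unique hfst hproj)

theorem tautologicalForm_apply {z₀ z : Cotangent n M}
    (hz : z ∈ (extChartAt (cotModel n) z₀).source) (v : TangentSpace (cotModel n) z) :
    tautologicalForm z v = (extChartAt (cotModel n) z₀ z).2 (chartDeriv (cotModel n) z₀ z v).1 := by
  have : IsManifold (𝓡 n) 1 M := IsManifold.of_le (n := ∞) (by simp)
  rw [chartDeriv_cotangent_fst hz, cotangent_chart_snd hz]
  have hid := mfderivWithin_extChartAt_symm_comp_mfderiv_extChartAt' (I := 𝓡 n)
    (mem_cotangent_chart_source.1 hz)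
  rw [(𝓡 n).range_eq_univ, mfderivWithin_univ] at hid
  exact congrArg (fun L : EuclideanSpace ℝ (Fin n) →L[ℝ] EuclideanSpace ℝ (Fin n) =>
    covector z (L (mfderiv (cotModel n) (𝓡 n) cotProj z v))) hid.symm

theorem covectorInChart_tautologicalForm_eqOn (z₀ : Cotangent n M) :
    EqOn (covectorInChart (cotModel n) tautologicalForm z₀)
      (phaseTautologicalForm (EuclideanSpace ℝ (Fin n))) (extChartAt (cotModel n) z₀).target := by
  refine fun e he => ContinuousLinearMap.ext fun v => ?_
  rw [covectorInChart, ContinuousLinearMap.comp_apply,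
    tautologicalForm_apply ((extChartAt (cotModel n) z₀).map_target he),
    chartDeriv_chartSymmDeriv he, (extChartAt (cotModel n) z₀).right_inv he,
    phaseTautologicalForm_apply]

variable (M) in
theorem isSmoothCovectorField_tautologicalForm :
    IsSmoothCovectorField (cotModel n) (tautologicalForm (n := n) (M := M)) :=
  isSmoothCovectorField_of_covectorInChart_eqOn _ covectorInChart_tautologicalForm_eqOn

theorem symplecticForm_apply {z₀ z : Cotangent n M}
    (hz : z ∈ (extChartAt (cotModel n) z₀).source) (v w : TangentSpace (cotModel n) z) :
    symplecticForm z ![v, w] = negCurlForm (phaseTautologicalForm (EuclideanSpace ℝ (Fin n)))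
      (chartDeriv (cotModel n) z₀ z v) (chartDeriv (cotModel n) z₀ z w) := by
  have heq := (covectorInChart_tautologicalForm_eqOn z₀).eventuallyEq_of_mem
    ((isOpen_extChartAt_target z₀).mem_nhds ((extChartAt (cotModel n) z₀).map_source hz))
  have hbilin := mextDerivBilin_eq_chartForm (isSmoothCovectorField_tautologicalForm M) hz v w
  unfold chartForm at hbilin
  rw [curl_congr_of_eventuallyEq heq, curl_continuousLinearMap] at hbilin
  exact (congrArg (- ·) hbilin).trans (neg_neg _)

end CotangentCharts

section ChartDifferential

variable {F : Type*} [NormedAddCommGroup F] [NormedSpace ℝ F] {K : Type*} [TopologicalSpace K]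
  {J : ModelWithCorners ℝ F K} {N : Type*} [TopologicalSpace N] [ChartedSpace K N]
  [J.Boundaryless] [IsManifold J 1 N] {f : N → ℝ} {z₀ z : N}

theorem differentiableAt_comp_chart_symm (hf : MDifferentiableAt J 𝓘(ℝ, ℝ) f z)
    (hz : z ∈ (extChartAt J z₀).source) :
    DifferentiableAt ℝ (fun e => f ((extChartAt J z₀).symm e)) (extChartAt J z₀ z) := by
  have hf' : MDifferentiableAt J 𝓘(ℝ, ℝ) f ((extChartAt J z₀).symm (extChartAt J z₀ z)) := by
    rwa [(extChartAt J z₀).left_inv hz]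
  exact (hf'.comp _ (hasMFDerivAt_chart_symm
    ((extChartAt J z₀).map_source hz)).mdifferentiableAt).differentiableAt

theorem mvfderiv_eq_fderiv_comp_chart_symm (hf : MDifferentiableAt J 𝓘(ℝ, ℝ) f z)
    (hz : z ∈ (extChartAt J z₀).source) (w : TangentSpace J z) :
    mvfderiv J f z w = fderiv ℝ (fun e => f ((extChartAt J z₀).symm e)) (extChartAt J z₀ z)
      (chartDeriv J z₀ z w) := by
  have hcomp := (differentiableAt_comp_chart_symm hf hz).hasFDerivAt.hasMFDerivAt.comp z
    (hasMFDerivAt_chart hz)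
  have hderiv : HasMFDerivAt J 𝓘(ℝ, ℝ) f z
      (fderiv ℝ (fun e => f ((extChartAt J z₀).symm e)) (extChartAt J z₀ z) ∘L
        chartDeriv J z₀ z) := by
    refine hcomp.congr_of_eventuallyEq ?_
    filter_upwards [(isOpen_extChartAt_source z₀).mem_nhds hz] with y hy
    simp only [Function.comp_apply, (extChartAt J z₀).left_inv hy]
  exact congrArg (fun L : F →L[ℝ] ℝ => L w) hderiv.mfderiv

end ChartDifferential

/-! ### The extended phase space -/

section ExtendedCharts

variable {n : ℕ} {M : Type*} [TopologicalSpace M] [ChartedSpace (EuclideanSpace ℝ (Fin n)) M]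
  [IsManifold (𝓡 n) ∞ M] {q₀ q : ℝ × Cotangent n M}

theorem ext_chart_apply (q₀ q : ℝ × Cotangent n M) :
    extChartAt (extModel n) q₀ q = (q.1, extChartAt (cotModel n) q₀.2 q.2) := by
  rw [extChartAt_prod]
  rfl

theorem ext_chart_symm_apply (q₀ : ℝ × Cotangent n M)
    (e : ℝ × PhaseSpace (EuclideanSpace ℝ (Fin n))) :
    (extChartAt (extModel n) q₀).symm e = (e.1, (extChartAt (cotModel n) q₀.2).symm e.2) := by
  rw [extChartAt_prod]
  rfl

theorem mem_ext_chart_source :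
    q ∈ (extChartAt (extModel n) q₀).source ↔ q.2 ∈ (extChartAt (cotModel n) q₀.2).source := by
  rw [extChartAt_prod]
  exact ⟨fun h => h.2, fun h => ⟨by simp [chartAt_self_eq], h⟩⟩

/-- The component along `T^*M` of a tangent vector of `ℝ × T^*M`. -/
def spacePart (v : TangentSpace (extModel n) q) : TangentSpace (cotModel n) q.2 :=
  mfderiv (extModel n) (cotModel n) Prod.snd q v

theorem dtForm_mk (s : ℝ) (v : TangentSpace (cotModel n) q.2) :
    dtForm q ((s, v) : ℝ × PhaseSpace (EuclideanSpace ℝ (Fin n))) = s :=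
  congrArg (fun L : ℝ × PhaseSpace (EuclideanSpace ℝ (Fin n)) →L[ℝ] ℝ => L (s, v))
    (mfderiv_fst (I := 𝓘(ℝ, ℝ)) (I' := cotModel n) (x := q))

theorem spacePart_mk (s : ℝ) (v : TangentSpace (cotModel n) q.2) :
    spacePart (q := q) ((s, v) : ℝ × PhaseSpace (EuclideanSpace ℝ (Fin n))) = v :=
  congrArg (fun L : ℝ × PhaseSpace (EuclideanSpace ℝ (Fin n)) →L[ℝ]
    PhaseSpace (EuclideanSpace ℝ (Fin n)) => L (s, v))
    (mfderiv_snd (I := 𝓘(ℝ, ℝ)) (I' := cotModel n) (x := q))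

theorem ext_chartDeriv (hq : q ∈ (extChartAt (extModel n) q₀).source)
    (v : TangentSpace (extModel n) q) :
    chartDeriv (extModel n) q₀ q v =
      (dtForm q v, chartDeriv (cotModel n) q₀.2 q.2 (spacePart v)) := by
  have hchart : HasMFDerivAt (extModel n) 𝓘(ℝ, ℝ × PhaseSpace (EuclideanSpace ℝ (Fin n)))
      (extChartAt (extModel n) q₀) q (chartDeriv (extModel n) q₀ q) := hasMFDerivAt_chart hq
  have hspace : HasMFDerivAt (extModel n) 𝓘(ℝ, PhaseSpace (EuclideanSpace ℝ (Fin n)))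
      (fun q : ℝ × Cotangent n M => extChartAt (cotModel n) q₀.2 q.2) q
      (chartDeriv (cotModel n) q₀.2 q.2 ∘L mfderiv (extModel n) (cotModel n) Prod.snd q) :=
    (hasMFDerivAt_chart (mem_ext_chart_source.1 hq)).comp q mdifferentiableAt_snd.hasMFDerivAt
  have htime : HasMFDerivAt (extModel n) 𝓘(ℝ, ℝ) (Prod.fst : ℝ × Cotangent n M → ℝ) q
      (mfderiv (extModel n) 𝓘(ℝ, ℝ) Prod.fst q) := mdifferentiableAt_fst.hasMFDerivAt
  rw [show (extChartAt (extModel n) q₀ : ℝ × Cotangent n M → _) =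
    fun q => (q.1, extChartAt (cotModel n) q₀.2 q.2) from funext (ext_chart_apply q₀)] at hchart
  exact congrArg (fun L : ℝ × PhaseSpace (EuclideanSpace ℝ (Fin n)) →L[ℝ]
    ℝ × PhaseSpace (EuclideanSpace ℝ (Fin n)) => L v)
    (hasMFDerivAt_unique hchart ⟨htime.1.prodMk hspace.1, htime.2.prodMk hspace.2⟩)

end ExtendedCharts

section ActionForm

open Set

variable {n : ℕ} {M : Type*} [TopologicalSpace M] [ChartedSpace (EuclideanSpace ℝ (Fin n)) M]
  [IsManifold (𝓡 n) ∞ M] {H : ℝ × Cotangent n M → ℝ} {q₀ q : ℝ × Cotangent n M}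

theorem actionForm_apply (H : ℝ × Cotangent n M → ℝ)
    (hq : q ∈ (extChartAt (extModel n) q₀).source) (v : TangentSpace (extModel n) q) :
    actionForm H q v = (extChartAt (extModel n) q₀ q).2.2 (chartDeriv (extModel n) q₀ q v).2.1 -
      H q * (chartDeriv (extModel n) q₀ q v).1 := by
  rw [ext_chartDeriv hq, ext_chart_apply,
    ← tautologicalForm_apply (mem_ext_chart_source.1 hq) (spacePart v)]
  rfl

/-- The expression of a function on `ℝ × T^*M` in the preferred chart at `q₀`. -/
def hamiltonianInChart (H : ℝ × Cotangent n M → ℝ) (q₀ : ℝ × Cotangent n M)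
    (e : ℝ × PhaseSpace (EuclideanSpace ℝ (Fin n))) : ℝ :=
  H ((extChartAt (extModel n) q₀).symm e)

theorem contDiffOn_hamiltonianInChart (hH : ContMDiff (extModel n) 𝓘(ℝ, ℝ) ∞ H)
    (q₀ : ℝ × Cotangent n M) :
    ContDiffOn ℝ ∞ (hamiltonianInChart H q₀) (extChartAt (extModel n) q₀).target := by
  rw [← contMDiffOn_iff_contDiffOn]
  exact hH.comp_contMDiffOn (contMDiffOn_extChartAt_symm q₀)

theorem differentiableAt_hamiltonianInChart (hH : ContMDiff (extModel n) 𝓘(ℝ, ℝ) ∞ H)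
    {e : ℝ × PhaseSpace (EuclideanSpace ℝ (Fin n))}
    (he : e ∈ (extChartAt (extModel n) q₀).target) :
    DifferentiableAt ℝ (hamiltonianInChart H q₀) e :=
  ((contDiffOn_hamiltonianInChart hH q₀).contDiffAt
    ((isOpen_extChartAt_target q₀).mem_nhds he)).differentiableAt (by simp)

theorem covectorInChart_actionForm_eqOn (H : ℝ × Cotangent n M → ℝ) (q₀ : ℝ × Cotangent n M) :
    EqOn (covectorInChart (extModel n) (actionForm H) q₀)
      (linearActionForm (phaseTautologicalForm (EuclideanSpace ℝ (Fin n)))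
        (hamiltonianInChart H q₀)) (extChartAt (extModel n) q₀).target := fun e he => by
  have happly (v) : covectorInChart (extModel n) (actionForm H) q₀ e v = linearActionForm
      (phaseTautologicalForm (EuclideanSpace ℝ (Fin n))) (hamiltonianInChart H q₀) e v := by
    rw [covectorInChart, ContinuousLinearMap.comp_apply,
      actionForm_apply H ((extChartAt (extModel n) q₀).map_target he),
      chartDeriv_chartSymmDeriv he, (extChartAt (extModel n) q₀).right_inv he]
    rfl
  exact ContinuousLinearMap.ext happly

theorem isSmoothCovectorField_actionForm (hH : ContMDiff (extModel n) 𝓘(ℝ, ℝ) ∞ H) :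
    IsSmoothCovectorField (extModel n) (actionForm H) := fun q₀ =>
  (contDiffOn_linearActionForm ((contDiffOn_hamiltonianInChart hH q₀).of_le (by norm_cast))).congr
    (covectorInChart_actionForm_eqOn H q₀)

theorem mextDerivBilin_actionForm (hH : ContMDiff (extModel n) 𝓘(ℝ, ℝ) ∞ H)
    (hq : q ∈ (extChartAt (extModel n) q₀).source) (v w : TangentSpace (extModel n) q) :
    mextDerivBilin (extModel n) (actionForm H) q v w =
      curl (linearActionForm (phaseTautologicalForm (EuclideanSpace ℝ (Fin n)))
          (hamiltonianInChart H q₀)) (extChartAt (extModel n) q₀ q)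
        (chartDeriv (extModel n) q₀ q v) (chartDeriv (extModel n) q₀ q w) := by
  have heq := (covectorInChart_actionForm_eqOn H q₀).eventuallyEq_of_mem
    ((isOpen_extChartAt_target q₀).mem_nhds ((extChartAt (extModel n) q₀).map_source hq))
  rw [mextDerivBilin_eq_chartForm (isSmoothCovectorField_actionForm hH) hq]
  unfold chartForm
  rw [curl_congr_of_eventuallyEq heq]

theorem actionTwoForm_apply (hH : ContMDiff (extModel n) 𝓘(ℝ, ℝ) ∞ H)
    (hq : q ∈ (extChartAt (extModel n) q₀).source) (v w : TangentSpace (extModel n) q) :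
    actionTwoForm H q ![v, w] =
      negCurlForm (phaseTautologicalForm (EuclideanSpace ℝ (Fin n)))
          (chartDeriv (extModel n) q₀ q v).2 (chartDeriv (extModel n) q₀ q w).2 +
        fderiv ℝ (hamiltonianInChart H q₀) (extChartAt (extModel n) q₀ q)
          (chartDeriv (extModel n) q₀ q v) * (chartDeriv (extModel n) q₀ q w).1 -
        fderiv ℝ (hamiltonianInChart H q₀) (extChartAt (extModel n) q₀ q)
          (chartDeriv (extModel n) q₀ q w) * (chartDeriv (extModel n) q₀ q v).1 := by
  have hbilin := mextDerivBilin_actionForm hH hq v w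
  rw [curl_linearActionForm (differentiableAt_hamiltonianInChart hH
    ((extChartAt (extModel n) q₀).map_source hq))] at hbilin
  refine (congrArg (- ·) hbilin).trans ?_
  ring

end ActionForm

section HamiltonianField

variable {n : ℕ} {M : Type*} [TopologicalSpace M] [ChartedSpace (EuclideanSpace ℝ (Fin n)) M]
  [IsManifold (𝓡 n) ∞ M]

theorem symplecticForm_hamiltonianField {H : Cotangent n M → ℝ} {z : Cotangent n M}
    (hH : MDifferentiableAt (cotModel n) 𝓘(ℝ, ℝ) H z) (w : TangentSpace (cotModel n) z) :
    symplecticForm z ![hamiltonianField H z, w] = mvfderiv (cotModel n) H z w := by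
  have hz := mem_extChartAt_source (I := cotModel n) z
  have hex : ∃ v, ∀ w, symplecticForm z ![v, w] = mvfderiv (cotModel n) H z w := by
    obtain ⟨v, hv⟩ := chartDeriv_surjective hz (symplecticSharp
      (negCurlForm_phaseTautologicalForm_injective (EuclideanSpace ℝ (Fin n)))
      (fderiv ℝ (fun e => H ((extChartAt (cotModel n) z).symm e)) (extChartAt (cotModel n) z z)))
    refine ⟨v, fun w => ?_⟩
    rw [symplecticForm_apply hz, mvfderiv_eq_fderiv_comp_chart_symm hH hz, hv,
      negCurlForm_symplecticSharp]
  exact Classical.epsilon_spec hex w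

theorem chartDeriv_hamiltonianField {H : Cotangent n M → ℝ} {z₀ z : Cotangent n M}
    (hH : MDifferentiableAt (cotModel n) 𝓘(ℝ, ℝ) H z)
    (hz : z ∈ (extChartAt (cotModel n) z₀).source) :
    chartDeriv (cotModel n) z₀ z (hamiltonianField H z) = symplecticSharp
      (negCurlForm_phaseTautologicalForm_injective (EuclideanSpace ℝ (Fin n)))
      (fderiv ℝ (fun e => H ((extChartAt (cotModel n) z₀).symm e))
        (extChartAt (cotModel n) z₀ z)) := by
  have hinj := negCurlForm_phaseTautologicalForm_injective (EuclideanSpace ℝ (Fin n))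
  refine hinj (ContinuousLinearMap.ext fun w => ?_)
  obtain ⟨w, rfl⟩ := chartDeriv_surjective hz w
  rw [negCurlForm_symplecticSharp, ← symplecticForm_apply hz,
    symplecticForm_hamiltonianField hH, mvfderiv_eq_fderiv_comp_chart_symm hH hz]

variable {H : ℝ × Cotangent n M → ℝ}

theorem mdifferentiableAt_slice (hH : ContMDiff (extModel n) 𝓘(ℝ, ℝ) ∞ H) (t : ℝ)
    (z : Cotangent n M) : MDifferentiableAt (cotModel n) 𝓘(ℝ, ℝ) (fun z => H (t, z)) z :=
  ((hH (t, z)).comp z (contMDiffAt_const.prodMk contMDiffAt_id)).mdifferentiableAt (by simp)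

theorem chartDeriv_extHamiltonianField (hH : ContMDiff (extModel n) 𝓘(ℝ, ℝ) ∞ H)
    {q₀ q : ℝ × Cotangent n M} (hq : q ∈ (extChartAt (extModel n) q₀).source) :
    chartDeriv (extModel n) q₀ q (extHamiltonianField H q) = suspendedField
      (negCurlForm_phaseTautologicalForm_injective (EuclideanSpace ℝ (Fin n)))
      (hamiltonianInChart H q₀) (extChartAt (extModel n) q₀ q) := by
  have hslice : (fun e => H (q.1, (extChartAt (cotModel n) q₀.2).symm e)) =
      fun e => hamiltonianInChart H q₀ (q.1, e) :=
    funext fun e => congrArg H (ext_chart_symm_apply q₀ (q.1, e)).symm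
  have hdiff := differentiableAt_hamiltonianInChart hH ((extChartAt (extModel n) q₀).map_source hq)
  rw [ext_chart_apply] at hdiff
  rw [ext_chartDeriv hq, extHamiltonianField, dtForm_mk, spacePart_mk,
    chartDeriv_hamiltonianField (mdifferentiableAt_slice hH _ _) (mem_ext_chart_source.1 hq),
    hslice, ext_chart_apply]
  exact congrArg (fun L => ((1 : ℝ), symplecticSharp _ L)) (fderiv_slice hdiff)

theorem isCharacteristic_actionForm (hH : ContMDiff (extModel n) 𝓘(ℝ, ℝ) ∞ H) :
    IsCharacteristic (extModel n) (actionForm H) (extHamiltonianField H) where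
  smooth_form := isSmoothCovectorField_actionForm hH
  smooth_field q₀ := by
    refine (contDiffOn_suspendedField
      (negCurlForm_phaseTautologicalForm_injective (EuclideanSpace ℝ (Fin n)))
      (isOpen_extChartAt_target q₀) (contDiffOn_hamiltonianInChart hH q₀) (k := 2)
      (by norm_cast)).congr
        (f₁ := fieldInChart (extModel n) (extHamiltonianField H) q₀) fun e he => ?_
    rw [fieldInChart,
      chartDeriv_extHamiltonianField hH ((extChartAt (extModel n) q₀).map_target he),
      (extChartAt (extModel n) q₀).right_inv he]
  ker q w := by
    have hq := mem_extChartAt_source (I := extModel n) q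
    rw [mextDerivBilin_actionForm hH hq, chartDeriv_extHamiltonianField hH hq]
    exact curl_linearActionForm_suspendedField _
      (differentiableAt_hamiltonianInChart hH (mem_extChartAt_target q)) _

end HamiltonianField

/-! ### Volume forms -/

section Volume

variable {n : ℕ}

theorem exists_isDarbouxFamily_negCurlForm {V : Type*} [AddCommGroup V] [Module ℝ V]
    {Ψ : V → PhaseSpace (EuclideanSpace ℝ (Fin n))} (hΨ : Function.Surjective Ψ)
    {W : V [⋀^Fin 2]→ₗ[ℝ] ℝ} (hW : ∀ v w, W ![v, w] =
      negCurlForm (phaseTautologicalForm (EuclideanSpace ℝ (Fin n))) (Ψ v) (Ψ w)) :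
    ∃ e f : Fin n → V, IsDarbouxFamily W e f := by
  choose e he using fun i : Fin n => hΨ (EuclideanSpace.single i 1, 0)
  choose f hf using fun i : Fin n => hΨ (0, EuclideanSpace.proj i)
  refine ⟨e, f, fun i j => ?_, fun i j => ?_, fun i j => ?_⟩ <;>
    rw [hW, negCurlForm_phaseTautologicalForm_apply]
  · simp [he]
  · simp [hf]
  · simp [he, hf, eq_comm]

variable {M : Type*} [TopologicalSpace M] [ChartedSpace (EuclideanSpace ℝ (Fin n)) M]
  [IsManifold (𝓡 n) ∞ M]

theorem exists_isDarbouxFamily_symplecticForm (z : Cotangent n M) :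
    ∃ e f : Fin n → TangentSpace (cotModel n) z,
      IsDarbouxFamily (symplecticForm z).toAlternatingMap e f :=
  exists_isDarbouxFamily_negCurlForm (chartDeriv_surjective (mem_extChartAt_source z))
    (symplecticForm_apply (mem_extChartAt_source z))

/-- The tangent vector of `ℝ × T^*M` with components `0` along `ℝ` and `v` along `T^*M`. -/
def spaceLift (q : ℝ × Cotangent n M) (v : TangentSpace (cotModel n) q.2) :
    TangentSpace (extModel n) q :=
  ((0 : ℝ), v)

theorem actionTwoForm_apply_spaceLift {H : ℝ × Cotangent n M → ℝ}
    (hH : ContMDiff (extModel n) 𝓘(ℝ, ℝ) ∞ H) {q : ℝ × Cotangent n M}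
    (v w : TangentSpace (cotModel n) q.2) :
    actionTwoForm H q ![spaceLift q v, spaceLift q w] = symplecticForm q.2 ![v, w] := by
  have hq := mem_extChartAt_source (I := extModel n) q
  have hlift (u : TangentSpace (cotModel n) q.2) : chartDeriv (extModel n) q q (spaceLift q u) =
      ((0 : ℝ), chartDeriv (cotModel n) q.2 q.2 u) := by
    rw [ext_chartDeriv hq, spaceLift, dtForm_mk, spacePart_mk]
  rw [actionTwoForm_apply hH hq, symplecticForm_apply (mem_extChartAt_source q.2), hlift, hlift]
  simp only [mul_zero, add_zero, sub_zero]

variable (n M) in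
theorem isVolumeForm_liouvilleForm :
    IsVolumeForm (cotModel n) (liouvilleForm (n := n) (M := M)) := by
  refine ⟨by rw [finrank_phaseSpace, finrank_euclideanSpace_fin], fun z => ?_⟩
  obtain ⟨e, f, hef⟩ := exists_isDarbouxFamily_symplecticForm z
  exact hef.wedgePow_ne_zero

theorem isVolumeForm_extLiouvilleForm {H : ℝ × Cotangent n M → ℝ}
    (hH : ContMDiff (extModel n) 𝓘(ℝ, ℝ) ∞ H) :
    IsVolumeForm (extModel n) (extLiouvilleForm H) := by
  refine ⟨by rw [Module.finrank_prod, Module.finrank_self, finrank_phaseSpace,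
    finrank_euclideanSpace_fin], fun q => ?_⟩
  obtain ⟨e, f, hef⟩ := exists_isDarbouxFamily_symplecticForm q.2
  have hlift : IsDarbouxFamily (actionTwoForm H q).toAlternatingMap (fun i => spaceLift q (e i))
      (fun i => spaceLift q (f i)) :=
    ⟨fun i j => (actionTwoForm_apply_spaceLift hH _ _).trans (hef.apply_left i j),
      fun i j => (actionTwoForm_apply_spaceLift hH _ _).trans (hef.apply_right i j),
      fun i j => (actionTwoForm_apply_spaceLift hH _ _).trans (hef.apply_left_right i j)⟩
  exact hlift.wedge_wedgePow_ne_zero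
    (T := ((1, 0) : ℝ × PhaseSpace (EuclideanSpace ℝ (Fin n))))
    ((dtForm_mk 1 0).trans_ne one_ne_zero) (fun i => dtForm_mk 0 (e i)) fun i => dtForm_mk 0 (f i)

end Volume

/-! ### Time-dependent systems -/

section WedgePreservation

variable {F : Type*} [NormedAddCommGroup F] [NormedSpace ℝ F] {K : Type*} [TopologicalSpace K]
  {J : ModelWithCorners ℝ F K} {N : Type*} [TopologicalSpace N] [ChartedSpace K N]
  {Y : HybridSystem J N} {k l : ℕ} {α : (z : N) → TangentSpace J z [⋀^Fin k]→ₗ[ℝ] ℝ}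
  {β : (z : N) → TangentSpace J z [⋀^Fin l]→ₗ[ℝ] ℝ}
  {σ : (z : N) → TangentSpace J z [⋀^Fin 2]→ₗ[ℝ] ℝ}

theorem HybridSystem.Preserves.wedge (hα : Y.Preserves α) (hβ : Y.Preserves β) :
    Y.Preserves fun z => _root_.wedge (α z) (β z) := by
  intro t U Φ hU hUY hflow hΦ x hx hΦx
  rw [wedge_compLinearMap, hα t U Φ hU hUY hflow hΦ x hx hΦx,
    hβ t U Φ hU hUY hflow hΦ x hx hΦx]

theorem HybridSystem.Preserves.wedgePow (hσ : Y.Preserves σ) (k : ℕ) :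
    Y.Preserves fun z => _root_.wedgePow (σ z) k := by
  intro t U Φ hU hUY hflow hΦ x hx hΦx
  rw [wedgePow_compLinearMap, hσ t U Φ hU hUY hflow hΦ x hx hΦx]

end WedgePreservation

section TimeDependent

open Set Filter Topology

variable {n m : ℕ} {M : Type*} [TopologicalSpace M] [ChartedSpace (EuclideanSpace ℝ (Fin n)) M]
  [IsManifold (𝓡 n) ∞ M]

theorem fst_eq_add_of_isMIntegralCurveOn {X : (q : ℝ × Cotangent n M) → TangentSpace (extModel n) q}
    (hX : ∀ q, dtForm q (X q) = 1) {γ : ℝ → ℝ × Cotangent n M} {t : ℝ} (ht : 0 ≤ t)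
    (hγ : IsMIntegralCurveOn γ X (Icc 0 t)) : (γ t).1 = (γ 0).1 + t := by
  have hderiv : ∀ s ∈ Icc 0 t, HasDerivWithinAt (fun s => (γ s).1 - s) 0 (Icc 0 t) s := by
    intro s hs
    obtain ⟨L, hL, hLone⟩ : ∃ L : ℝ →L[ℝ] ℝ,
        HasFDerivWithinAt (fun s => (γ s).1) L (Icc 0 t) s ∧
          L 1 = dtForm (γ s) ((1 : ℝ) • X (γ s)) :=
      ⟨_, ((mdifferentiableAt_fst (I := 𝓘(ℝ, ℝ)) (I' := cotModel n)
        (x := γ s)).hasMFDerivAt.comp_hasMFDerivWithinAt s (hγ s hs)).hasFDerivWithinAt, rfl⟩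
    refine (hL.hasDerivWithinAt.sub (hasDerivWithinAt_id s (Icc 0 t))).congr_deriv ?_
    rw [sub_eq_zero, hLone, one_smul]
    exact hX _
  have hconst := constant_of_has_deriv_right_zero (fun s hs => (hderiv s hs).continuousWithinAt)
    (fun s hs => (hderiv s ⟨hs.1, hs.2.le⟩).mono_of_mem_nhdsWithin (Icc_mem_nhdsGE_of_mem hs))
    t ⟨ht, le_rfl⟩
  linarith

variable {Y : HybridSystem (extModel n) (ℝ × Cotangent n M)}

theorem HybridSystem.Reaches.fst_eq_add (hX : ∀ q, dtForm q (Y.field q) = 1)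
    (hreset : ∀ q ∈ Y.guard, (Y.reset q).1 = q.1) {t : ℝ} {q q' : ℝ × Cotangent n M}
    (h : Y.Reaches t q q') : q'.1 = q.1 + t := by
  induction h with
  | flow t γ ht hγ => exact fst_eq_add_of_isMIntegralCurveOn hX ht hγ
  | reset τ t γ w hτ _ hγ _ hτS _ ih =>
    rw [ih, hreset _ hτS, fst_eq_add_of_isMIntegralCurveOn hX hτ hγ, add_assoc]

theorem HybridSystem.IsFlowMapOn.fst_eq_add (hX : ∀ q, dtForm q (Y.field q) = 1)
    (hreset : ∀ q ∈ Y.guard, (Y.reset q).1 = q.1) {t : ℝ}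
    {Φ : ℝ × Cotangent n M → ℝ × Cotangent n M} {U : Set (ℝ × Cotangent n M)}
    (hΦ : Y.IsFlowMapOn t Φ U) {q : ℝ × Cotangent n M} (hq : q ∈ U) : (Φ q).1 = q.1 + t := by
  rcases le_or_gt 0 t with ht | ht
  · exact ((hΦ q hq).1 ht).fst_eq_add hX hreset
  · linarith [((hΦ q hq).2 ht).fst_eq_add hX hreset]

theorem dtForm_mfderiv {Φ : ℝ × Cotangent n M → ℝ × Cotangent n M} {x : ℝ × Cotangent n M} {t : ℝ}
    (hΦ : MDifferentiableAt (extModel n) (extModel n) Φ x) (h : ∀ᶠ q in 𝓝 x, (Φ q).1 = q.1 + t)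
    (v : TangentSpace (extModel n) x) :
    dtForm (Φ x) (mfderiv (extModel n) (extModel n) Φ x v) = dtForm x v := by
  have hcomp : HasMFDerivAt (extModel n) 𝓘(ℝ, ℝ) (fun q => (Φ q).1) x
      (dtForm (Φ x) ∘L mfderiv (extModel n) (extModel n) Φ x) :=
    mdifferentiableAt_fst.hasMFDerivAt.comp x hΦ.hasMFDerivAt
  have hadd : HasMFDerivAt (extModel n) 𝓘(ℝ, ℝ) (fun q => q.1 + t) x (dtForm x) :=
    ((hasFDerivAt_id x.1).add_const t).hasMFDerivAt.comp x mdifferentiableAt_fst.hasMFDerivAt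
  exact congrArg (fun L : ℝ × PhaseSpace (EuclideanSpace ℝ (Fin n)) →L[ℝ] ℝ => L v)
    (hasMFDerivAt_unique hcomp (hadd.congr_of_eventuallyEq h))

theorem HybridSystem.preserves_dtForm (hX : ∀ q, dtForm q (Y.field q) = 1)
    (hreset : ∀ q ∈ Y.guard, (Y.reset q).1 = q.1) :
    Y.Preserves fun q => AlternatingMap.ofSubsingleton ℝ (TangentSpace (extModel n) q) ℝ
      (0 : Fin 1) (dtForm q).toLinearMap := by
  intro t U Φ hU _ hflow hΦ x hx _
  have hΦx := (hΦ.contMDiffAt (hU.mem_nhds hx)).mdifferentiableAt (by simp)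
  have hfst := eventually_of_mem (hU.mem_nhds hx) fun q hq => hflow.fst_eq_add hX hreset hq
  exact AlternatingMap.ext fun v => dtForm_mfderiv hΦx hfst (v 0)

theorem contMDiff_extProj :
    ContMDiff (extModel n) (𝓘(ℝ, ℝ).prod (𝓡 n)) ∞ (extProj : ℝ × Cotangent n M → ℝ × M) :=
  contMDiff_fst.prodMk ((contMDiff_cotProj M).comp contMDiff_snd)

namespace TimeHybridControlSystem

variable (C : TimeHybridControlSystem n m M)

theorem mvfderiv_h_comp_extProj {q : ℝ × Cotangent n M} (hq : extProj q ∈ C.W) :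
    mvfderiv (extModel n) (C.h ∘ extProj) q = C.dhPull q := by
  have hh : MDifferentiableAt (𝓘(ℝ, ℝ).prod (𝓡 n)) 𝓘(ℝ, ℝ) C.h (extProj q) :=
    (C.smooth_h.contMDiffAt (C.isOpen_W.mem_nhds hq)).mdifferentiableAt (by simp)
  exact (hh.hasMFDerivAt.comp q
    (contMDiff_extProj.mdifferentiableAt (by simp)).hasMFDerivAt).mfderiv

theorem extendedGuard_eq_crossingSet : C.extendedGuard =
    crossingSet (extModel n) (extHamiltonianField C.H) (extProj ⁻¹' C.W) (C.h ∘ extProj) := by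
  ext q
  constructor
  · rintro ⟨⟨hW, hzero⟩, hpos⟩
    exact ⟨hW, hzero, by rwa [C.mvfderiv_h_comp_extProj hW]⟩
  · rintro ⟨hW, hzero, hpos⟩
    exact ⟨⟨hW, hzero⟩, by rwa [C.mvfderiv_h_comp_extProj hW] at hpos⟩

variable {C} {R : ℝ × Cotangent n M → Cotangent n M}

theorem IsExtendedReset.isActionReset (hR : C.IsExtendedReset R) :
    IsActionReset (extModel n) (actionForm C.H) (extHamiltonianField C.H) (extProj ⁻¹' C.W)
      (C.h ∘ extProj) (timeReset R) where
  isOpen := C.isOpen_W.preimage contMDiff_extProj.continuous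
  smooth_defining := (C.smooth_h.comp contMDiff_extProj.contMDiffOn subset_rfl).of_le (by norm_cast)
  smooth_reset := by
    rw [← C.extendedGuard_eq_crossingSet]
    exact (contMDiff_fst.contMDiffOn.prodMk hR.smooth).of_le (by norm_cast)
  action q hq v hv := by
    rw [C.mvfderiv_h_comp_extProj hq.1] at hv
    rw [← C.extendedGuard_eq_crossingSet] at hq ⊢
    exact hR.action q hq v hv

variable [T2Space M] [SecondCountableTopology M]

theorem IsExtendedReset.preserves_actionTwoForm (hR : C.IsExtendedReset R)
    (hH : ContMDiff (extModel n) 𝓘(ℝ, ℝ) ∞ C.H) :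
    (C.lift R).Preserves fun q => (actionTwoForm C.H q).toAlternatingMap :=
  (C.lift R).preserves_neg_mextDerivOne (isCharacteristic_actionForm hH) hR.isActionReset
    C.extendedGuard_eq_crossingSet

theorem IsExtendedReset.preserves_extLiouvilleForm (hR : C.IsExtendedReset R)
    (hH : ContMDiff (extModel n) 𝓘(ℝ, ℝ) ∞ C.H) :
    (C.lift R).Preserves (extLiouvilleForm C.H) :=
  ((C.lift R).preserves_dtForm (fun _ => dtForm_mk 1 _) fun _ _ => rfl).wedge
    ((hR.preserves_actionTwoForm hH).wedgePow n)

end TimeHybridControlSystem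

end TimeDependent

/-! ### Time-independent systems -/

section Suspension

open Set

variable {F : Type*} [NormedAddCommGroup F] [NormedSpace ℝ F] {K : Type*} [TopologicalSpace K]
  {J : ModelWithCorners ℝ F K} {N : Type*} [TopologicalSpace N] [ChartedSpace K N]
  {Y : HybridSystem J N} {t : ℝ}

/-- The suspension of a hybrid system, which lets time run along an additional factor `ℝ`. -/
def HybridSystem.suspension (Y : HybridSystem J N) : HybridSystem (𝓘(ℝ, ℝ).prod J) (ℝ × N) where
  guard := univ ×ˢ Y.guard
  field := fun q => ((1 : ℝ), Y.field q.2)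
  reset := Prod.map id Y.reset

theorem isMIntegralCurveOn_suspension {X : (z : N) → TangentSpace J z} {γ : ℝ → N} {A : Set ℝ}
    (hγ : IsMIntegralCurveOn γ X A) (s : ℝ) :
    IsMIntegralCurveOn (I := 𝓘(ℝ, ℝ).prod J) (fun r => (s + r, γ r))
      (fun q => ((1 : ℝ), X q.2)) A := by
  intro r hr
  have hadd : HasFDerivWithinAt (fun r : ℝ => s + r) (ContinuousLinearMap.id ℝ ℝ) A r :=
    (hasFDerivWithinAt_id r A).const_add s
  have hprod (a : F) :
      (ContinuousLinearMap.id ℝ ℝ).prod (ContinuousLinearMap.smulRight (1 : ℝ →L[ℝ] ℝ) a) =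
        ContinuousLinearMap.smulRight (1 : ℝ →L[ℝ] ℝ) ((1 : ℝ), a) := by
    ext <;> simp
  exact (hadd.hasMFDerivWithinAt.prodMk (hγ r hr)).congr_mfderiv (hprod (X (γ r)))

theorem HybridSystem.Reaches.suspension {z w : N} (h : Y.Reaches t z w) (s : ℝ) :
    Y.suspension.Reaches t (s, z) (s + t, w) := by
  induction h generalizing s with
  | flow t γ ht hγ hS =>
    have hflow := HybridSystem.Reaches.flow (Y := Y.suspension) t (fun r => (s + r, γ r)) ht
      (isMIntegralCurveOn_suspension hγ s) fun r hr hm => hS r hr hm.2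
    rwa [add_zero] at hflow
  | reset τ t γ w hτ ht hγ hS hτS _ ih =>
    have hreset := HybridSystem.Reaches.reset (Y := Y.suspension) τ t (fun r => (s + r, γ r))
      (s + τ + t, w) hτ ht (isMIntegralCurveOn_suspension hγ s) (fun r hr hm => hS r hr hm.2)
      ⟨mem_univ _, hτS⟩ (ih (s + τ))
    rwa [add_zero, add_assoc] at hreset

theorem HybridSystem.IsFlowMapOn.suspension {Φ : N → N} {U : Set N} (h : Y.IsFlowMapOn t Φ U) :
    Y.suspension.IsFlowMapOn t (fun q => (q.1 + t, Φ q.2)) (univ ×ˢ U) := fun q hq =>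
  ⟨fun ht => ((h q.2 hq.2).1 ht).suspension q.1, fun ht => by
    simpa using ((h q.2 hq.2).2 ht).suspension (q.1 + t)⟩

end Suspension

section TimeIndependent

open Set

variable {n m : ℕ} {M : Type*} [TopologicalSpace M] [ChartedSpace (EuclideanSpace ℝ (Fin n)) M]
  [IsManifold (𝓡 n) ∞ M]

theorem mfderiv_suspension_spaceLift {Φ : Cotangent n M → Cotangent n M} {q : ℝ × Cotangent n M}
    (hΦ : MDifferentiableAt (cotModel n) (cotModel n) Φ q.2) (t : ℝ)
    (v : TangentSpace (cotModel n) q.2) :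
    mfderiv (extModel n) (extModel n) (fun q : ℝ × Cotangent n M => (q.1 + t, Φ q.2)) q
        (spaceLift q v) =
      spaceLift (q.1 + t, Φ q.2) (mfderiv (cotModel n) (cotModel n) Φ q.2 v) := by
  have hadd : HasFDerivAt (fun s : ℝ => s + t) (ContinuousLinearMap.id ℝ ℝ) q.1 :=
    (hasFDerivAt_id q.1).add_const t
  have htime := hadd.hasMFDerivAt.comp q (hasMFDerivAt_fst (I := 𝓘(ℝ, ℝ)) (I' := cotModel n) q)
  have hspace := hΦ.hasMFDerivAt.comp q (hasMFDerivAt_snd (I := 𝓘(ℝ, ℝ)) (I' := cotModel n) q)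
  exact congrArg (fun L : ℝ × PhaseSpace (EuclideanSpace ℝ (Fin n)) →L[ℝ]
    ℝ × PhaseSpace (EuclideanSpace ℝ (Fin n)) => L (0, v)) (htime.prodMk hspace).mfderiv

theorem symplecticForm_compLinearMap_mfderiv_of_suspension {H : ℝ × Cotangent n M → ℝ}
    (hH : ContMDiff (extModel n) 𝓘(ℝ, ℝ) ∞ H) {Φ : Cotangent n M → Cotangent n M}
    {q : ℝ × Cotangent n M} (hΦ : MDifferentiableAt (cotModel n) (cotModel n) Φ q.2) {t : ℝ}
    (h : (actionTwoForm H (q.1 + t, Φ q.2)).toAlternatingMap.compLinearMap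
        (mfderiv (extModel n) (extModel n)
          (fun q : ℝ × Cotangent n M => (q.1 + t, Φ q.2)) q).toLinearMap =
      (actionTwoForm H q).toAlternatingMap) :
    (symplecticForm (Φ q.2)).toAlternatingMap.compLinearMap
        (mfderiv (cotModel n) (cotModel n) Φ q.2).toLinearMap =
      (symplecticForm q.2).toAlternatingMap := by
  refine compLinearMap_eq_iff_apply_pair.2 fun v w => ?_
  have hlift := congrArg₂ (fun a b => actionTwoForm H (q.1 + t, Φ q.2) ![a, b])
    (mfderiv_suspension_spaceLift hΦ t v) (mfderiv_suspension_spaceLift hΦ t w)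
  exact (actionTwoForm_apply_spaceLift (q := (q.1 + t, Φ q.2)) hH _ _).symm.trans <|
    hlift.symm.trans <|
    (compLinearMap_eq_iff_apply_pair.1 h (spaceLift q v) (spaceLift q w)).trans <|
    actionTwoForm_apply_spaceLift hH v w

theorem HybridSystem.preserves_symplecticForm_of_suspension
    {Y : HybridSystem (cotModel n) (Cotangent n M)} {H : ℝ × Cotangent n M → ℝ}
    (hH : ContMDiff (extModel n) 𝓘(ℝ, ℝ) ∞ H)
    (hY : Y.suspension.Preserves fun q => (actionTwoForm H q).toAlternatingMap) :
    Y.Preserves fun z => (symplecticForm z).toAlternatingMap := by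
  intro t U Φ hU hUY hflow hΦ x hx hΦx
  have hsmooth : ContMDiffOn (extModel n) (extModel n) ∞
      (fun q : ℝ × Cotangent n M => (q.1 + t, Φ q.2)) (univ ×ˢ U) :=
    ((contMDiff_id.add contMDiff_const).comp contMDiff_fst).contMDiffOn.prodMk
      (hΦ.comp contMDiff_snd.contMDiffOn fun q hq => hq.2)
  exact symplecticForm_compLinearMap_mfderiv_of_suspension (q := (0, x)) hH
    ((hΦ.contMDiffAt (hU.mem_nhds hx)).mdifferentiableAt (by simp))
    (hY t (univ ×ˢ U) _ (isOpen_univ.prod hU) (hUY.set_prod_right _ _)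
      hflow.suspension hsmooth (0, x) ⟨mem_univ _, hx⟩ fun h => hΦx h.2)

namespace HybridControlSystem

variable (C : HybridControlSystem n m M)

/-- The function `h` that defines the guard, pulled back to `ℝ × T^*M`. -/
def guardFunction (q : ℝ × Cotangent n M) : ℝ := C.h (cotProj q.2)

theorem mvfderiv_guardFunction {q : ℝ × Cotangent n M} (hq : cotProj q.2 ∈ C.W)
    (v : TangentSpace (extModel n) q) :
    mvfderiv (extModel n) C.guardFunction q v = C.dhPull q.2 (spacePart v) := by
  have hh : MDifferentiableAt (𝓡 n) 𝓘(ℝ, ℝ) C.h (cotProj q.2) :=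
    (C.smooth_h.contMDiffAt (C.isOpen_W.mem_nhds hq)).mdifferentiableAt (by simp)
  have hcomp := (hh.hasMFDerivAt.comp q.2 (mdifferentiableAt_cotProj q.2).hasMFDerivAt).comp q
    (mdifferentiableAt_snd (I := 𝓘(ℝ, ℝ)) (I' := cotModel n) (x := q)).hasMFDerivAt
  exact congrArg (fun L : ℝ × PhaseSpace (EuclideanSpace ℝ (Fin n)) →L[ℝ] ℝ => L v) hcomp.mfderiv

theorem prod_extendedGuard_eq_crossingSet : (univ : Set ℝ) ×ˢ C.extendedGuard =
    crossingSet (extModel n) (extHamiltonianField fun q => C.H q.2)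
      {q : ℝ × Cotangent n M | cotProj q.2 ∈ C.W} C.guardFunction := by
  have hderiv : ∀ q : ℝ × Cotangent n M, cotProj q.2 ∈ C.W →
      mvfderiv (extModel n) C.guardFunction q (extHamiltonianField (fun q => C.H q.2) q) =
        C.dhPull q.2 (hamiltonianField C.H q.2) := fun q hq => by
    rw [C.mvfderiv_guardFunction hq, extHamiltonianField, spacePart_mk]
  ext q
  constructor
  · rintro ⟨-, ⟨hW, hzero⟩, hpos⟩
    exact ⟨hW, hzero, by rwa [hderiv q hW]⟩
  · rintro ⟨hW, hzero, hpos⟩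
    exact ⟨mem_univ _, ⟨hW, hzero⟩, by rwa [hderiv q hW] at hpos⟩

variable {C} {R : Cotangent n M → Cotangent n M}

theorem IsExtendedReset.isActionReset (hR : C.IsExtendedReset R) :
    IsActionReset (extModel n) (actionForm fun q => C.H q.2) (extHamiltonianField fun q => C.H q.2)
      {q : ℝ × Cotangent n M | cotProj q.2 ∈ C.W} C.guardFunction (Prod.map id R) where
  isOpen := C.isOpen_W.preimage ((contMDiff_cotProj M).continuous.comp continuous_snd)
  smooth_defining := (C.smooth_h.comp ((contMDiff_cotProj M).comp contMDiff_snd).contMDiffOn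
    subset_rfl).of_le (by norm_cast)
  smooth_reset := by
    rw [← C.prod_extendedGuard_eq_crossingSet]
    exact (contMDiff_fst.contMDiffOn.prodMk
      (hR.smooth.comp contMDiff_snd.contMDiffOn fun q hq => hq.2)).of_le (by norm_cast)
  action q hq v hv := by
    rw [C.mvfderiv_guardFunction hq.1] at hv
    rw [← C.prod_extendedGuard_eq_crossingSet] at hq ⊢
    exact hR.action q.1 q.2 hq.2 v hv

variable [T2Space M] [SecondCountableTopology M]

theorem IsExtendedReset.preserves_symplecticForm (hR : C.IsExtendedReset R)
    (hH : ContMDiff (cotModel n) 𝓘(ℝ, ℝ) ∞ C.H) :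
    (C.lift R).Preserves fun z => (symplecticForm z).toAlternatingMap := by
  have hH' : ContMDiff (extModel n) 𝓘(ℝ, ℝ) ∞ fun q : ℝ × Cotangent n M => C.H q.2 :=
    hH.comp contMDiff_snd
  exact HybridSystem.preserves_symplecticForm_of_suspension hH'
    ((C.lift R).suspension.preserves_neg_mextDerivOne (isCharacteristic_actionForm hH')
      hR.isActionReset C.prod_extendedGuard_eq_crossingSet)

theorem IsExtendedReset.preserves_liouvilleForm (hR : C.IsExtendedReset R)
    (hH : ContMDiff (cotModel n) 𝓘(ℝ, ℝ) ∞ C.H) :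
    (C.lift R).Preserves (liouvilleForm (n := n) (M := M)) :=
  (hR.preserves_symplecticForm hH).wedgePow n

end HybridControlSystem

end TimeIndependent

section InfimumHamiltonian

variable {n m : ℕ} {M : Type*} [TopologicalSpace M] [ChartedSpace (EuclideanSpace ℝ (Fin n)) M]
  [IsManifold (𝓡 n) ∞ M]

theorem HybridControlSystem.IsRegular.isGLB_H {C : HybridControlSystem n m M} (hC : C.IsRegular)
    (z : Cotangent n M) : IsGLB (C.controlHamiltonian z '' C.U) (C.H z) :=
  let ⟨_, hu, hmin⟩ := hC.exists_min z
  isGLB_csInf (Set.Nonempty.image _ ⟨_, hu⟩) ⟨_, Set.forall_mem_image.2 hmin⟩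

theorem TimeHybridControlSystem.IsRegular.isGLB_H {C : TimeHybridControlSystem n m M}
    (hC : C.IsRegular) (q : ℝ × Cotangent n M) :
    IsGLB (C.controlHamiltonian q '' C.U) (C.H q) :=
  let ⟨_, hu, hmin⟩ := hC.exists_min q
  isGLB_csInf (Set.Nonempty.image _ ⟨_, hu⟩) ⟨_, Set.forall_mem_image.2 hmin⟩

end InfimumHamiltonian

theorem mainTheorem1_general {n m : ℕ} {M : Type*} [TopologicalSpace M] [T2Space M]
    [SecondCountableTopology M] [ChartedSpace (EuclideanSpace ℝ (Fin n)) M]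
    [IsManifold (𝓡 n) ∞ M] :
    (∀ (C : HybridControlSystem n m M) (R : Cotangent n M → Cotangent n M),
      (∀ z, IsGLB (C.controlHamiltonian z '' C.U) (C.H z)) →
      ContMDiff (cotModel n) 𝓘(ℝ, ℝ) ∞ C.H → C.IsExtendedReset R →
        (C.lift R).Preserves (fun z => (symplecticForm z).toAlternatingMap) ∧
        IsVolumeForm (cotModel n) (liouvilleForm (n := n) (M := M)) ∧
        (C.lift R).Preserves (liouvilleForm (n := n) (M := M))) ∧
    (∀ (C : TimeHybridControlSystem n m M) (R : ℝ × Cotangent n M → Cotangent n M),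
      (∀ q, IsGLB (C.controlHamiltonian q '' C.U) (C.H q)) →
      ContMDiff (extModel n) 𝓘(ℝ, ℝ) ∞ C.H → C.IsExtendedReset R →
        (C.lift R).Preserves (fun q => (actionTwoForm C.H q).toAlternatingMap) ∧
        IsVolumeForm (extModel n) (extLiouvilleForm C.H) ∧
        (C.lift R).Preserves (extLiouvilleForm C.H)) :=
  ⟨fun _ _ _ hH hR => ⟨hR.preserves_symplecticForm hH, isVolumeForm_liouvilleForm n M,
      hR.preserves_liouvilleForm hH⟩,
    fun _ _ _ hH hR => ⟨hR.preserves_actionTwoForm hH, isVolumeForm_extLiouvilleForm hH,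
      hR.preserves_extLiouvilleForm hH⟩⟩

end

theorem mainTheorem1 {n m : ℕ} {M : Type*} [TopologicalSpace M] [T2Space M]
    [SecondCountableTopology M] [ChartedSpace (EuclideanSpace ℝ (Fin n)) M]
    [IsManifold (𝓡 n) ∞ M] :
    (∀ (C : HybridControlSystem n m M) (R : Cotangent n M → Cotangent n M),
      C.IsRegular → C.IsExtendedReset R →
        (C.lift R).Preserves (fun z => (symplecticForm z).toAlternatingMap) ∧
        IsVolumeForm (cotModel n) (liouvilleForm (n := n) (M := M)) ∧
        (C.lift R).Preserves (liouvilleForm (n := n) (M := M))) ∧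
    (∀ (C : TimeHybridControlSystem n m M) (R : ℝ × Cotangent n M → Cotangent n M),
      C.IsRegular → C.IsExtendedReset R →
        (C.lift R).Preserves (fun q => (actionTwoForm C.H q).toAlternatingMap) ∧
        IsVolumeForm (extModel n) (extLiouvilleForm C.H) ∧
        (C.lift R).Preserves (extLiouvilleForm C.H)) :=
  ⟨fun C R hC => mainTheorem1_general.1 C R hC.isGLB_H hC.smooth_H,
    fun C R hC => mainTheorem1_general.2 C R hC.isGLB_H hC.smooth_H⟩
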